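/- Let $\Gamma$ be a finite connected graph (loops and multiple edges are allowed, and there is no restriction on the valency of vertices) with a basepoint vertex $p$ and with $m\ge 0$ pairwise disjoint distinguished simple cycles $C_1,\dots,C_m$ (a loop is a cycle of length $1$). Let $V$ be the number of vertices of $\Gamma$ and $c$ the number of distinguished cycles that do not contain $p$. Let $d(p,v)$ be the number of edges in a shortest edge path from $p$ to $v$, and $\Lambda_i(\Gamma)=\{v : d(p,v)=i\}$. A vertex $v$ is a base vertex if it lies in some $C_j$ and $d(p,v)\le d(p,w)$ for all vertices $w$ of $C_j$; let $m_i(\Gamma)$ be the number of base vertices in $\Lambda_i(\Gamma)$. A non-empty set $F$ of edges containing no cycle is called a forest; $\Gamma/F$ is the graph obtained by collapsing each tree of $F$ to a point, with the images of $p$ and of the $C_j$ as basepoint and distinguished cycles. A forest $F$ is admissible if every tree $T$ of $F$ meets at most one distinguished cycle, and whenever $T\cap C_j\neq\emptyset$, this intersection is a single vertex or a connected edge path in $C_j$. Let $D(F)$ be the smallest $i$ such that $F$ has a vertex in $\Lambda_i(\Gamma)$. With $i=D(F)$, an admissible forest $F$ is good if either $m_i(\Gamma/F)<m_i(\Gamma)$,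 or $m_i(\Gamma/F)=m_i(\Gamma)$ and no two distinct vertices of $\Lambda_i(\Gamma)$ lie in the same tree of $F$. Let $P(\Gamma)$ be the set of good admissible forests, partially ordered by inclusion. Then the geometric realization of $P(\Gamma)$ is homotopy equivalent to a wedge of finitely many (possibly zero) spheres of dimension $V-c-2$. Here a wedge of zero spheres of dimension $n\ge 0$ is a point; moreover $V-c-2\ge -1$, and if $V-c-2=-1$ the assertion means that $P(\Gamma)$ is empty (the sphere $S^{-1}$). -/

import Mathlib

open scoped Graph ContinuousMap

/-! Finite multigraphs (loops and parallel edges allowed) with a basepoint and disjoint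
distinguished cycles, and the poset of good admissible forests in such a graph. -/

namespace Graph

variable {α β : Type*}

/-- The simple graph with the same adjacencies between distinct vertices. Forgetting loops and
parallel edges changes neither connectivity nor the length of shortest edge paths. -/
def underlying (G : Graph α β) : SimpleGraph α :=
  SimpleGraph.fromRel G.Adj

/-- `x` and `y` can be joined by an edge path in `G`. -/
def Joined (G : Graph α β) (x y : α) : Prop :=
  G.underlying.Reachable x y

/-- The number of edges in a shortest edge path from `x` to `y`
(only used for vertices that can be joined by an edge path). -/
noncomputable def distance (G : Graph α β) (x y : α) : ℕ :=
  G.underlying.dist x y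

/-- `G` is non-empty and any two of its vertices can be joined by an edge path. -/
def IsConnected (G : Graph α β) : Prop :=
  V(G).Nonempty ∧ ∀ x ∈ V(G), ∀ y ∈ V(G), G.Joined x y

/-- `C` is a cycle graph: it consists of `n + 1 ≥ 1` distinct vertices `v 0, …, v n` and of
`n + 1` distinct edges `e 0, …, e n`, where `e i` joins `v i` to `v (i + 1)`, indices being taken
modulo `n + 1`. A loop is a cycle with one edge, two parallel edges are a cycle with two edges. -/
def IsCycleGraph (C : Graph α β) : Prop :=
  ∃ (n : ℕ) (v : Fin (n + 1) → α) (e : Fin (n + 1) → β),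
    Function.Injective v ∧ Function.Injective e ∧
    V(C) = Set.range v ∧ E(C) = Set.range e ∧ ∀ i, C.IsLink (e i) (v i) (v (i + 1))

/-- A set `F` of edges of `G` is a (sub)forest if no cycle of `G` has all its edges in `F`. -/
def IsForest (G : Graph α β) (F : Set β) : Prop :=
  F ⊆ E(G) ∧ ∀ C : Graph α β, C ≤ G.restrict F → ¬ C.IsCycleGraph

/-- The set of vertices that can be joined to `x` by a path with all edges in `F`. For a vertex `x`
and a forest `F` this is the vertex set of the tree of `F` through `x` (or just `{x}`). -/
def component (G : Graph α β) (F : Set β) (x : α) : Set α :=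
  {y | (G.restrict F).Joined x y}

end Graph

/-- A graph with a basepoint and an `m`-tuple of distinguished subgraphs. -/
structure DistinguishedGraph (α β : Type*) (m : ℕ) where
  /-- the graph -/
  graph : Graph α β
  /-- the basepoint -/
  base : α
  /-- the distinguished cycles -/
  cycle : Fin m → Graph α β

namespace DistinguishedGraph

variable {α β : Type*} {m : ℕ}

/-- The graph is connected, the basepoint is one of its vertices, and the distinguished subgraphs
are pairwise disjoint cycles in it. -/
structure IsWellFormed (Γ : DistinguishedGraph α β m) : Prop where
  connected : Γ.graph.IsConnected
  base_mem : Γ.base ∈ V(Γ.graph)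
  cycle_le : ∀ j, Γ.cycle j ≤ Γ.graph
  isCycleGraph : ∀ j, (Γ.cycle j).IsCycleGraph
  disjoint : ∀ j k, j ≠ k → Disjoint V(Γ.cycle j) V(Γ.cycle k)

/-- The number of vertices. -/
noncomputable def numVertices (Γ : DistinguishedGraph α β m) : ℕ :=
  V(Γ.graph).ncard

/-- The number of distinguished cycles that do not contain the basepoint. -/
noncomputable def numCyclesOffBase (Γ : DistinguishedGraph α β m) : ℕ :=
  {j | Γ.base ∉ V(Γ.cycle j)}.ncard

/-- The distance of a vertex from the basepoint. -/
noncomputable def height (Γ : DistinguishedGraph α β m) (v : α) : ℕ :=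
  Γ.graph.distance Γ.base v

/-- The level `Λ i`: the set of vertices at distance `i` from the basepoint. -/
def level (Γ : DistinguishedGraph α β m) (i : ℕ) : Set α :=
  {v | v ∈ V(Γ.graph) ∧ Γ.height v = i}

/-- `v` is a base vertex: it lies in some distinguished cycle and is, among the vertices of
that cycle, at minimal distance from the basepoint. -/
def IsBaseVertex (Γ : DistinguishedGraph α β m) (v : α) : Prop :=
  ∃ j, v ∈ V(Γ.cycle j) ∧ ∀ w ∈ V(Γ.cycle j), Γ.height v ≤ Γ.height w

/-- The number of base vertices in level `i`. -/
noncomputable def numBaseVertices (Γ : DistinguishedGraph α β m) (i : ℕ) : ℕ :=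
  {v | v ∈ Γ.level i ∧ Γ.IsBaseVertex v}.ncard

/-- The blow-down `Γ / F`: the edges of `F` are deleted and each connected component of `F` is
identified to one vertex (a vertex of `Γ / F` is the set of the vertices of `Γ` it comes from).
Its distinguished subgraphs are the images of those of `Γ`. -/
def blowDown (Γ : DistinguishedGraph α β m) (F : Set β) : DistinguishedGraph (Set α) β m where
  graph := (Γ.graph.deleteEdges F).map (Γ.graph.component F)
  base := Γ.graph.component F Γ.base
  cycle j := ((Γ.cycle j).deleteEdges F).map (Γ.graph.component F)

/-- Admissible forests: each tree `T` of the forest meets at most one distinguished cycle, and if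
it meets a distinguished cycle `C`, then any two vertices of `T ∩ C` are joined by a path
with edges in `T ∩ C`. As `T` is a tree, this says that `T ∩ C` is a single vertex or a connected
edge path in `C`. -/
structure IsAdmissible (Γ : DistinguishedGraph α β m) (F : Set β) : Prop where
  isForest : Γ.graph.IsForest F
  eq_of_joined : ∀ j k, ∀ x ∈ V(Γ.cycle j), ∀ y ∈ V(Γ.cycle k),
    (Γ.graph.restrict F).Joined x y → j = k
  joined_in_cycle : ∀ j, ∀ x ∈ V(Γ.cycle j), ∀ y ∈ V(Γ.cycle j),
    (Γ.graph.restrict F).Joined x y → ((Γ.cycle j).restrict F).Joined x y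

/-- The level `D(F)` of a non-empty forest: the smallest distance from the basepoint to a vertex
of an edge of `F`. -/
noncomputable def forestLevel (Γ : DistinguishedGraph α β m) (F : Set β) : ℕ :=
  sInf {i | ∃ e ∈ F, ∃ v, Γ.graph.Inc e v ∧ Γ.height v = i}

/-- The change `m_i(Γ / F) - m_i(Γ)` of the number of base vertices in level `i`. -/
noncomputable def baseChange (Γ : DistinguishedGraph α β m) (i : ℕ) (F : Set β) : ℤ :=
  ((Γ.blowDown F).numBaseVertices i : ℤ) - (Γ.numBaseVertices i : ℤ)

/-- `F` is arced: it connects two different vertices of the level `D(F)`. -/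
def IsArced (Γ : DistinguishedGraph α β m) (F : Set β) : Prop :=
  ∃ x ∈ Γ.level (Γ.forestLevel F), ∃ y ∈ Γ.level (Γ.forestLevel F),
    x ≠ y ∧ (Γ.graph.restrict F).Joined x y

/-- `F` is good: at the level `D(F)` it is base-decreasing, or base-preserving and arc-free. -/
def IsGood (Γ : DistinguishedGraph α β m) (F : Set β) : Prop :=
  Γ.baseChange (Γ.forestLevel F) F < 0 ∨
    (Γ.baseChange (Γ.forestLevel F) F = 0 ∧ ¬ Γ.IsArced F)

/-- The poset `P(Γ)` of good admissible (non-empty) forests, ordered by inclusion. -/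
abbrev GoodForest (Γ : DistinguishedGraph α β m) : Type _ :=
  {F : Set β // F.Nonempty ∧ Γ.IsAdmissible F ∧ Γ.IsGood F}

end DistinguishedGraph

/-- The geometric realization of (the order complex of) a finite poset `P`, in barycentric
coordinates: a point is a convex combination of the elements of a chain, and the topology is the
one induced from `ℝ ^ P`. -/
abbrev PosetRealization (P : Type*) [PartialOrder P] [Finite P] : Type _ :=
  {t : P → ℝ // (∀ a, 0 ≤ t a) ∧ ∑ᶠ a, t a = 1 ∧ IsChain (· ≤ ·) (Function.support t)}

/-- The unit sphere `S ^ n` in `ℝ ^ (n + 1)`. -/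
abbrev UnitSphere (n : ℕ) : Type :=
  Metric.sphere (0 : EuclideanSpace ℝ (Fin (n + 1))) 1

/-- The basepoint `(1, 0, …, 0)` of `S ^ n`. -/
noncomputable def UnitSphere.point (n : ℕ) : UnitSphere n :=
  ⟨EuclideanSpace.single 0 1, by simp⟩

/-- The relation which glues the basepoints of `k` copies of `S ^ n` to one additional point. -/
inductive WedgeRel (n k : ℕ) : Unit ⊕ (Fin k × UnitSphere n) → Unit ⊕ (Fin k × UnitSphere n) → Prop
  | glue (i : Fin k) : WedgeRel n k (Sum.inr (i, UnitSphere.point n)) (Sum.inl ())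

/-- The wedge of `k` copies of `S ^ n`, with the quotient topology. It is a point for `k = 0`. -/
abbrev SphereWedge (n k : ℕ) : Type :=
  Quot (WedgeRel n k)

/-- `X` is homotopy equivalent to a wedge of (finitely many, possibly zero) spheres of dimension
`d ≥ 0`, or `d = -1` and `X` is the sphere `S ^ (-1)`, that is, empty. This is false for
`d < -1`. -/
def IsHomotopyWedgeOfSpheres (X : Type*) [TopologicalSpace X] (d : ℤ) : Prop :=
  (d = -1 ∧ IsEmpty X) ∨ ∃ n k : ℕ, d = (n : ℤ) ∧ Nonempty (X ≃ₕ SphereWedge n k)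

/-! Goodness looks only at the lowest level of a forest. It is replaced by the hereditary condition
`IsTotallyNice`, which is imposed at every level `k` on the edges of height at least `k`: they may
join different vertices of level `k` only if these lie on a common distinguished cycle without
vertices below level `k`, and they may not join any further vertex of level `k` to such a cycle.

Counting base vertices of the blow-down shows that totally nice forests are good
(`IsTotallyNice.isGood`). Conversely, a good forest `F` contains an edge `e` that can be added to
every totally nice `G ⊆ F` (`IsGood.exists_insert`). If `F` is not totally nice itself, then `G ≤ G
∪ {e} ≥ {e}` contracts the totally nice forests below `F`. Hence the poset of good forests collapses
to the poset of totally nice ones when the other forests are removed from the bottom up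
(`goodForests_collapsesTo`).

If some distinguished cycle has an edge without an end of minimal height, let `e` be an edge of this
cycle at a vertex of minimal height. Adding `e` preserves total niceness
(`IsTotallyNice.insert_of_height_ne`), so the poset is contractible. Otherwise (`IsShallow`) the
totally nice forests are the independent sets of a partition matroid: from each distinguished cycle
all edges but one may be taken, and from each vertex off the cycles other than `p` one edge to the
next lower level. The rank is `V - c - 1`, and deletion and contraction show that the order complex
of the non-empty independent sets is spherical of dimension `V - c - 2` (`isSpherical_boundedSets`).

Topologically, an elementary collapse is a deformation retraction. A spherical complex is a
collapsible complex with top-dimensional faces attached; attaching a cone over the collapsible part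
and shrinking this cone to a point gives the wedge of spheres (`IsSpherical.exists_homotopyEquiv`).
All maps and homotopies are explicit in barycentric coordinates. -/

/-! ### Collapses of abstract simplicial complexes, and order complexes -/

section Order

variable {ι : Type*} [PartialOrder ι]

/-- The order complex of a set in a partial order. -/
def orderComplex (Q : Set ι) : Set (Finset ι) :=
  {s | s.Nonempty ∧ (s : Set ι) ⊆ Q ∧ IsChain (· ≤ ·) (s : Set ι)}

/-- The elements of `Q` comparable to `x` and different from `x`. -/
def orderLink (Q : Set ι) (x : ι) : Set ι := {y ∈ Q | y < x ∨ x < y}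

theorem orderComplex_mono {Q R : Set ι} (h : Q ⊆ R) : orderComplex Q ⊆ orderComplex R :=
  fun _ hs => ⟨hs.1, hs.2.1.trans h, hs.2.2⟩

theorem orderComplex_empty : orderComplex (∅ : Set ι) = ∅ := by
  ext s
  simp only [orderComplex, Set.mem_ofPred_eq, Set.mem_empty_iff_false, iff_false]
  rintro ⟨⟨x, hx⟩, h, -⟩
  exact h hx

theorem notMem_of_mem_orderComplex {Q : Set ι} {x : ι} (hx : x ∉ Q) :
    ∀ ρ ∈ orderComplex Q, x ∉ ρ :=
  fun _ hρ h => hx (hρ.2.1 h)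

theorem orderComplex_singleton (m : ι) : orderComplex {m} = {{m}} := by
  ext s
  simp only [orderComplex, Set.mem_ofPred_eq, Set.mem_singleton_iff, Finset.coe_subset_singleton]
  constructor
  · rintro ⟨h1, h2, -⟩
    exact h1.subset_singleton_iff.1 h2
  · rintro rfl
    simp

end Order

section Collapse

variable {ι : Type*} [DecidableEq ι]

/-- `Y` is obtained from the complex `X` by removing a free face `σ` together with the only face
`insert v σ` that properly contains it. -/
def IsElementaryCollapse (X Y : Set (Finset ι)) : Prop :=
  ∃ (σ : Finset ι) (v : ι), σ.Nonempty ∧ v ∉ σ ∧ (∀ ρ ∈ Y, ¬ σ ⊆ ρ) ∧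
    X = insert σ (insert (insert v σ) Y) ∧
    ∀ ρ ⊆ insert v σ, ρ.Nonempty → ¬ σ ⊆ ρ → ρ ∈ Y

/-- `Y` is obtained from `X` by a sequence of elementary collapses. -/
def CollapsesTo (X Y : Set (Finset ι)) : Prop :=
  Relation.ReflTransGen IsElementaryCollapse X Y

/-- `X` collapses to a vertex. -/
def IsCollapsible (X : Set (Finset ι)) : Prop :=
  ∃ w, CollapsesTo X {{w}}

/-- The faces containing `x` of the cone with apex `x` over `L`. -/
def openCone (x : ι) (L : Set (Finset ι)) : Set (Finset ι) :=
  insert {x} (insert x '' L)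

theorem IsElementaryCollapse.subset {X Y : Set (Finset ι)} (h : IsElementaryCollapse X Y) :
    Y ⊆ X := by
  obtain ⟨σ, v, -, -, -, rfl, -⟩ := h
  exact fun ρ hρ => Or.inr (Or.inr hρ)

theorem CollapsesTo.subset {X Y : Set (Finset ι)} (h : CollapsesTo X Y) : Y ⊆ X := by
  induction h with
  | refl => exact subset_rfl
  | tail _ h ih => exact h.subset.trans ih

theorem IsCollapsible.of_collapsesTo {X Y : Set (Finset ι)} (h : CollapsesTo X Y)
    (hY : IsCollapsible Y) : IsCollapsible X :=
  let ⟨w, hw⟩ := hY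
  ⟨w, Relation.ReflTransGen.trans h hw⟩

theorem Finset.eq_or_eq_of_subset_insert {σ ρ : Finset ι} {v : ι} (h1 : σ ⊆ ρ)
    (h2 : ρ ⊆ insert v σ) : ρ = σ ∨ ρ = insert v σ := by
  by_cases hv : v ∈ ρ
  · exact Or.inr (h2.antisymm (Finset.insert_subset hv h1))
  · exact Or.inl (((Finset.subset_insert_iff_of_notMem hv).1 h2).antisymm h1)

/-- Joining with `x` turns the free pair `σ ⊂ insert v σ` of `L` into the free pair `insert x σ ⊂
insert x (insert v σ)`, since the faces through `x` correspond to the faces of `L` and the empty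
face. -/
theorem IsElementaryCollapse.union_openCone {A L L' : Set (Finset ι)} {x : ι}
    (hx : ∀ ρ ∈ A, x ∉ ρ) (hL : L ⊆ A) (h : IsElementaryCollapse L L') :
    IsElementaryCollapse (A ∪ openCone x L) (A ∪ openCone x L') := by
  obtain ⟨σ, v, hσ, hv, hfree, rfl, hsub⟩ := h
  have hσA : σ ∈ A := hL (Or.inl rfl)
  have hτA : insert v σ ∈ A := hL (Or.inr (Or.inl rfl))
  have hxσ : x ∉ σ := hx _ hσA
  have hxτ : x ∉ insert v σ := hx _ hτA
  have hxv : v ≠ x := fun h => hxτ (by simp [h])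
  refine ⟨insert x σ, v, by simp, by simp [hv, hxv], ?_, ?_, ?_⟩
  · rintro ρ (hρ | rfl | ⟨s, hs, rfl⟩) hsub'
    · exact hx _ hρ (hsub' (Finset.mem_insert_self _ _))
    · obtain ⟨y, hy⟩ := hσ
      have := hsub' (Finset.mem_insert_of_mem hy)
      rw [Finset.mem_singleton] at this
      exact hxσ (this ▸ hy)
    · exact hfree s hs ((Finset.insert_subset_insert_iff hxσ).1 hsub')
  · have : insert v (insert x σ) = insert x (insert v σ) := Finset.insert_comm ..
    rw [this]
    simp only [openCone, Set.image_insert_eq]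
    ext ρ
    simp only [Set.mem_union, Set.mem_insert_iff]
    tauto
  · intro ρ hρ hne hσρ
    by_cases hxρ : x ∈ ρ
    · right
      obtain ⟨ρ', hxρ', rfl⟩ : ∃ ρ', x ∉ ρ' ∧ ρ = insert x ρ' :=
        ⟨ρ.erase x, by simp, (Finset.insert_erase hxρ).symm⟩
      rw [Finset.insert_comm, Finset.insert_subset_insert_iff hxρ'] at hρ
      rw [Finset.insert_subset_insert_iff hxσ] at hσρ
      rcases ρ'.eq_empty_or_nonempty with rfl | hne'
      · left; rfl
      · right; exact ⟨ρ', hsub ρ' hρ hne' hσρ, rfl⟩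
    · left
      rw [Finset.insert_comm, Finset.subset_insert_iff_of_notMem hxρ] at hρ
      by_cases hs : σ ⊆ ρ
      · rcases Finset.eq_or_eq_of_subset_insert hs hρ with rfl | rfl <;> assumption
      · exact hL (Or.inr (Or.inr (hsub ρ hρ hne hs)))

theorem CollapsesTo.union_openCone {A L L' : Set (Finset ι)} {x : ι}
    (hx : ∀ ρ ∈ A, x ∉ ρ) (hL : L ⊆ A) (h : CollapsesTo L L') :
    CollapsesTo (A ∪ openCone x L) (A ∪ openCone x L') := by
  induction h with
  | refl => exact .refl
  | tail h1 h2 ih => exact ih.tail (h2.union_openCone hx ((CollapsesTo.subset h1).trans hL))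

/-- A cone attached along a collapsible subcomplex can be collapsed. -/
theorem IsCollapsible.union_openCone_collapsesTo {A L : Set (Finset ι)} {x : ι}
    (hx : ∀ ρ ∈ A, x ∉ ρ) (hL : L ⊆ A) (h : IsCollapsible L) :
    CollapsesTo (A ∪ openCone x L) A := by
  obtain ⟨w, hw⟩ := h
  refine (hw.union_openCone hx hL).tail ?_
  have hwA : {w} ∈ A := hL (CollapsesTo.subset hw rfl)
  have hwx : w ≠ x := fun h => hx _ hwA (by simp [h])
  -- Once `L` has shrunk to the vertex `w`, only the edge from `x` to `w` sticks out of `A`, and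
  -- `{x}` is its free face.
  refine ⟨{x}, w, by simp, by simpa using hwx, ?_, ?_, ?_⟩
  · intro ρ hρ h
    exact hx _ hρ (by simpa using h)
  · ext ρ
    simp only [openCone, Set.image_singleton, Set.mem_union, Set.mem_insert_iff,
      Set.mem_singleton_iff, Finset.pair_comm x w]
    tauto
  · intro ρ hρ hne hxρ
    rw [Finset.singleton_subset_iff] at hxρ
    have h1 : ρ ⊆ {w} := fun y hy => by
      rcases Finset.mem_insert.1 (hρ hy) with h | h
      · simp [h]
      · exact absurd ((Finset.mem_singleton.1 h) ▸ hy) hxρ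
    rw [hne.subset_singleton_iff.1 h1]
    exact hwA

/-- A complex of dimension at most `n - 1` which is empty (`n = 0`) or becomes collapsible after
removal of some faces of dimension `n - 1`. -/
def IsSpherical (n : ℕ) (X : Set (Finset ι)) : Prop :=
  (∀ s ∈ X, s.card ≤ n) ∧ (0 < n → ∃ T ⊆ X, (∀ s ∈ T, s.card = n) ∧ IsCollapsible (X \ T))

theorem IsCollapsible.isSpherical {n : ℕ} {X : Set (Finset ι)} (h : IsCollapsible X)
    (hn : ∀ s ∈ X, s.card ≤ n) : IsSpherical n X :=
  ⟨hn, fun _ => ⟨∅, by simp, by simp, by simpa using h⟩⟩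

/-! ### Building up order complexes one point at a time -/

section Order

variable [PartialOrder ι]

theorem insert_mem_orderComplex {Q : Set ι} {x : ι} {s : Finset ι}
    (hs : s ∈ orderComplex (orderLink Q x)) : insert x s ∈ orderComplex (insert x Q) := by
  refine ⟨by simp, ?_, ?_⟩
  · rw [Finset.coe_insert]
    exact Set.insert_subset_insert fun y hy => (hs.2.1 hy).1
  · rw [Finset.coe_insert]
    exact hs.2.2.insert fun y hy _ => ((hs.2.1 hy).2.symm.imp le_of_lt le_of_lt)

theorem orderComplex_insert (Q : Set ι) (x : ι) :
    orderComplex (insert x Q) =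
      orderComplex Q ∪ openCone x (orderComplex (orderLink Q x)) := by
  ext s
  constructor
  · rintro ⟨hne, hs, hc⟩
    by_cases hxs : x ∈ s
    · right
      obtain ⟨t, hxt, rfl⟩ : ∃ t, x ∉ t ∧ s = insert x t :=
        ⟨s.erase x, by simp, (Finset.insert_erase hxs).symm⟩
      rcases t.eq_empty_or_nonempty with rfl | hne'
      · left; rfl
      · right
        refine ⟨t, ⟨hne', fun y hy => ?_, hc.mono (by simp)⟩, rfl⟩
        have hyx : y ≠ x := fun h => hxt (h ▸ hy)
        have hyQ : y ∈ Q := by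
          rcases hs (Finset.mem_insert_of_mem hy) with h | h
          · exact absurd h hyx
          · exact h
        refine ⟨hyQ, ?_⟩
        rcases hc.total (Finset.mem_insert_of_mem hy) (Finset.mem_insert_self x t) with h | h
        · exact Or.inl (lt_of_le_of_ne h hyx)
        · exact Or.inr (lt_of_le_of_ne h hyx.symm)
    · left
      refine ⟨hne, fun y hy => ?_, hc⟩
      rcases hs hy with h | h
      · exact absurd (h ▸ hy) hxs
      · exact h
  · rintro (hs | rfl | ⟨t, ht, rfl⟩)
    · exact orderComplex_mono (Set.subset_insert _ _) hs
    · refine ⟨by simp, by simp, by simp⟩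
    · exact insert_mem_orderComplex ht

theorem collapsesTo_orderComplex_insert {Q : Set ι} {x : ι} (hx : x ∉ Q)
    (h : IsCollapsible (orderComplex (orderLink Q x))) :
    CollapsesTo (orderComplex (insert x Q)) (orderComplex Q) := by
  rw [orderComplex_insert]
  exact h.union_openCone_collapsesTo (notMem_of_mem_orderComplex hx)
    (orderComplex_mono fun _ h => h.1)

/-- The top faces to be removed are those of `Q` and the joins of `x` with those of the link; the
rest of the cone over the link then collapses away. If `n = 0`, the link is empty and `{x}` itself
is a top face. -/
theorem IsSpherical.orderComplex_insert {n : ℕ} {Q : Set ι} {x : ι} (hx : x ∉ Q)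
    (hQ : IsSpherical (n + 1) (orderComplex Q))
    (hl : IsSpherical n (orderComplex (orderLink Q x))) :
    IsSpherical (n + 1) (orderComplex (insert x Q)) := by
  have hxA := notMem_of_mem_orderComplex hx
  have hxL : ∀ ρ ∈ orderComplex (orderLink Q x), x ∉ ρ :=
    notMem_of_mem_orderComplex fun h => hx h.1
  have hLA : orderComplex (orderLink Q x) ⊆ orderComplex Q := orderComplex_mono fun _ h => h.1
  rw [_root_.orderComplex_insert]
  refine ⟨?_, fun _ => ?_⟩
  · rintro s (hs | rfl | ⟨t, ht, rfl⟩)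
    · exact hQ.1 s hs
    · simp
    · rw [Finset.card_insert_of_notMem (hxL t ht)]
      exact Nat.succ_le_succ (hl.1 t ht)
  · obtain ⟨T, hT, hTn, hTc⟩ := hQ.2 n.succ_pos
    rcases n.eq_zero_or_pos with rfl | hn
    · have hempty : orderComplex (orderLink Q x) = ∅ := by
        refine Set.eq_empty_of_forall_notMem fun s hs => ?_
        have := hl.1 s hs
        exact hs.1.ne_empty (Finset.card_eq_zero.1 (by omega))
      refine ⟨insert {x} T, ?_, ?_, ?_⟩
      · exact Set.insert_subset (Or.inr (Or.inl rfl)) (hT.trans Set.subset_union_left)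
      · rintro s (rfl | hs)
        · simp
        · exact hTn s hs
      · convert hTc using 1
        rw [hempty]
        have : {x} ∉ orderComplex Q := fun h => hxA _ h (by simp)
        ext s
        simp only [openCone, Set.image_empty, Set.mem_sdiff, Set.mem_union, Set.mem_insert_iff,
          Set.mem_empty_iff_false, or_false]
        constructor
        · tauto
        · rintro ⟨h1, h2⟩
          refine ⟨Or.inl h1, ?_⟩
          rintro (rfl | h)
          · exact this h1
          · exact h2 h
    · obtain ⟨U, hU, hUn, hUc⟩ := hl.2 hn
      refine ⟨T ∪ insert x '' U, ?_, ?_, ?_⟩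
      · refine Set.union_subset_union hT ?_
        exact (Set.image_mono hU).trans (Set.subset_insert _ _)
      · rintro s (hs | ⟨t, ht, rfl⟩)
        · exact hTn s hs
        · rw [Finset.card_insert_of_notMem (hxL t (hU ht)), hUn t ht]
      · have key : (orderComplex Q ∪ openCone x (orderComplex (orderLink Q x))) \
            (T ∪ insert x '' U) =
            (orderComplex Q \ T) ∪ openCone x (orderComplex (orderLink Q x) \ U) := by
          ext s
          constructor
          · rintro ⟨hs | rfl | ⟨t, ht, rfl⟩, hs'⟩
            · exact Or.inl ⟨hs, fun h => hs' (Or.inl h)⟩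
            · exact Or.inr (Or.inl rfl)
            · exact Or.inr (Or.inr ⟨t, ⟨ht, fun h => hs' (Or.inr ⟨t, h, rfl⟩)⟩, rfl⟩)
          · rintro (⟨hs, hs'⟩ | rfl | ⟨t, ⟨ht, ht'⟩, rfl⟩)
            · refine ⟨Or.inl hs, ?_⟩
              rintro (h | ⟨t, -, rfl⟩)
              · exact hs' h
              · exact hxA _ hs (by simp)
            · refine ⟨Or.inr (Or.inl rfl), ?_⟩
              rintro (h | ⟨t, ht, h⟩)
              · exact hxA _ (hT h) (by simp)
              · have := (hU ht).1
                obtain ⟨y, hy⟩ := this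
                have h3 : y ∈ ({x} : Finset ι) := h ▸ Finset.mem_insert_of_mem hy
                exact hxL t (hU ht) (Finset.mem_singleton.1 h3 ▸ hy)
            · refine ⟨Or.inr (Or.inr ⟨t, ht, rfl⟩), ?_⟩
              rintro (h | ⟨u, hu, h⟩)
              · exact hxA _ (hT h) (by simp)
              · have : t = u := by
                  rw [← Finset.erase_insert (hxL t ht), ← Finset.erase_insert (hxL u (hU hu)), h]
                exact ht' (this ▸ hu)
        rw [key]
        -- Faces of the link have at most `n` vertices, so none of them belongs to `T`, and the
        -- remaining cone is attached to `orderComplex Q \ T`.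
        refine .of_collapsesTo (hUc.union_openCone_collapsesTo (fun ρ h => hxA ρ h.1) ?_) hTc
        rintro s ⟨hs, -⟩
        refine ⟨hLA hs, fun h => ?_⟩
        have h1 := hTn s h
        have h2 := hl.1 s hs
        omega

variable [Finite ι]

/-- Removing a point `x ≠ m` is a collapse because `m` is again a cone point of the link of `x`. -/
theorem isCollapsible_of_conePoint {Q : Set ι} {m : ι} (hm : m ∈ Q)
    (h : ∀ y ∈ Q, y ≤ m ∨ m ≤ y) : IsCollapsible (orderComplex Q) := by
  induction hn : Q.ncard using Nat.strong_induction_on generalizing Q with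
  | _ n ih =>
    by_cases hQ : ∃ x ∈ Q, x ≠ m
    · obtain ⟨x, hxQ, hxm⟩ := hQ
      have hlt : (Q \ {x}).ncard < n := hn ▸ Set.ncard_sdiff_singleton_lt_of_mem hxQ
      have hx : x ∉ Q \ {x} := by simp
      have hins : insert x (Q \ {x}) = Q := by simp [Set.insert_eq_of_mem hxQ]
      rw [← hins]
      refine .of_collapsesTo (collapsesTo_orderComplex_insert hx ?_) ?_
      · refine ih _ (lt_of_le_of_lt (Set.ncard_le_ncard fun y hy => hy.1) hlt) (Q := orderLink _ x)
          ⟨⟨hm, hxm.symm⟩, ?_⟩ (fun y hy => h y hy.1.1) rfl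
        rcases h x hxQ with h | h
        · exact Or.inr (lt_of_le_of_ne h hxm)
        · exact Or.inl (lt_of_le_of_ne h hxm.symm)
      · exact ih _ hlt ⟨hm, hxm.symm⟩ (fun y hy => h y hy.1) rfl
    · have : Q = {m} := by
        ext y
        push Not at hQ
        exact ⟨hQ y, fun h => h ▸ hm⟩
      subst this
      rw [orderComplex_singleton]
      exact ⟨m, .refl⟩

/-- The points of `P \ Z` are removed from the bottom up: when the turn of `x` comes, only points of
`Z` are left below it while everything above it is still present. This explains the mixed form of
the link. -/
theorem collapsesTo_orderComplex {Z P : Set ι} (hZ : Z ⊆ P)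
    (h : ∀ x ∈ P \ Z, IsCollapsible (orderComplex ({y ∈ Z | y < x} ∪ {y ∈ P | x < y}))) :
    CollapsesTo (orderComplex P) (orderComplex Z) := by
  induction hn : (P \ Z).ncard generalizing P with
  | zero =>
    rw [Set.ncard_eq_zero] at hn
    rw [hZ.antisymm (Set.sdiff_eq_empty.1 hn)]
    exact .refl
  | succ n ih =>
    have hne : (P \ Z).Nonempty := by
      rw [← Set.ncard_pos]; omega
    obtain ⟨x, hx⟩ := (P \ Z).toFinite.exists_minimal hne
    have hxP := hx.1
    have hmin : ∀ y ∈ P \ Z, ¬ y < x := fun y hy hyx => hx.not_lt hy hyx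
    have hins : insert x (P \ {x}) = P := by simp [Set.insert_eq_of_mem hxP.1]
    have hxn : x ∉ P \ {x} := by simp
    have hstep : CollapsesTo (orderComplex P) (orderComplex (P \ {x})) := by
      conv_lhs => rw [← hins]
      refine collapsesTo_orderComplex_insert hxn ?_
      convert h x hxP using 2
      ext y
      constructor
      · rintro ⟨hy, hyx | hyx⟩
        · exact Or.inl ⟨by_contra fun hyZ => hmin y ⟨hy.1, hyZ⟩ hyx, hyx⟩
        · exact Or.inr ⟨hy.1, hyx⟩
      · rintro (⟨hy, hyx⟩ | ⟨hy, hyx⟩)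
        · exact ⟨⟨hZ hy, hyx.ne⟩, Or.inl hyx⟩
        · exact ⟨⟨hy, hyx.ne'⟩, Or.inr hyx⟩
    refine hstep.trans (ih (fun y hy => ⟨hZ hy, fun h => hxP.2 (h ▸ hy)⟩) ?_ ?_)
    · rintro y ⟨⟨hyP, hyx⟩, hyZ⟩
      convert h y ⟨hyP, hyZ⟩ using 4 with z
      ext z
      simp only [Set.mem_sdiff, Set.mem_singleton_iff]
      refine ⟨fun h => ⟨h.1.1, h.2⟩, fun h => ⟨⟨h.1, ?_⟩, h.2⟩⟩
      rintro rfl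
      exact hmin y ⟨hyP, hyZ⟩ h.2
    · have : (P \ {x}) \ Z = (P \ Z) \ {x} := by ext; simp; tauto
      rw [this, Set.ncard_sdiff_singleton_of_mem hxP, hn]
      rfl

/-- The order of removal is that of `collapsesTo_orderComplex`, read backwards: each point of `P \
Z` attaches a cone over a spherical link of one dimension less. -/
theorem isSpherical_orderComplex_of_subset {n : ℕ} {Z P : Set ι} (hZ : Z ⊆ P)
    (hs : IsSpherical (n + 1) (orderComplex Z))
    (h : ∀ x ∈ P \ Z, IsSpherical n (orderComplex ({y ∈ Z | y < x} ∪ {y ∈ P | x < y}))) :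
    IsSpherical (n + 1) (orderComplex P) := by
  induction hn : (P \ Z).ncard generalizing P with
  | zero =>
    rw [Set.ncard_eq_zero] at hn
    rwa [← hZ.antisymm (Set.sdiff_eq_empty.1 hn)]
  | succ k ih =>
    have hne : (P \ Z).Nonempty := by
      rw [← Set.ncard_pos]; omega
    obtain ⟨x, hx⟩ := (P \ Z).toFinite.exists_minimal hne
    have hxP := hx.1
    have hmin : ∀ y ∈ P \ Z, ¬ y < x := fun y hy hyx => hx.not_lt hy hyx
    have hins : insert x (P \ {x}) = P := by simp [Set.insert_eq_of_mem hxP.1]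
    have hxn : x ∉ P \ {x} := by simp
    rw [← hins]
    refine IsSpherical.orderComplex_insert hxn
      (ih (fun y hy => ⟨hZ hy, fun h => hxP.2 (h ▸ hy)⟩) ?_ ?_) ?_
    · rintro y ⟨⟨hyP, hyx⟩, hyZ⟩
      convert h y ⟨hyP, hyZ⟩ using 4 with z
      ext z
      simp only [Set.mem_sdiff, Set.mem_singleton_iff]
      refine ⟨fun h => ⟨h.1.1, h.2⟩, fun h => ⟨⟨h.1, ?_⟩, h.2⟩⟩
      rintro rfl
      exact hmin y ⟨hyP, hyZ⟩ h.2
    · have : (P \ {x}) \ Z = (P \ Z) \ {x} := by ext; simp; tauto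
      rw [this, Set.ncard_sdiff_singleton_of_mem hxP, hn]
      rfl
    · convert h x hxP using 2
      ext y
      constructor
      · rintro ⟨hy, hyx | hyx⟩
        · exact Or.inl ⟨by_contra fun hyZ => hmin y ⟨hy.1, hyZ⟩ hyx, hyx⟩
        · exact Or.inr ⟨hy.1, hyx⟩
      · rintro (⟨hy, hyx⟩ | ⟨hy, hyx⟩)
        · exact ⟨⟨hZ hy, hyx.ne⟩, Or.inl hyx⟩
        · exact ⟨⟨hy, hyx.ne'⟩, Or.inr hyx⟩

end Order

/-- The inequalities `y ≤ y ⊔ a ≥ a` contract `Q` to `a`. In terms of collapses, a maximal `x` among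
the elements not above `a` has `x ⊔ a` as a cone point of its link; when no such `x` is left, `a` is
the minimum. -/
theorem isCollapsible_of_sup_mem {ι : Type*} [DecidableEq ι] [SemilatticeSup ι] [Finite ι]
    {Q : Set ι} {a : ι} (ha : a ∈ Q) (h : ∀ y ∈ Q, y ⊔ a ∈ Q) :
    IsCollapsible (orderComplex Q) := by
  induction hn : {y ∈ Q | ¬ a ≤ y}.ncard generalizing Q with
  | zero =>
    rw [Set.ncard_eq_zero] at hn
    refine isCollapsible_of_conePoint ha fun y hy => Or.inr (by_contra fun h' => ?_)
    exact (Set.eq_empty_iff_forall_notMem.1 hn y) ⟨hy, h'⟩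
  | succ n ih =>
    have hne : {y ∈ Q | ¬ a ≤ y}.Nonempty := by
      rw [← Set.ncard_pos]; omega
    obtain ⟨x, hx⟩ := (Set.toFinite {y ∈ Q | ¬ a ≤ y}).exists_maximal hne
    obtain ⟨hxQ, hax⟩ := hx.1
    have hins : insert x (Q \ {x}) = Q := by simp [Set.insert_eq_of_mem hxQ]
    have hxn : x ∉ Q \ {x} := by simp
    have hlt : x < x ⊔ a := left_lt_sup.2 hax
    rw [← hins]
    refine .of_collapsesTo (collapsesTo_orderComplex_insert hxn ?_) (ih ?_ ?_ ?_)
    · refine isCollapsible_of_conePoint (m := x ⊔ a) ⟨⟨h x hxQ, hlt.ne'⟩, Or.inr hlt⟩ ?_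
      rintro y ⟨hy, hyx | hyx⟩
      · exact Or.inl (hyx.le.trans le_sup_left)
      · refine Or.inr (sup_le hyx.le (by_contra fun hay => ?_))
        exact hx.not_gt ⟨hy.1, hay⟩ hyx
    · exact ⟨ha, fun h => hax (le_of_eq h)⟩
    · exact fun y hy => ⟨h y hy.1, fun h => hax ((le_sup_right (a := y)).trans (le_of_eq h))⟩
    · have : {y ∈ Q \ {x} | ¬ a ≤ y} = {y ∈ Q | ¬ a ≤ y} \ {x} := by ext; simp; tauto
      rw [this, Set.ncard_sdiff_singleton_of_mem hx.1, hn]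
      rfl

end Collapse

/-! ### Partition matroids -/

section Partition

variable {β B : Type*}

/-- The sets `F` with `G ⊂ F ⊆ E` which contain at most `k b` elements of each block `b`. -/
def boundedSets (blk : β → B) (k : B → ℕ) (G E : Set β) : Set (Set β) :=
  {F | G ⊂ F ∧ F ⊆ E ∧ ∀ b, (F ∩ blk ⁻¹' {b}).ncard ≤ k b}

theorem ncard_insert_inter_preimage_of_ne {blk : β → B} (F : Set β) {e : β} {b : B}
    (h : blk e ≠ b) : (insert e F ∩ blk ⁻¹' {b}).ncard = (F ∩ blk ⁻¹' {b}).ncard := by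
  rw [Set.insert_inter_of_notMem (by simpa using h)]

variable [Finite β]

theorem ncard_insert_inter_preimage_self {blk : β → B} (F : Set β) {e : β} (he : e ∉ F) :
    (insert e F ∩ blk ⁻¹' {blk e}).ncard = (F ∩ blk ⁻¹' {blk e}).ncard + 1 := by
  rw [Set.insert_inter_of_mem (by simp), Set.ncard_insert_of_notMem (fun h => he h.1)]

theorem ncard_eq_sum_inter_preimage [Fintype B] (blk : β → B) (F : Set β) :
    F.ncard = ∑ b, (F ∩ blk ⁻¹' {b}).ncard := by
  induction F, F.toFinite using Set.Finite.induction_on with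
  | empty => simp
  | @insert e F he _ ih =>
    classical
    rw [Set.ncard_insert_of_notMem he, ih, ← Finset.add_sum_erase _ _ (Finset.mem_univ (blk e)),
      ← Finset.add_sum_erase (a := blk e) Finset.univ
        (fun b => (insert e F ∩ blk ⁻¹' {b}).ncard) (Finset.mem_univ _),
      ncard_insert_inter_preimage_self F he]
    have : ∑ b ∈ Finset.univ.erase (blk e), (insert e F ∩ blk ⁻¹' {b}).ncard =
        ∑ b ∈ Finset.univ.erase (blk e), (F ∩ blk ⁻¹' {b}).ncard :=
      Finset.sum_congr rfl fun b hb =>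
        ncard_insert_inter_preimage_of_ne F (Finset.ne_of_mem_erase hb).symm
    rw [this]
    omega

/-- Cardinalities strictly increase along a chain, and only `n` values are available. -/
theorem card_le_of_mem_orderComplex {Q : Set (Set β)} {g n : ℕ}
    (h : ∀ F ∈ Q, g < F.ncard ∧ F.ncard ≤ g + n) : ∀ s ∈ orderComplex Q, s.card ≤ n := by
  classical
  intro s hs
  have hinj : Set.InjOn Set.ncard (s : Set (Set β)) := by
    intro F hF F' hF' hFF
    rcases hs.2.2.total hF hF' with h | h
    · exact Set.eq_of_subset_of_ncard_le h hFF.ge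
    · exact (Set.eq_of_subset_of_ncard_le h hFF.le).symm
  rw [← Finset.card_image_of_injOn hinj]
  have : s.image Set.ncard ⊆ Finset.Ioc g (g + n) := by
    intro i hi
    obtain ⟨F, hF, rfl⟩ := Finset.mem_image.1 hi
    have := h F (hs.2.1 hF)
    exact Finset.mem_Ioc.2 this
  simpa using Finset.card_le_card this

/-- Deletion and contraction of an element `e` of `E \ G`. If `G` already fills the block of `e`,
then `e` never occurs. If the block has no more elements than its capacity, then `e` can be added to
every set and the poset is contractible. Otherwise the sets avoiding `e` form a poset of the same
rank with smaller `E`, to which the sets containing `e` are attached. -/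
theorem isSpherical_boundedSets [DecidableEq (Set β)] [Fintype B] (blk : β → B) (k : B → ℕ)
    (G E : Set β) (n : ℕ) (hGE : G ⊆ E) (hG : ∀ b, (G ∩ blk ⁻¹' {b}).ncard ≤ k b)
    (hE : ∀ b, k b ≤ (E ∩ blk ⁻¹' {b}).ncard) (hn : G.ncard + n = ∑ b, k b) :
    IsSpherical n (orderComplex (boundedSets blk k G E)) := by
  induction hN : (E \ G).ncard using Nat.strong_induction_on generalizing G E n with
  | _ N ih =>
  have hcard : ∀ F ∈ boundedSets blk k G E, G.ncard < F.ncard ∧ F.ncard ≤ G.ncard + n := by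
    intro F hF
    refine ⟨Set.ncard_lt_ncard hF.1, ?_⟩
    rw [hn, ncard_eq_sum_inter_preimage blk F]
    exact Finset.sum_le_sum fun b _ => hF.2.2 b
  have hdim := card_le_of_mem_orderComplex hcard
  by_cases hEG : E ⊆ G
  · have : boundedSets blk k G E = ∅ := by
      refine Set.eq_empty_of_forall_notMem fun F hF => ?_
      exact hF.1.2 (hF.2.1.trans hEG)
    have hn0 : n = 0 := by
      have h1 := ncard_eq_sum_inter_preimage blk E
      have h2 := Finset.sum_le_sum (s := Finset.univ) fun b _ => hE b
      have h3 := Set.ncard_le_ncard hEG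
      omega
    subst hn0
    rw [this, orderComplex_empty]
    exact ⟨by simp, by simp⟩
  obtain ⟨e, heE, heG⟩ := Set.not_subset.1 hEG
  have hmem : e ∈ E \ G := ⟨heE, heG⟩
  have hlt : ((E \ {e}) \ G).ncard < N := by
    rw [← hN]
    exact Set.ncard_lt_ncard ⟨fun x hx => ⟨hx.1.1, hx.2⟩, fun h => (h hmem).1.2 rfl⟩
  have hGE' : G ⊆ E \ {e} := fun x hx => ⟨hGE hx, fun h => heG (h ▸ hx)⟩
  have hEe : insert e (E \ {e}) = E := by simp [Set.insert_eq_of_mem heE]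
  have hE1 := ncard_insert_inter_preimage_self (blk := blk) (E \ {e}) (e := e) (by simp)
  rw [hEe] at hE1
  have hE2 : ∀ b, blk e ≠ b → ((E \ {e}) ∩ blk ⁻¹' {b}).ncard = (E ∩ blk ⁻¹' {b}).ncard := by
    intro b hb
    rw [← ncard_insert_inter_preimage_of_ne (E \ {e}) hb, hEe]
  have hins : ∀ F ∈ boundedSets blk k G E, (F ∩ blk ⁻¹' {blk e}).ncard < k (blk e) →
      insert e F ∈ boundedSets blk k G E := by
    refine fun F hF hlt => ⟨hF.1.trans_subset (Set.subset_insert _ _),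
      Set.insert_subset heE hF.2.1, fun b => ?_⟩
    by_cases heF : e ∈ F
    · rw [Set.insert_eq_of_mem heF]; exact hF.2.2 b
    by_cases hb : blk e = b
    · subst hb
      rw [ncard_insert_inter_preimage_self F heF]
      exact hlt
    · rw [ncard_insert_inter_preimage_of_ne F hb]
      exact hF.2.2 b
  rcases eq_or_lt_of_le (hG (blk e)) with h1 | h1
  · have : boundedSets blk k G E = boundedSets blk k G (E \ {e}) := by
      ext F
      refine ⟨fun hF => ⟨hF.1, fun x hx => ⟨hF.2.1 hx, ?_⟩, hF.2.2⟩,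
        fun hF => ⟨hF.1, hF.2.1.trans Set.sdiff_subset, hF.2.2⟩⟩
      rintro rfl
      have h2 : insert x G ⊆ F := Set.insert_subset hx hF.1.1
      have h3 := Set.ncard_le_ncard (Set.inter_subset_inter_left (blk ⁻¹' {blk x}) h2)
      rw [ncard_insert_inter_preimage_self G heG] at h3
      have := hF.2.2 (blk x)
      omega
    rw [this]
    refine ih _ hlt G (E \ {e}) n hGE' hG (fun b => ?_) hn rfl
    by_cases hb : blk e = b
    · subst hb
      rw [← h1]
      exact Set.ncard_le_ncard (Set.inter_subset_inter_left _ hGE')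
    · rw [hE2 b hb]
      exact hE b
  · have hG' : ∀ b, (insert e G ∩ blk ⁻¹' {b}).ncard ≤ k b := by
      intro b
      by_cases hb : blk e = b
      · subst hb
        rw [ncard_insert_inter_preimage_self G heG]
        exact h1
      · rw [ncard_insert_inter_preimage_of_ne G hb]
        exact hG b
    have heGm : insert e G ∈ boundedSets blk k G E :=
      ⟨Set.ssubset_insert heG, Set.insert_subset heE hGE, hG'⟩
    rcases eq_or_lt_of_le (hE (blk e)) with h2 | h2
    · refine IsCollapsible.isSpherical (isCollapsible_of_sup_mem heGm fun F hF => ?_) hdim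
      have : F ⊔ insert e G = insert e F := by
        change F ∪ insert e G = insert e F
        rw [Set.union_insert, Set.union_eq_left.2 hF.1.1]
      rw [this]
      by_cases heF : e ∈ F
      · rwa [Set.insert_eq_of_mem heF]
      refine hins F hF ?_
      have h3 := Set.ncard_le_ncard (Set.inter_subset_inter_left (blk ⁻¹' {blk e})
        (Set.insert_subset heE hF.2.1))
      rw [ncard_insert_inter_preimage_self F heF] at h3
      omega
    · have hn' : 0 < n := by
        have := hcard _ heGm
        omega
      obtain ⟨n, rfl⟩ : ∃ l, n = l + 1 := ⟨n - 1, by omega⟩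
      refine isSpherical_orderComplex_of_subset (Z := boundedSets blk k G (E \ {e}))
        (fun F hF => ⟨hF.1, hF.2.1.trans Set.sdiff_subset, hF.2.2⟩)
        (ih _ hlt G (E \ {e}) (n + 1) hGE' hG (fun b => ?_) hn rfl) ?_
      · by_cases hb : blk e = b
        · subst hb
          omega
        · rw [hE2 b hb]
          exact hE b
      · rintro F ⟨hF, hFZ⟩
        have heF : e ∈ F := by
          by_contra heF
          exact hFZ ⟨hF.1, fun x hx => ⟨hF.2.1 hx, fun h => heF (h ▸ hx)⟩, hF.2.2⟩
        -- Nothing lies below `insert e G`, and above it lies the contraction of `e`, of rank one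
        -- less. For every other `F` the set `F \ {e}` belongs to the deletion and is a cone point
        -- of the mixed link.
        by_cases hFG : F = insert e G
        · subst hFG
          have hset : {H ∈ boundedSets blk k G (E \ {e}) | H < insert e G} ∪
              {H ∈ boundedSets blk k G E | insert e G < H} =
              boundedSets blk k (insert e G) E := by
            ext H
            constructor
            · rintro (⟨hH, hHe⟩ | ⟨hH, hHe⟩)
              · refine absurd ?_ hH.1.2
                intro x hx
                rcases hHe.1 hx with rfl | h
                · exact absurd rfl (hH.2.1 hx).2
                · exact h
              · exact ⟨hHe, hH.2⟩
            · intro hH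
              exact Or.inr ⟨⟨(Set.ssubset_insert heG).trans hH.1, hH.2⟩, hH.1⟩
          rw [hset]
          refine ih _ ?_ (insert e G) E n hF.2.1 hG' hE ?_ rfl
          · rw [← hN]
            exact Set.ncard_lt_ncard ⟨fun x hx => ⟨hx.1, fun h => hx.2 (Or.inr h)⟩,
              fun h => (h hmem).2 (Or.inl rfl)⟩
          · rw [Set.ncard_insert_of_notMem heG]
            omega
        · have hGF : G ⊂ F \ {e} := by
            refine ⟨fun x hx => ⟨hF.1.1 hx, fun h => heG (h ▸ hx)⟩, fun h => hFG ?_⟩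
            refine Set.Subset.antisymm (fun x hx => ?_) (Set.insert_subset heF hF.1.1)
            by_cases hxe : x = e
            · exact Or.inl hxe
            · exact Or.inr (h ⟨hx, hxe⟩)
          have hFe : F \ {e} < F := ⟨Set.sdiff_subset, fun h => (h heF).2 rfl⟩
          refine IsCollapsible.isSpherical (isCollapsible_of_conePoint (m := F \ {e}) ?_ ?_) ?_
          · refine Or.inl ⟨⟨hGF, fun x hx => ⟨hF.2.1 hx.1, hx.2⟩, fun b => ?_⟩, hFe⟩
            exact (Set.ncard_le_ncard (Set.inter_subset_inter_left _ Set.sdiff_subset)).trans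
              (hF.2.2 b)
          · rintro H (⟨hH, hHF⟩ | ⟨hH, hHF⟩)
            · exact Or.inl fun x hx => ⟨hHF.1 hx, (hH.2.1 hx).2⟩
            · exact Or.inr (hFe.le.trans hHF.le)
          · intro s hs
            have h3 : s ∈ orderComplex (orderLink (boundedSets blk k G E) F) := by
              refine orderComplex_mono ?_ hs
              rintro H (⟨hH, hHF⟩ | ⟨hH, hHF⟩)
              · exact ⟨⟨hH.1, hH.2.1.trans Set.sdiff_subset, hH.2.2⟩, Or.inl hHF⟩
              · exact ⟨hH, Or.inr hHF⟩
            have h4 := hdim _ (Set.insert_eq_of_mem hF ▸ insert_mem_orderComplex h3)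
            rw [Finset.card_insert_of_notMem] at h4
            · omega
            · intro h
              have := (h3.2.1 h).2
              simp at this

end Partition

/-! ### Geometric realizations -/

section Realization

variable {ι : Type*}

/-- The smallest value of `t` on `σ` (zero if `σ` is empty). -/
noncomputable def infOn (σ : Finset ι) (t : ι → ℝ) : ℝ :=
  if h : σ.Nonempty then σ.inf' h t else 0

theorem infOn_le {σ : Finset ι} {a : ι} (ha : a ∈ σ) (t : ι → ℝ) : infOn σ t ≤ t a := by
  rw [infOn, dif_pos ⟨a, ha⟩]
  exact Finset.inf'_le _ ha

theorem exists_infOn_eq {σ : Finset ι} (h : σ.Nonempty) (t : ι → ℝ) : ∃ a ∈ σ, infOn σ t = t a := by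
  rw [infOn, dif_pos h]
  exact Finset.exists_mem_eq_inf' h t

theorem infOn_nonneg {σ : Finset ι} {t : ι → ℝ} (ht : ∀ a, 0 ≤ t a) : 0 ≤ infOn σ t := by
  by_cases h : σ.Nonempty
  · obtain ⟨a, -, ha⟩ := exists_infOn_eq h t
    exact ha ▸ ht a
  · rw [infOn, dif_neg h]

theorem infOn_eq_zero {σ : Finset ι} {t : ι → ℝ} (ht : ∀ a, 0 ≤ t a) {a : ι} (ha : a ∈ σ)
    (h0 : t a = 0) : infOn σ t = 0 :=
  le_antisymm (h0 ▸ infOn_le ha t) (infOn_nonneg ht)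

theorem continuous_infOn (σ : Finset ι) : Continuous (infOn σ) := by
  by_cases h : σ.Nonempty
  · have : infOn σ = fun t => σ.inf' h (fun a => t a) := by
      ext t
      rw [infOn, dif_pos h]
    rw [this]
    exact Continuous.finset_inf'_apply h fun a _ => continuous_apply a
  · have : infOn σ = fun _ => 0 := by
      ext t
      rw [infOn, dif_neg h]
    rw [this]
    exact continuous_const

section

variable [DecidableEq ι]

/-- Moves a point away from the face `σ` towards the vertex `v`. -/
noncomputable def pushOff (σ : Finset ι) (v : ι) (s : ℝ) (t : ι → ℝ) : ι → ℝ := fun a =>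
  t a - s * infOn σ t * (if a ∈ σ then 1 else 0) + s * infOn σ t * σ.card * (if a = v then 1 else 0)

theorem continuous_pushOff (σ : Finset ι) (v : ι) :
    Continuous fun p : ℝ × (ι → ℝ) => pushOff σ v p.1 p.2 := by
  have := (continuous_infOn σ).comp (continuous_snd (X := ℝ) (Y := ι → ℝ))
  refine continuous_pi fun a => ?_
  simp only [pushOff]
  simp only [Function.comp_def] at this
  fun_prop

theorem pushOff_zero (σ : Finset ι) (v : ι) (t : ι → ℝ) : pushOff σ v 0 t = t := by
  ext a; simp [pushOff]

theorem pushOff_of_infOn_eq_zero {σ : Finset ι} (v : ι) (s : ℝ) {t : ι → ℝ} (h : infOn σ t = 0) :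
    pushOff σ v s t = t := by
  ext a; simp [pushOff, h]

theorem pushOff_nonneg {σ : Finset ι} (v : ι) {s : ℝ} (hs : s ∈ Set.Icc (0 : ℝ) 1) {t : ι → ℝ}
    (ht : ∀ a, 0 ≤ t a) (a : ι) : 0 ≤ pushOff σ v s t a := by
  have hm := infOn_nonneg (σ := σ) ht
  have h1 : 0 ≤ s * infOn σ t * σ.card * (if a = v then 1 else 0) := by
    have := hs.1
    split_ifs <;> positivity
  have h2 : s * infOn σ t * (if a ∈ σ then 1 else 0) ≤ t a := by
    split_ifs with h
    · have := infOn_le h t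
      nlinarith [hs.1, hs.2]
    · simpa using ht a
  rw [pushOff]
  linarith

end

variable [Fintype ι]

/-- The support of a function on a finite type, as a finset. -/
noncomputable def funSupport (t : ι → ℝ) : Finset ι := {a | t a ≠ 0}

@[simp]
theorem mem_funSupport {t : ι → ℝ} {a : ι} : a ∈ funSupport t ↔ t a ≠ 0 := by
  simp [funSupport]

theorem funSupport_nonempty {t : ι → ℝ} (h : ∑ a, t a = 1) : (funSupport t).Nonempty := by
  by_contra hne
  rw [Finset.not_nonempty_iff_eq_empty, Finset.eq_empty_iff_forall_notMem] at hne
  have h0 : ∀ a, t a = 0 := fun a => by simpa using hne a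
  simp [h0] at h

/-- The geometric realization of a simplicial complex, in barycentric coordinates. -/
def realization (X : Set (Finset ι)) : Set (ι → ℝ) :=
  {t | (∀ a, 0 ≤ t a) ∧ ∑ a, t a = 1 ∧ funSupport t ∈ X}

theorem realization_mono {X Y : Set (Finset ι)} (h : X ⊆ Y) : realization X ⊆ realization Y :=
  fun _ ht => ⟨ht.1, ht.2.1, h ht.2.2⟩

theorem infOn_eq_zero_of_not_subset {σ : Finset ι} {t : ι → ℝ} (ht : ∀ a, 0 ≤ t a)
    (h : ¬ σ ⊆ funSupport t) : infOn σ t = 0 := by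
  obtain ⟨a, ha, hat⟩ := Finset.not_subset.1 h
  exact infOn_eq_zero ht ha (by simpa using hat)

theorem infOn_pos {σ : Finset ι} (hσ : σ.Nonempty) {t : ι → ℝ} (ht : ∀ a, 0 ≤ t a)
    (h : σ ⊆ funSupport t) : 0 < infOn σ t := by
  obtain ⟨a, ha, hat⟩ := exists_infOn_eq hσ t
  exact hat ▸ lt_of_le_of_ne (ht a) (Ne.symm (by simpa using h ha))

variable [DecidableEq ι]

theorem sum_pushOff (σ : Finset ι) (v : ι) (s : ℝ) (t : ι → ℝ) :
    ∑ a, pushOff σ v s t a = ∑ a, t a := by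
  simp only [pushOff, Finset.sum_add_distrib, Finset.sum_sub_distrib, ← Finset.mul_sum]
  simp

theorem funSupport_pushOff_subset {σ : Finset ι} {v : ι} {s : ℝ} {t : ι → ℝ}
    (ht : funSupport t ⊆ insert v σ) : funSupport (pushOff σ v s t) ⊆ insert v σ := by
  intro a ha
  by_contra h
  have h0 : t a = 0 := by
    by_contra h'
    exact h (ht (by simpa using h'))
  rw [Finset.mem_insert, not_or] at h
  simp [pushOff, h0, h.1, h.2] at ha

theorem pushOff_mem {X Y : Set (Finset ι)} {σ : Finset ι} {v : ι}
    (hfree : ∀ ρ ∈ Y, ¬ σ ⊆ ρ) (hX : X = insert σ (insert (insert v σ) Y))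
    (hsub : ∀ ρ ⊆ insert v σ, ρ.Nonempty → ¬ σ ⊆ ρ → ρ ∈ Y) {s : ℝ}
    (hs : s ∈ Set.Icc (0 : ℝ) 1) {t : ι → ℝ} (ht : t ∈ realization X) :
    pushOff σ v s t ∈ realization X := by
  by_cases hY : funSupport t ∈ Y
  · rwa [pushOff_of_infOn_eq_zero v s (infOn_eq_zero_of_not_subset ht.1 (hfree _ hY))]
  refine ⟨pushOff_nonneg v hs ht.1, (sum_pushOff ..).trans ht.2.1, ?_⟩
  have h1 : funSupport t ⊆ insert v σ := by
    rcases hX ▸ ht.2.2 with h | h | h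
    · exact h ▸ Finset.subset_insert _ _
    · exact h ▸ subset_rfl
    · exact absurd h hY
  have h2 := funSupport_pushOff_subset (s := s) h1
  rw [hX]
  by_cases h3 : σ ⊆ funSupport (pushOff σ v s t)
  · rcases Finset.eq_or_eq_of_subset_insert h3 h2 with h | h
    · exact Or.inl h
    · exact Or.inr (Or.inl h)
  · exact Or.inr (Or.inr (hsub _ h2
      (funSupport_nonempty ((sum_pushOff ..).trans ht.2.1)) h3))

/-- At time one the smallest coordinate on `σ` has been reduced to zero, so the support no longer
contains `σ`. -/
theorem pushOff_one_mem {X Y : Set (Finset ι)} {σ : Finset ι} {v : ι} (hσ : σ.Nonempty)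
    (hv : v ∉ σ) (hfree : ∀ ρ ∈ Y, ¬ σ ⊆ ρ) (hX : X = insert σ (insert (insert v σ) Y))
    (hsub : ∀ ρ ⊆ insert v σ, ρ.Nonempty → ¬ σ ⊆ ρ → ρ ∈ Y)
    {t : ι → ℝ} (ht : t ∈ realization X) :
    pushOff σ v 1 t ∈ realization Y := by
  have h1 := pushOff_mem hfree hX hsub (s := 1) (by simp) ht
  refine ⟨h1.1, h1.2.1, ?_⟩
  have h3 : ¬ σ ⊆ funSupport (pushOff σ v 1 t) := by
    intro h
    obtain ⟨a, ha, hat⟩ := exists_infOn_eq hσ t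
    have hav : a ≠ v := fun h => hv (h ▸ ha)
    have := h ha
    simp [pushOff, ha, hav, hat] at this
  have h2 := h1.2.2
  rw [hX] at h2
  rcases h2 with h | h | h
  · exact absurd h.ge h3
  · exact absurd ((Finset.subset_insert _ _).trans h.ge) h3
  · exact h

/-- `pushOff` takes the same amount from all coordinates on `σ` and gives it to `v`. Over `Y` some
coordinate on `σ` vanishes and nothing moves, so this is a deformation retraction. -/
theorem IsElementaryCollapse.nonempty_homotopyEquiv {X Y : Set (Finset ι)}
    (h : IsElementaryCollapse X Y) : Nonempty (realization X ≃ₕ realization Y) := by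
  have hYX := realization_mono h.subset
  obtain ⟨σ, v, hσ, hv, hfree, hX, hsub⟩ := h
  have hc := continuous_pushOff σ v
  let r : C(realization X, realization Y) :=
    ⟨fun t => ⟨pushOff σ v 1 t, pushOff_one_mem hσ hv hfree hX hsub t.2⟩, by
      refine Continuous.subtype_mk ?_ _
      exact hc.comp (continuous_const.prodMk continuous_subtype_val)⟩
  let i : C(realization Y, realization X) := ⟨fun t => ⟨t, hYX t.2⟩, by fun_prop⟩
  let H : (ContinuousMap.id (realization X)).Homotopy (i.comp r) :=
    { toFun := fun p => ⟨pushOff σ v p.1 p.2, pushOff_mem hfree hX hsub p.1.2 p.2.2⟩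
      continuous_toFun := by
        refine Continuous.subtype_mk ?_ _
        exact hc.comp ((continuous_subtype_val.comp continuous_fst).prodMk
          (continuous_subtype_val.comp continuous_snd))
      map_zero_left := fun t => Subtype.ext (pushOff_zero σ v t)
      map_one_left := fun t => rfl }
  have hri : r.comp i = ContinuousMap.id _ := by
    ext1 t
    exact Subtype.ext (pushOff_of_infOn_eq_zero v 1
      (infOn_eq_zero_of_not_subset t.2.1 (hfree _ t.2.2.2)))
  exact ⟨⟨r, i, ⟨H.symm⟩, hri ▸ ContinuousMap.Homotopic.refl _⟩⟩

theorem CollapsesTo.nonempty_homotopyEquiv {X Y : Set (Finset ι)} (h : CollapsesTo X Y) :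
    Nonempty (realization X ≃ₕ realization Y) := by
  induction h with
  | refl => exact ⟨.refl _⟩
  | tail _ h ih =>
    obtain ⟨f⟩ := ih
    obtain ⟨g⟩ := h.nonempty_homotopyEquiv
    exact ⟨f.trans g⟩

theorem isCompact_realization {X : Set (Finset ι)}
    (hX : ∀ s ∈ X, ∀ ρ ⊆ s, ρ.Nonempty → ρ ∈ X) : IsCompact (realization X) := by
  have hfin : X.Finite := Set.toFinite X
  have : realization X = ⋃ s ∈ X, (stdSimplex ℝ ι ∩ {t | ∀ a ∉ s, t a = 0}) := by
    ext t
    simp only [Set.mem_iUnion, exists_prop]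
    constructor
    · intro ht
      exact ⟨_, ht.2.2, ⟨ht.1, ht.2.1⟩, fun a ha => by simpa using ha⟩
    · rintro ⟨s, hs, ⟨h1, h2⟩, h3⟩
      refine ⟨h1, h2, hX s hs _ (fun a ha => ?_) (funSupport_nonempty h2)⟩
      by_contra has
      simp [h3 a has] at ha
  rw [this]
  refine hfin.isCompact_biUnion fun s _ => (isCompact_stdSimplex ℝ ι).inter_right ?_
  simp only [Set.ofPred_forall]
  exact isClosed_iInter fun a => isClosed_iInter fun _ =>
    isClosed_eq (continuous_apply a) continuous_const

end Realization

/-- A continuous surjection `q` from a compact space onto a Hausdorff space is a homotopy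
equivalence if the identity can be deformed, compatibly with the fibres of `q`, to a map which is
constant on the fibres of `q`. -/
theorem nonempty_homotopyEquiv_of_surjective {X W : Type*} [TopologicalSpace X]
    [TopologicalSpace W] [CompactSpace X] [T2Space W] (q : C(X, W)) (hq : Function.Surjective q)
    (H : C(unitInterval × X, X)) (h0 : ∀ t, H (0, t) = t)
    (h1 : ∀ t t', q t = q t' → H (1, t) = H (1, t'))
    (hs : ∀ s t t', q t = q t' → q (H (s, t)) = q (H (s, t'))) : Nonempty (X ≃ₕ W) := by
  have hquot : Topology.IsQuotientMap q :=
    (q.continuous.isClosedMap).isQuotientMap q.continuous hq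
  let H1 : C(X, X) := H.comp ((ContinuousMap.const X 1).prodMk (ContinuousMap.id X))
  let g : C(W, X) := hquot.lift H1 h1
  have hg : ∀ t, g (q t) = H (1, t) := fun t =>
    DFunLike.congr_fun (hquot.lift_comp H1 h1) t
  -- The product map is again a closed surjection, from a compact to a Hausdorff space, hence a
  -- quotient map; so the homotopy descends to `W`.
  let qI : C(unitInterval × X, unitInterval × W) := (ContinuousMap.id _).prodMap q
  have hqI : Topology.IsQuotientMap qI :=
    (qI.continuous.isClosedMap).isQuotientMap qI.continuous
      (Function.Surjective.prodMap Function.surjective_id hq)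
  have hK : ∀ a b, qI a = qI b → (q.comp H) a = (q.comp H) b := by
    rintro ⟨s, t⟩ ⟨s', t'⟩ h
    obtain ⟨h1, h2⟩ := Prod.mk.inj h
    obtain rfl : s = s' := h1
    exact hs s t t' h2
  let K : C(unitInterval × W, W) := hqI.lift (q.comp H) hK
  have hKq : ∀ s t, K (s, q t) = q (H (s, t)) := fun s t =>
    DFunLike.congr_fun (hqI.lift_comp (q.comp H) hK) (s, t)
  have A : (ContinuousMap.id X).Homotopy (g.comp q) :=
    { toContinuousMap := H
      map_zero_left := h0
      map_one_left := fun t => (hg t).symm }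
  have B : (ContinuousMap.id W).Homotopy (q.comp g) :=
    { toContinuousMap := K
      map_zero_left := fun w => by
        obtain ⟨t, rfl⟩ := hq w
        exact (hKq 0 t).trans (congrArg q (h0 t))
      map_one_left := fun w => by
        obtain ⟨t, rfl⟩ := hq w
        exact (hKq 1 t).trans (congrArg q (hg t).symm) }
  exact ⟨⟨q, g, ⟨A.symm⟩, ⟨B.symm⟩⟩⟩

/-! ### The wedge of spheres as a subspace of a product of spheres -/

section Wedge

variable {n k : ℕ}

/-- The `i`-th coordinate collapses all spheres of the wedge except the `i`-th one. -/
noncomputable def SphereWedge.coord : SphereWedge n k → Fin k → UnitSphere n :=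
  Quot.lift (fun p i => Sum.elim (fun _ => UnitSphere.point n)
    (fun p => if p.1 = i then p.2 else UnitSphere.point n) p) (by
    rintro _ _ ⟨j⟩
    ext1 i
    simp)

theorem SphereWedge.continuous_coord : Continuous (SphereWedge.coord (n := n) (k := k)) := by
  refine continuous_quot_lift _ (continuous_pi fun i => ?_)
  refine Continuous.sumElim continuous_const ?_
  refine continuous_prod_of_discrete_left.2 fun j => ?_
  by_cases h : j = i
  · simpa [h] using continuous_id'
  · simpa [h] using continuous_const

theorem SphereWedge.coord_injective : Function.Injective (SphereWedge.coord (n := n) (k := k)) := by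
  have hinl : ∀ (i : Fin k) (z : UnitSphere n), (∀ j, (if i = j then z else UnitSphere.point n) =
      UnitSphere.point n) → (Quot.mk (WedgeRel n k) (Sum.inr (i, z))) = Quot.mk _ (Sum.inl ()) := by
    intro i z h
    have := h i
    rw [if_pos rfl] at this
    rw [this]
    exact Quot.sound (.glue i)
  rintro ⟨⟨⟩ | ⟨i, z⟩⟩ ⟨⟨⟩ | ⟨i', z'⟩⟩ h
  · rfl
  · exact (hinl i' z' fun j => (congrFun h j).symm).symm
  · exact hinl i z fun j => congrFun h j
  · by_cases hii : i = i'
    · subst hii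
      have := congrFun h i
      simp only [SphereWedge.coord, Sum.elim_inr, if_true] at this
      rw [this]
    · have h1 := congrFun h i
      have h2 := congrFun h i'
      simp only [SphereWedge.coord, Sum.elim_inr, if_true, if_neg hii, if_neg (Ne.symm hii)]
        at h1 h2
      rw [h1, ← h2]
      exact (Quot.sound (.glue i)).trans (Quot.sound (.glue i')).symm

instance : T2Space (SphereWedge n k) :=
  T2Space.of_injective_continuous SphereWedge.coord_injective SphereWedge.continuous_coord

/-- The wedge is compact and injects continuously into a Hausdorff product, so its quotient topology
is induced by the coordinates. -/
theorem SphereWedge.continuous_iff {X : Type*} [TopologicalSpace X] {q : X → SphereWedge n k} :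
    Continuous q ↔ Continuous fun x => SphereWedge.coord (q x) :=
  (SphereWedge.continuous_coord.isClosedEmbedding SphereWedge.coord_injective).isEmbedding
    |>.continuous_iff

end Wedge

/-! ### Collapsing the boundary of a simplex -/

section Chart

variable {ι : Type*} {n : ℕ}

/-- The squared distance of the first vertex coordinate to the others, corrected by the mass
outside of the simplex. -/
noncomputable def chartSq (f : Fin (n + 1) ↪ ι) (t : ι → ℝ) : ℝ :=
  ∑ j, (t (f j) - t (f 0)) ^ 2 + (1 - ∑ j, t (f j))

/-- The normalized smallest barycentric coordinate in a simplex. -/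
noncomputable def chartMin (f : Fin (n + 1) ↪ ι) (t : ι → ℝ) : ℝ :=
  (n + 1) * infOn (Finset.univ.map f) t

/-- The map of a simplex to a sphere which collapses the boundary: inverse stereographic
projection applied to the differences of barycentric coordinates divided by the smallest one. -/
noncomputable def chartVec (f : Fin (n + 1) ↪ ι) (t : ι → ℝ) : EuclideanSpace ℝ (Fin (n + 1)) :=
  WithLp.toLp 2 fun j => (4 * chartMin f t * (t (f j) - t (f 0)) +
    (chartSq f t - 4 * chartMin f t ^ 2) * (if j = 0 then 1 else 0)) /
    (chartSq f t + 4 * chartMin f t ^ 2)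

theorem exists_chartMin_eq (f : Fin (n + 1) ↪ ι) (t : ι → ℝ) :
    ∃ i, chartMin f t = (n + 1) * t (f i) ∧ ∀ j, t (f i) ≤ t (f j) := by
  obtain ⟨a, ha, hat⟩ := exists_infOn_eq (σ := Finset.univ.map f) (by simp) t
  obtain ⟨i, -, rfl⟩ := Finset.mem_map.1 ha
  exact ⟨i, by rw [chartMin, hat], fun j => hat ▸ infOn_le (by simp) t⟩

theorem continuous_chartMin (f : Fin (n + 1) ↪ ι) : Continuous (chartMin f) :=
  continuous_const.mul (continuous_infOn _)

theorem continuous_chartSq (f : Fin (n + 1) ↪ ι) : Continuous (chartSq f) := by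
  unfold chartSq
  fun_prop

theorem chartSq_eq {f : Fin (n + 1) ↪ ι} {t : ι → ℝ} (h : ∑ j, t (f j) = 1) :
    chartSq f t = ∑ j, (t (f j) - t (f 0)) ^ 2 := by
  simp [chartSq, h]

variable [Fintype ι]

theorem sum_embedding_le {f : Fin (n + 1) ↪ ι} {t : ι → ℝ} (ht : ∀ a, 0 ≤ t a) :
    ∑ j, t (f j) ≤ ∑ a, t a := by
  rw [← Finset.sum_map Finset.univ f t]
  exact Finset.sum_le_sum_of_subset_of_nonneg (Finset.subset_univ _) fun a _ _ => ht a

theorem sum_embedding_eq {f : Fin (n + 1) ↪ ι} {t : ι → ℝ}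
    (h : ∀ a ∉ Finset.univ.map f, t a = 0) : ∑ j, t (f j) = ∑ a, t a := by
  rw [← Finset.sum_map Finset.univ f t]
  exact Finset.sum_subset (Finset.subset_univ _) fun a _ ha => h a ha

/-- A vanishing denominator would make the coordinates on the simplex all equal, with sum one and
minimum zero. The summand `1 - ∑ j, t (f j)` of `chartSq` is what rules out points whose coordinates
on the simplex all vanish. -/
theorem chart_denom_pos {f : Fin (n + 1) ↪ ι} {t : ι → ℝ} (ht : ∀ a, 0 ≤ t a)
    (h1 : ∑ a, t a = 1) : 0 < chartSq f t + 4 * chartMin f t ^ 2 := by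
  have hle := h1 ▸ sum_embedding_le (f := f) ht
  have hsq : 0 ≤ ∑ j, (t (f j) - t (f 0)) ^ 2 := Finset.sum_nonneg fun j _ => sq_nonneg _
  by_contra hneg
  have hS : chartSq f t = ∑ j, (t (f j) - t (f 0)) ^ 2 + (1 - ∑ j, t (f j)) := rfl
  have hL := sq_nonneg (chartMin f t)
  have h2 : ∑ j, (t (f j) - t (f 0)) ^ 2 = 0 := by linarith
  have h3 : ∑ j, t (f j) = 1 := by linarith
  have h4 : chartMin f t ^ 2 = 0 := by linarith
  rw [Finset.sum_eq_zero_iff_of_nonneg fun j _ => sq_nonneg _] at h2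
  have h5 : ∀ j, t (f j) = t (f 0) := fun j => by
    have := h2 j (Finset.mem_univ j)
    rw [sq_eq_zero_iff] at this
    linarith
  obtain ⟨i, hi, -⟩ := exists_chartMin_eq f t
  rw [sq_eq_zero_iff, hi, h5] at h4
  simp only [h5, Finset.sum_const, Finset.card_univ, Fintype.card_fin, nsmul_eq_mul] at h3
  push_cast at h3
  linarith

/-- If the simplex carries all the mass and `y` is the vector of the `(t (f j) - t (f 0)) / L` with
`L = chartMin f t`, then `chartVec` is inverse stereographic projection `(4y + (|y|² - 4)e₀) / (|y|²
+ 4)`, and `16|y|² + (|y|² - 4)² = (|y|² + 4)²`. Numerator and denominator are multiplied by `L²`,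
so that the formula extends to `L = 0` with the constant value `e₀`. -/
theorem norm_chartVec {f : Fin (n + 1) ↪ ι} {t : ι → ℝ} (ht : ∀ a, 0 ≤ t a)
    (h1 : ∑ a, t a = 1) (h : chartMin f t = 0 ∨ ∑ j, t (f j) = 1) : ‖chartVec f t‖ = 1 := by
  have hD := chart_denom_pos (f := f) ht h1
  rw [EuclideanSpace.norm_eq, Real.sqrt_eq_one]
  simp only [chartVec, Real.norm_eq_abs, sq_abs, div_pow]
  rw [← Finset.sum_div, div_eq_one_iff_eq (by positivity)]
  set L := chartMin f t
  set S := chartSq f t with hS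
  have : ∀ j, (4 * L * (t (f j) - t (f 0)) + (S - 4 * L ^ 2) * (if j = 0 then 1 else 0)) ^ 2 =
      16 * L ^ 2 * (t (f j) - t (f 0)) ^ 2 + (S - 4 * L ^ 2) ^ 2 * (if j = 0 then 1 else 0) := by
    intro j
    by_cases hj : j = 0
    · subst hj; simp
    · simp only [if_neg hj]; ring
  simp only [this, Finset.sum_add_distrib, ← Finset.mul_sum]
  simp only [Finset.sum_ite_eq', Finset.mem_univ, if_true, mul_one]
  rcases h with h | h
  · rw [show L = 0 from h]; ring
  · rw [← chartSq_eq h, ← hS]; ring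

theorem chartVec_eq_of_chartMin_eq_zero {f : Fin (n + 1) ↪ ι} {t : ι → ℝ} (ht : ∀ a, 0 ≤ t a)
    (h1 : ∑ a, t a = 1) (h : chartMin f t = 0) : chartVec f t = EuclideanSpace.single 0 1 := by
  have hD := chart_denom_pos (f := f) ht h1
  simp only [h] at hD
  ext j
  simp only [chartVec, h]
  by_cases hj : j = 0
  · subst hj
    simp at hD ⊢
    exact hD.ne'
  · simp [hj]

/-- The stereographic coordinates of a point of the sphere. -/
noncomputable def stereoCoord (z : EuclideanSpace ℝ (Fin (n + 1))) (j : Fin (n + 1)) : ℝ :=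
  if j = 0 then 0 else 2 * z j / (1 - z 0)

theorem one_sub_chartVec_zero {f : Fin (n + 1) ↪ ι} {t : ι → ℝ} (ht : ∀ a, 0 ≤ t a)
    (h1 : ∑ a, t a = 1) : 1 - chartVec f t 0 =
      8 * chartMin f t ^ 2 / (chartSq f t + 4 * chartMin f t ^ 2) := by
  have hD := chart_denom_pos (f := f) ht h1
  simp only [chartVec]
  field_simp
  simp
  ring

theorem sub_eq_chartMin_mul_stereoCoord {f : Fin (n + 1) ↪ ι} {t : ι → ℝ} (ht : ∀ a, 0 ≤ t a)
    (h1 : ∑ a, t a = 1) (h : 0 < chartMin f t) (j : Fin (n + 1)) :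
    t (f j) - t (f 0) = chartMin f t * stereoCoord (chartVec f t) j := by
  have hD := chart_denom_pos (f := f) ht h1
  by_cases hj : j = 0
  · simp [stereoCoord, hj]
  rw [stereoCoord, if_neg hj, one_sub_chartVec_zero ht h1]
  simp only [chartVec, if_neg hj, mul_zero, add_zero]
  generalize chartSq f t + 4 * chartMin f t ^ 2 = D at hD
  field_simp
  ring

/-- Stereographic coordinates give the differences of the barycentric coordinates in units of `L =
chartMin f t`, and the smallest coordinate is `L / (n + 1)`. So they determine `t` up to a factor,
which is fixed by the total mass. -/
theorem chartVec_injOn {f : Fin (n + 1) ↪ ι} {t t' : ι → ℝ} (ht : ∀ a, 0 ≤ t a)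
    (h1 : ∑ a, t a = 1) (h : 0 < chartMin f t) (h0 : ∀ a ∉ Finset.univ.map f, t a = 0)
    (ht' : ∀ a, 0 ≤ t' a) (h1' : ∑ a, t' a = 1) (h' : 0 < chartMin f t')
    (h0' : ∀ a ∉ Finset.univ.map f, t' a = 0) (heq : chartVec f t = chartVec f t') : t = t' := by
  have e := sub_eq_chartMin_mul_stereoCoord ht h1 h
  have e' := sub_eq_chartMin_mul_stereoCoord ht' h1' h'
  rw [← heq] at e'
  obtain ⟨i, hi, hmin⟩ := exists_chartMin_eq f t
  obtain ⟨i', hi', hmin'⟩ := exists_chartMin_eq f t'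
  have s1 := sum_embedding_eq h0
  have s1' := sum_embedding_eq h0'
  rw [h1] at s1
  rw [h1'] at s1'
  set L := chartMin f t
  set L' := chartMin f t'
  set w := stereoCoord (chartVec f t)
  have hw : w i = w i' := by
    apply le_antisymm
    · have := hmin i'
      have a1 := e i
      have a2 := e i'
      have : L * w i ≤ L * w i' := by linarith
      exact le_of_mul_le_mul_left this h
    · have := hmin' i
      have a1 := e' i
      have a2 := e' i'
      have : L' * w i' ≤ L' * w i := by linarith
      exact le_of_mul_le_mul_left this h'
  have key : ∀ j, L' * t (f j) = L * t' (f j) := by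
    intro j
    have a1 := e i
    have a2 := e j
    have b1 := e' i'
    have b2 := e' j
    rw [← hw] at b1
    have c1 : t (f j) = t (f i) + L * (w j - w i) := by linarith
    have c2 : t' (f j) = t' (f i') + L' * (w j - w i) := by linarith
    have hn : (n + 1 : ℝ) ≠ 0 := by positivity
    have d : L' * t (f i) = L * t' (f i') := by
      rw [hi, hi']; ring
    rw [c1, c2]
    linear_combination d
  have hL : L' = L := by
    have := Finset.sum_congr rfl fun j (_ : j ∈ Finset.univ) => key j
    rw [← Finset.mul_sum, ← Finset.mul_sum, s1, s1'] at this
    simpa using this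
  ext a
  by_cases ha : a ∈ Finset.univ.map f
  · obtain ⟨j, -, rfl⟩ := Finset.mem_map.1 ha
    have := key j
    rw [hL] at this
    exact mul_left_cancel₀ h.ne' this
  · rw [h0 a ha, h0' a ha]

theorem exists_chartVec_eq (f : Fin (n + 1) ↪ ι) {z : EuclideanSpace ℝ (Fin (n + 1))}
    (hz : ‖z‖ = 1) (hz0 : z ≠ EuclideanSpace.single 0 1) :
    ∃ t : ι → ℝ, (∀ a, 0 ≤ t a) ∧ ∑ a, t a = 1 ∧ funSupport t = Finset.univ.map f ∧
      chartVec f t = z := by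
  have hsq : ∑ j, z j ^ 2 = 1 := by
    rw [EuclideanSpace.norm_eq, Real.sqrt_eq_one] at hz
    simpa using hz
  have hsplit := Finset.add_sum_erase Finset.univ (fun j => z j ^ 2) (Finset.mem_univ 0)
  rw [hsq] at hsplit
  simp only at hsplit
  have hnn : 0 ≤ ∑ j ∈ Finset.univ.erase 0, z j ^ 2 := Finset.sum_nonneg fun j _ => sq_nonneg _
  have hz1 : 0 < 1 - z 0 := by
    have hle : z 0 ≤ 1 := by nlinarith
    rcases hle.lt_or_eq with h | h
    · linarith
    · exfalso
      have h2 : ∑ j ∈ Finset.univ.erase 0, z j ^ 2 = 0 := by rw [h] at hsplit; linarith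
      rw [Finset.sum_eq_zero_iff_of_nonneg fun j _ => sq_nonneg _] at h2
      refine hz0 ?_
      ext j
      by_cases hj : j = 0
      · subst hj; simpa using h
      · simpa [hj] using h2 j (by simp [hj])
  set w := stereoCoord z with hwdef
  have hw0 : w 0 = 0 := by simp [hwdef, stereoCoord]
  have hwj : ∀ j, j ≠ 0 → w j * (1 - z 0) = 2 * z j := fun j hj => by
    rw [hwdef, stereoCoord, if_neg hj]; field_simp
  have hwsq : (∑ j, w j ^ 2) * (1 - z 0) = 4 * (1 + z 0) := by
    have h3 : (∑ j, w j ^ 2) * (1 - z 0) ^ 2 = 4 * ∑ j ∈ Finset.univ.erase 0, z j ^ 2 := by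
      rw [← Finset.add_sum_erase _ _ (Finset.mem_univ 0), hw0, Finset.mul_sum, add_mul,
        Finset.sum_mul]
      simp only [ne_eq, OfNat.ofNat_ne_zero, not_false_eq_true, zero_pow, zero_mul, zero_add]
      refine Finset.sum_congr rfl fun j hj => ?_
      rw [← mul_pow, hwj j (Finset.ne_of_mem_erase hj)]
      ring
    have h4 : (∑ j, w j ^ 2) * (1 - z 0) * (1 - z 0) = 4 * (1 + z 0) * (1 - z 0) := by
      linear_combination h3 + 4 * hsplit
    exact mul_right_cancel₀ hz1.ne' h4
  obtain ⟨i, hi⟩ := Finite.exists_min w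
  have hn : (0 : ℝ) < n + 1 := by positivity
  -- `g` has the prescribed differences and the smallest coordinate `1 / (n + 1)`, which corresponds
  -- to `chartMin` equal to one; division by its mass `G` gives `t`.
  set g : Fin (n + 1) → ℝ := fun j => 1 / (n + 1) + (w j - w i) with hg
  have hgpos : ∀ j, 0 < g j := fun j => by
    have := hi j
    have h5 : (0 : ℝ) < 1 / (n + 1) := by positivity
    simp only [hg]; linarith
  set G := ∑ j, g j with hG
  have hGpos : 0 < G := Finset.sum_pos (fun j _ => hgpos j) Finset.univ_nonempty
  set t : ι → ℝ := Function.extend f (fun j => g j / G) 0 with htdef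
  have htf : ∀ j, t (f j) = g j / G := fun j => f.injective.extend_apply _ _ j
  have ht0 : ∀ a ∉ Finset.univ.map f, t a = 0 := fun a ha => by
    refine Function.extend_apply' _ _ a ?_
    rintro ⟨j, rfl⟩
    simp at ha
  have htnn : ∀ a, 0 ≤ t a := fun a => by
    by_cases ha : a ∈ Finset.univ.map f
    · obtain ⟨j, -, rfl⟩ := Finset.mem_map.1 ha
      rw [htf]
      exact (div_pos (hgpos j) hGpos).le
    · rw [ht0 a ha]
  have hsum' : ∑ j, t (f j) = 1 := by
    simp only [htf, ← Finset.sum_div]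
    exact div_self hGpos.ne'
  have hsum : ∑ a, t a = 1 := (sum_embedding_eq ht0).symm.trans hsum'
  refine ⟨t, htnn, hsum, ?_, ?_⟩
  · ext a
    rw [mem_funSupport]
    constructor
    · intro h
      by_contra ha
      exact h (ht0 a ha)
    · intro ha
      obtain ⟨j, -, rfl⟩ := Finset.mem_map.1 ha
      rw [htf]
      exact (div_pos (hgpos j) hGpos).ne'
  · have hL : chartMin f t = 1 / G := by
      obtain ⟨i', hi1, hi2⟩ := exists_chartMin_eq f t
      have e1 : t (f i') = t (f i) := by
        refine le_antisymm (hi2 i) ?_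
        rw [htf, htf]
        refine div_le_div_of_nonneg_right ?_ hGpos.le
        have := hi i'
        simp only [hg]; linarith
      rw [hi1, e1, htf]
      simp only [hg, sub_self, add_zero]
      field_simp
    have hy : ∀ j, t (f j) - t (f 0) = 1 / G * w j := fun j => by
      rw [htf, htf]
      simp only [hg, hw0]
      field_simp
      ring
    have hS : chartSq f t = (1 / G) ^ 2 * ∑ j, w j ^ 2 := by
      rw [chartSq_eq hsum', Finset.mul_sum]
      exact Finset.sum_congr rfl fun j _ => by rw [hy, mul_pow]
    set Q := ∑ j, w j ^ 2 with hQ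
    have hQ0 : 0 ≤ Q := Finset.sum_nonneg fun j _ => sq_nonneg _
    ext j
    simp only [chartVec, hL, hy, hS]
    have hden : (1 / G) ^ 2 * Q + 4 * (1 / G) ^ 2 ≠ 0 := by positivity
    rw [div_eq_iff hden]
    by_cases hj : j = 0
    · subst hj
      simp only [hw0, if_true]
      linear_combination (1 / G) ^ 2 * hwsq
    · simp only [if_neg hj]
      have h6 := hwj j hj
      have h7 : (Q + 4) * (1 - z 0) = 8 := by linear_combination hwsq
      have h8 : 4 * w j = z j * (Q + 4) := by
        have : 4 * w j * (1 - z 0) = z j * (Q + 4) * (1 - z 0) := by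
          linear_combination 4 * h6 - z j * h7
        exact mul_right_cancel₀ hz1.ne' this
      linear_combination (1 / G) ^ 2 * h8

end Chart

/-! ### Spherical complexes are wedges of spheres -/

section Flow

variable {ι : Type*} [DecidableEq ι]

/-- The unnormalized flow which pushes the faces in `T` off their barycentres and moves the
boundaries of these faces to the vertex `x`. -/
noncomputable def flowNum (T : Finset (Finset ι)) (x : ι) (c s : ℝ) (t : ι → ℝ) (a : ι) : ℝ :=
  max (1 - s) (∑ σ ∈ T, infOn σ t) *
      (t a - ∑ σ ∈ T, min (infOn σ t) (s * c) * (if a ∈ σ then 1 else 0)) +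
    max (s * c - ∑ σ ∈ T, infOn σ t) 0 * (if a = x then 1 else 0)

theorem continuous_flowNum (T : Finset (Finset ι)) (x : ι) (c : ℝ) (a : ι) :
    Continuous fun p : ℝ × (ι → ℝ) => flowNum T x c p.1 p.2 a := by
  have h : ∀ σ : Finset ι, Continuous fun p : ℝ × (ι → ℝ) => infOn σ p.2 := fun σ =>
    (continuous_infOn σ).comp continuous_snd
  unfold flowNum
  fun_prop

theorem flowNum_of_infOn_eq_zero {T : Finset (Finset ι)} (x : ι) {c s : ℝ} (hc : 0 < c)
    (hs : s ∈ Set.Icc (0 : ℝ) 1) {t : ι → ℝ} (h : ∀ σ ∈ T, infOn σ t = 0) (a : ι) :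
    flowNum T x c s t a = (1 - s) * t a + s * c * (if a = x then 1 else 0) := by
  have h1 : ∑ σ ∈ T, infOn σ t = 0 := Finset.sum_eq_zero h
  have hsc : 0 ≤ s * c := mul_nonneg hs.1 hc.le
  have h2 : ∑ σ ∈ T, min (infOn σ t) (s * c) * (if a ∈ σ then (1 : ℝ) else 0) = 0 :=
    Finset.sum_eq_zero fun σ hσ => by rw [h σ hσ, min_eq_left hsc, zero_mul]
  have h3 : (0 : ℝ) ≤ 1 - s := by linarith [hs.2]
  rw [flowNum, h1, h2, max_eq_left h3, sub_zero, sub_zero, max_eq_left hsc]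

theorem flowNum_of_mem {T : Finset (Finset ι)} (x : ι) {c s : ℝ}
    {t : ι → ℝ} {σ : Finset ι} (hσ : σ ∈ T)
    (h : ∀ τ ∈ T, τ ≠ σ → infOn τ t = 0) (hsc : 0 ≤ s * c) (a : ι) :
    flowNum T x c s t a = max (1 - s) (infOn σ t) *
      (t a - min (infOn σ t) (s * c) * (if a ∈ σ then 1 else 0)) +
        max (s * c - infOn σ t) 0 * (if a = x then 1 else 0) := by
  have h1 : ∑ τ ∈ T, infOn τ t = infOn σ t := Finset.sum_eq_single_of_mem σ hσ h
  have h2 : ∑ τ ∈ T, min (infOn τ t) (s * c) * (if a ∈ τ then (1 : ℝ) else 0) =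
      min (infOn σ t) (s * c) * (if a ∈ σ then 1 else 0) :=
    Finset.sum_eq_single_of_mem σ hσ fun τ hτ hne => by
      rw [h τ hτ hne, min_eq_left hsc, zero_mul]
  rw [flowNum, h1, h2]

variable [Fintype ι]

/-- The flow in barycentric coordinates. -/
noncomputable def flow (T : Finset (Finset ι)) (x : ι) (c s : ℝ) (t : ι → ℝ) (a : ι) : ℝ :=
  flowNum T x c s t a / ∑ b, flowNum T x c s t b

theorem sum_flow {T : Finset (Finset ι)} {x : ι} {c s : ℝ} {t : ι → ℝ}
    (h : 0 < ∑ b, flowNum T x c s t b) : ∑ a, flow T x c s t a = 1 := by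
  simp only [flow, ← Finset.sum_div]
  exact div_self h.ne'

theorem funSupport_flow {T : Finset (Finset ι)} {x : ι} {c s : ℝ} {t : ι → ℝ}
    (h : 0 < ∑ b, flowNum T x c s t b) :
    funSupport (flow T x c s t) = funSupport (flowNum T x c s t) := by
  ext a
  simp [flow, h.ne']

theorem flow_zero {T : Finset (Finset ι)} (x : ι) (c : ℝ) {t : ι → ℝ} (ht : ∀ a, 0 ≤ t a)
    (h1 : ∑ a, t a = 1) : flow T x c 0 t = t := by
  have hM : 0 ≤ ∑ σ ∈ T, infOn σ t := Finset.sum_nonneg fun σ _ => infOn_nonneg ht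
  have hnum : ∀ a, flowNum T x c 0 t a = max 1 (∑ σ ∈ T, infOn σ t) * t a := by
    intro a
    have h2 : ∑ σ ∈ T, min (infOn σ t) (0 * c) * (if a ∈ σ then (1 : ℝ) else 0) = 0 :=
      Finset.sum_eq_zero fun σ hσ => by
        rw [zero_mul, min_eq_right (infOn_nonneg ht), zero_mul]
    rw [flowNum, h2]
    simp [hM]
  ext a
  simp only [flow, hnum, ← Finset.mul_sum, h1, mul_one]
  have : (0 : ℝ) < max 1 (∑ σ ∈ T, infOn σ t) := lt_max_of_lt_left one_pos
  field_simp

end Flow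

/-! ### A cone with top-dimensional faces attached is equivalent to a wedge -/

section Attach

variable {ι : Type*} [DecidableEq ι]

/-- `C` is a cone with apex `x`, and `T` consists of faces of dimension `n` whose boundaries
lie in `C`. -/
structure IsConeWithFaces (C : Set (Finset ι)) (T : Finset (Finset ι)) (x : ι) (n : ℕ) : Prop where
  down : ∀ s ∈ C, ∀ ρ ⊆ s, ρ.Nonempty → ρ ∈ C
  insert_mem : ∀ s ∈ C, insert x s ∈ C
  apex_mem : {x} ∈ C
  boundary : ∀ σ ∈ T, ∀ ρ ⊂ σ, ρ.Nonempty → ρ ∈ C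
  card_eq : ∀ σ ∈ T, σ.card = n + 1
  not_subset : ∀ s ∈ C, ∀ σ ∈ T, ¬ σ ⊆ s
  apex_notMem : ∀ σ ∈ T, x ∉ σ

namespace IsConeWithFaces

variable {C : Set (Finset ι)} {T : Finset (Finset ι)} {x : ι} {n : ℕ}

theorem support_nonempty (h : IsConeWithFaces C T x n) {σ : Finset ι} (hσ : σ ∈ T) :
    σ.Nonempty := by
  rw [← Finset.card_pos, h.card_eq σ hσ]; omega

variable [Fintype ι]

theorem infOn_eq_zero (h : IsConeWithFaces C T x n) {t : ι → ℝ} (ht : ∀ a, 0 ≤ t a)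
    (hC : funSupport t ∈ C) : ∀ σ ∈ T, infOn σ t = 0 := fun σ hσ =>
  infOn_eq_zero_of_not_subset ht (h.not_subset _ hC σ hσ)

theorem infOn_eq_zero_of_ne (h : IsConeWithFaces C T x n) {t : ι → ℝ} (ht : ∀ a, 0 ≤ t a)
    (hT : funSupport t ∈ T) : ∀ τ ∈ T, τ ≠ funSupport t → infOn τ t = 0 := fun τ hτ hne =>
  infOn_eq_zero_of_not_subset ht fun hsub => hne
    (Finset.eq_of_subset_of_card_le hsub (by rw [h.card_eq _ hT, h.card_eq _ hτ]))

theorem sum_flowNum_of_mem_cone (h : IsConeWithFaces C T x n) {c s : ℝ} (hc : 0 < c)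
    (hs : s ∈ Set.Icc (0 : ℝ) 1) {t : ι → ℝ} (ht : ∀ a, 0 ≤ t a) (h1 : ∑ a, t a = 1)
    (hC : funSupport t ∈ C) : ∑ a, flowNum T x c s t a = 1 - s + s * c := by
  simp only [flowNum_of_infOn_eq_zero x hc hs (h.infOn_eq_zero ht hC), Finset.sum_add_distrib,
    ← Finset.mul_sum, h1]
  simp

/-- Over the cone every `infOn σ t` vanishes, and the flow is, up to normalization, the
straight-line contraction to the apex. -/
theorem flow_mem_cone (h : IsConeWithFaces C T x n) {c s : ℝ} (hc : 0 < c)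
    (hs : s ∈ Set.Icc (0 : ℝ) 1) {t : ι → ℝ} (ht : t ∈ realization C) :
    0 < ∑ a, flowNum T x c s t a ∧ flow T x c s t ∈ realization C := by
  have hnum := flowNum_of_infOn_eq_zero x hc hs (h.infOn_eq_zero ht.1 ht.2.2)
  have hpos : 0 < ∑ a, flowNum T x c s t a := by
    rw [h.sum_flowNum_of_mem_cone hc hs ht.1 ht.2.1 ht.2.2]
    rcases hs.2.lt_or_eq with h1 | h1
    · have := mul_nonneg hs.1 hc.le
      linarith
    · rw [h1]; linarith
  refine ⟨hpos, fun a => ?_, sum_flow hpos, ?_⟩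
  · refine div_nonneg ?_ hpos.le
    rw [hnum]
    have h1 : (0 : ℝ) ≤ 1 - s := by linarith [hs.2]
    have h2 := ht.1 a
    have h3 := hs.1
    split_ifs <;> positivity
  · refine h.down _ (h.insert_mem _ ht.2.2) _ ?_ (funSupport_nonempty (sum_flow hpos))
    rw [funSupport_flow hpos]
    intro a ha
    by_contra hna
    rw [Finset.mem_insert, mem_funSupport, not_or, not_not] at hna
    rw [mem_funSupport, hnum] at ha
    simp [hna.1, hna.2] at ha

theorem flow_one (h : IsConeWithFaces C T x n) {c : ℝ} (hc : 0 < c)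
    {t : ι → ℝ} (ht : t ∈ realization C) (a : ι) : flow T x c 1 t a = if a = x then 1 else 0 := by
  have hs : (1 : ℝ) ∈ Set.Icc (0 : ℝ) 1 := by simp
  rw [flow, h.sum_flowNum_of_mem_cone hc hs ht.1 ht.2.1 ht.2.2,
    flowNum_of_infOn_eq_zero x hc hs (h.infOn_eq_zero ht.1 ht.2.2)]
  have := hc.ne'
  simp only [sub_self, zero_mul, one_mul, zero_add]
  split_ifs <;> field_simp

/-- In an open face `σ ∈ T` with smallest coordinate `m`, a point stays in the open face while `s *
c < m`; from then on a smallest coordinate is cancelled and the point lies in the cone over the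
boundary of `σ`. The factor `max (1 - s) m` stays positive up to time one, and `c * (n + 1) < 1`
keeps the subtracted mass below one. -/
theorem flow_mem (h : IsConeWithFaces C T x n) {c s : ℝ} (hc : 0 < c)
    (hcn : c * (n + 1) < 1) (hs : s ∈ Set.Icc (0 : ℝ) 1) {t : ι → ℝ}
    (ht : t ∈ realization (C ∪ T)) :
    0 < ∑ a, flowNum T x c s t a ∧ flow T x c s t ∈ realization (C ∪ T) := by
  by_cases hC : funSupport t ∈ C
  · have := h.flow_mem_cone hc hs ⟨ht.1, ht.2.1, hC⟩
    exact ⟨this.1, realization_mono Set.subset_union_left this.2⟩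
  have hT : funSupport t ∈ T := ht.2.2.resolve_left hC
  have hsc : 0 ≤ s * c := mul_nonneg hs.1 hc.le
  have hscc : s * c ≤ c := mul_le_of_le_one_left hc.le hs.2
  have hnum := flowNum_of_mem x hT (h.infOn_eq_zero_of_ne ht.1 hT) hsc
  set σ := funSupport t with hσ
  have hm : 0 < infOn σ t := infOn_pos (h.support_nonempty hT) ht.1 subset_rfl
  set m := infOn σ t with hmdef
  have hα : 0 < max (1 - s) m := lt_max_of_lt_right hm
  set α := max (1 - s) m
  have hcard : (σ.card : ℝ) = n + 1 := by rw [h.card_eq _ hT]; push_cast; ring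
  have hsum : ∑ a, flowNum T x c s t a = α * (1 - (n + 1) * min m (s * c)) + max (s * c - m) 0 := by
    simp only [hnum, Finset.sum_add_distrib, Finset.sum_sub_distrib, ← Finset.mul_sum, ht.2.1]
    have e1 : ∑ a, (if a ∈ σ then (1 : ℝ) else 0) = n + 1 := by simp [hcard]
    have e2 : ∑ a, (if a = x then (1 : ℝ) else 0) = 1 := by simp
    rw [e1, e2]
    ring
  have hpos : 0 < ∑ a, flowNum T x c s t a := by
    rw [hsum]
    have h1 : (n + 1) * min m (s * c) < 1 := by
      have h2 : min m (s * c) ≤ c := (min_le_right _ _).trans hscc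
      have h3 : (0 : ℝ) < n + 1 := by positivity
      nlinarith
    have h2 : 0 < α * (1 - (n + 1) * min m (s * c)) := mul_pos hα (by linarith)
    have h3 : 0 ≤ max (s * c - m) 0 := le_max_right _ _
    linarith
  refine ⟨hpos, fun a => ?_, sum_flow hpos, ?_⟩
  · refine div_nonneg ?_ hpos.le
    rw [hnum]
    have h1 : 0 ≤ t a - min m (s * c) * (if a ∈ σ then 1 else 0) := by
      split_ifs with ha
      · have h2 := infOn_le ha t
        have h3 := min_le_left m (s * c)
        linarith
      · have := ht.1 a
        linarith
    have h3 : 0 ≤ max (s * c - m) 0 := le_max_right _ _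
    split_ifs at h1 ⊢ <;> positivity
  · rw [funSupport_flow hpos]
    have hne : (funSupport (flowNum T x c s t)).Nonempty := by
      rw [← funSupport_flow hpos]
      exact funSupport_nonempty (sum_flow hpos)
    have hxσ := h.apex_notMem _ hT
    rcases lt_or_ge (s * c) m with hlt | hge
    · right
      have : funSupport (flowNum T x c s t) = σ := by
        ext a
        rw [mem_funSupport, hnum, max_eq_right (by linarith : s * c - m ≤ 0), min_eq_right hlt.le]
        by_cases ha : a ∈ σ
        · simp only [ha, if_true, iff_true]
          have h2 := infOn_le ha t
          have : 0 < α * (t a - s * c) := mul_pos hα (by linarith)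
          simpa using this.ne'
        · have h0 : t a = 0 := by simpa [hσ] using ha
          simp [ha, h0]
      rw [this]
      exact hT
    · left
      obtain ⟨a, ha, hat⟩ := exists_infOn_eq (h.support_nonempty hT) t
      have hsub : funSupport (flowNum T x c s t) ⊆ insert x (σ.erase a) := by
        intro b hb
        by_contra hnb
        rw [Finset.mem_insert, Finset.mem_erase, not_or, not_and_or, not_ne_iff] at hnb
        rw [mem_funSupport, hnum, min_eq_left hge] at hb
        apply hb
        rcases hnb.2 with rfl | hbσ
        · have hbm : t b = m := hat.symm
          simp only [ha, if_true, hnb.1, if_false, hbm]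
          ring
        · have h0 : t b = 0 := by simpa [hσ] using hbσ
          simp [hbσ, h0, hnb.1]
      rcases (σ.erase a).eq_empty_or_nonempty with he | he
      · rw [he] at hsub
        exact h.down _ h.apex_mem _ hsub hne
      · exact h.down _ (h.insert_mem _ (h.boundary _ hT _ (Finset.erase_ssubset ha) he)) _ hsub hne

/-- The map to the wedge sends the cone to the wedge point and each open face of `T` to a sphere by
its chart; its only non-trivial fibre is the cone. The flow maps the cone to itself and is constant
on it at time one, as `nonempty_homotopyEquiv_of_surjective` requires. -/
theorem nonempty_homotopyEquiv (h : IsConeWithFaces C T x n) :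
    Nonempty (realization (C ∪ T) ≃ₕ SphereWedge n T.card) := by
  set K : Set (ι → ℝ) := realization (C ∪ T) with hK
  have hKdown : ∀ s ∈ C ∪ (T : Set (Finset ι)), ∀ ρ ⊆ s, ρ.Nonempty →
      ρ ∈ C ∪ (T : Set (Finset ι)) := by
    rintro s (hs | hs) ρ hρ hne
    · exact Or.inl (h.down s hs ρ hρ hne)
    · rcases hρ.eq_or_ssubset with rfl | hss
      · exact Or.inr hs
      · exact Or.inl (h.boundary s hs ρ hss hne)
  have : CompactSpace K := isCompact_iff_compactSpace.1 (isCompact_realization hKdown)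
  have hmap : ∀ i : Fin T.card, ∃ f : Fin (n + 1) ↪ ι,
      Finset.univ.map f = (T.equivFin.symm i : Finset ι) := by
    intro i
    have e := (T.equivFin.symm i : Finset ι).equivFinOfCardEq (h.card_eq _ (T.equivFin.symm i).2)
    refine ⟨e.symm.toEmbedding.trans (Function.Embedding.subtype _), ?_⟩
    ext a
    simp only [Finset.mem_map, Finset.mem_univ, true_and]
    constructor
    · rintro ⟨j, rfl⟩
      exact (e.symm j).2
    · exact fun ha => ⟨e ⟨a, ha⟩, by simp⟩
  choose f hf using hmap
  have hfT : ∀ i, Finset.univ.map (f i) ∈ T := fun i => hf i ▸ (T.equivFin.symm i).2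
  have hfinj : ∀ i j, Finset.univ.map (f i) = Finset.univ.map (f j) → i = j := fun i j hij => by
    rw [hf, hf] at hij
    exact T.equivFin.symm.injective (Subtype.ext hij)
  have hfsurj : ∀ σ ∈ T, ∃ i, Finset.univ.map (f i) = σ := fun σ hσ =>
    ⟨T.equivFin ⟨σ, hσ⟩, by rw [hf]; simp⟩
  have hn : (0 : ℝ) < n + 1 := by positivity
  have hLzero : ∀ (i) (t : K), funSupport t.1 ≠ Finset.univ.map (f i) → chartMin (f i) t.1 = 0 := by
    intro i t hne
    rw [chartMin]
    rcases t.2.2.2 with hC | hT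
    · rw [h.infOn_eq_zero t.2.1 hC _ (hfT i), mul_zero]
    · rw [h.infOn_eq_zero_of_ne t.2.1 hT _ (hfT i) hne.symm, mul_zero]
  have hLpos : ∀ (i) (t : K), funSupport t.1 = Finset.univ.map (f i) → 0 < chartMin (f i) t.1 :=
    fun i t he => mul_pos hn (infOn_pos (by simp) t.2.1 he.ge)
  have hsum : ∀ (i) (t : K), funSupport t.1 = Finset.univ.map (f i) → ∑ j, t.1 (f i j) = 1 := by
    intro i t he
    refine (sum_embedding_eq fun a ha => ?_).trans t.2.2.1
    rw [← he] at ha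
    simpa using ha
  let φ : Fin T.card → K → UnitSphere n := fun i t => ⟨chartVec (f i) t.1, by
    rw [mem_sphere_zero_iff_norm]
    refine norm_chartVec t.2.1 t.2.2.1 ?_
    by_cases he : funSupport t.1 = Finset.univ.map (f i)
    · exact Or.inr (hsum i t he)
    · exact Or.inl (hLzero i t he)⟩
  have hφc : ∀ i, Continuous (φ i) := by
    intro i
    refine Continuous.subtype_mk ?_ _
    refine (PiLp.continuous_toLp 2 _).comp (continuous_pi fun j => ?_)
    have c1 : Continuous fun t : K => chartMin (f i) t.1 :=
      (continuous_chartMin _).comp continuous_subtype_val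
    have c2 : Continuous fun t : K => chartSq (f i) t.1 :=
      (continuous_chartSq _).comp continuous_subtype_val
    have c3 : ∀ a, Continuous fun t : K => t.1 a := fun a =>
      (continuous_apply a).comp continuous_subtype_val
    refine Continuous.div ?_ (by fun_prop) fun t => (chart_denom_pos t.2.1 t.2.2.1).ne'
    exact ((continuous_const.mul c1).mul ((c3 _).sub (c3 _))).add
      ((c2.sub (continuous_const.mul (c1.pow 2))).mul continuous_const)
  have hφbase : ∀ i t, funSupport t.1 ≠ Finset.univ.map (f i) → φ i t = UnitSphere.point n :=
    fun i t he => Subtype.ext (chartVec_eq_of_chartMin_eq_zero t.2.1 t.2.2.1 (hLzero i t he))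
  have hφne : ∀ i t, funSupport t.1 = Finset.univ.map (f i) → φ i t ≠ UnitSphere.point n := by
    intro i t he heq
    have h1 : chartVec (f i) t.1 = EuclideanSpace.single 0 1 := congrArg Subtype.val heq
    have h2 := one_sub_chartVec_zero (f := f i) t.2.1 t.2.2.1
    rw [h1] at h2
    have h3 : 0 < 8 * chartMin (f i) t.1 ^ 2 / (chartSq (f i) t.1 + 4 * chartMin (f i) t.1 ^ 2) :=
      div_pos (by have := hLpos i t he; positivity) (chart_denom_pos t.2.1 t.2.2.1)
    simp at h2
    exact absurd h2 h3.ne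
  classical
  let q₀ : K → SphereWedge n T.card := fun t =>
    if ht : funSupport t.1 ∈ T then
      Quot.mk _ (Sum.inr (T.equivFin ⟨_, ht⟩, φ (T.equivFin ⟨_, ht⟩) t))
    else Quot.mk _ (Sum.inl ())
  have hcoord : ∀ t i, SphereWedge.coord (q₀ t) i = φ i t := by
    intro t i
    by_cases ht : funSupport t.1 ∈ T
    · simp only [q₀, dif_pos ht, SphereWedge.coord, Sum.elim_inr]
      split_ifs with hi
      · rw [hi]
      · refine (hφbase i t fun he => hi ?_).symm
        apply T.equivFin.symm.injective
        rw [Equiv.symm_apply_apply]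
        exact Subtype.ext (he.trans (hf i))
    · simp only [q₀, dif_neg ht, SphereWedge.coord, Sum.elim_inl]
      exact (hφbase i t fun he => ht (he ▸ hfT i)).symm
  let q : C(K, SphereWedge n T.card) := ⟨q₀, by
    rw [SphereWedge.continuous_iff]
    refine continuous_pi fun i => ?_
    simp only [hcoord]
    exact hφc i⟩
  have hqeq : ∀ t t', q t = q t' → t = t' ∨
      (funSupport t.1 ∈ C ∧ funSupport t'.1 ∈ C) := by
    intro t t' heq
    have hφ : ∀ i, φ i t = φ i t' := fun i => by
      rw [← hcoord, ← hcoord]; exact congrArg (fun w => SphereWedge.coord w i) heq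
    by_cases hT : ∃ i, funSupport t.1 = Finset.univ.map (f i)
    · obtain ⟨i, hi⟩ := hT
      have hi' : funSupport t'.1 = Finset.univ.map (f i) := by
        by_contra hne
        exact hφne i t hi ((hφ i).trans (hφbase i t' hne))
      left
      refine Subtype.ext (chartVec_injOn (f := f i) t.2.1 t.2.2.1 (hLpos i t hi) ?_ t'.2.1 t'.2.2.1
        (hLpos i t' hi') ?_ (congrArg Subtype.val (hφ i)))
      · intro a ha
        rw [← hi] at ha
        simpa using ha
      · intro a ha
        rw [← hi'] at ha
        simpa using ha
    · right
      have hT' : ¬ ∃ i, funSupport t'.1 = Finset.univ.map (f i) := by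
        rintro ⟨i, hi⟩
        refine hφne i t' hi ((hφ i).symm.trans (hφbase i t fun he => hT ⟨i, he⟩))
      constructor
      · refine t.2.2.2.resolve_right fun hmem => ?_
        obtain ⟨i, hi⟩ := hfsurj _ hmem
        exact hT ⟨i, hi.symm⟩
      · refine t'.2.2.2.resolve_right fun hmem => ?_
        obtain ⟨i, hi⟩ := hfsurj _ hmem
        exact hT' ⟨i, hi.symm⟩
  have hqC : ∀ t t' : K, funSupport t.1 ∈ C → funSupport t'.1 ∈ C → q t = q t' := by
    intro t t' hC hC'
    apply SphereWedge.coord_injective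
    ext1 i
    change SphereWedge.coord (q₀ t) i = SphereWedge.coord (q₀ t') i
    rw [hcoord, hcoord, hφbase, hφbase]
    · exact fun he => h.not_subset _ hC' _ (hfT i) he.ge
    · exact fun he => h.not_subset _ hC _ (hfT i) he.ge
  have hqsurj : Function.Surjective q := by
    have hinl : ∃ t, q t = Quot.mk _ (Sum.inl ()) := by
      have hsingle : Pi.single x 1 ∈ realization (C ∪ T) := by
        refine ⟨fun a => ?_, by simp, ?_⟩
        · by_cases ha : a = x
          · subst ha; simp
          · simp [ha]
        · have : funSupport (Pi.single x (1 : ℝ)) = {x} := by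
            ext a
            by_cases ha : a = x
            · subst ha; simp
            · simp [ha]
          rw [this]
          exact Or.inl h.apex_mem
      refine ⟨⟨_, hsingle⟩, SphereWedge.coord_injective ?_⟩
      ext1 i
      change SphereWedge.coord (q₀ _) i = _
      rw [hcoord, hφbase]
      · rfl
      · intro he
        have := h.apex_notMem _ (hfT i)
        rw [← he] at this
        simp at this
    rintro ⟨⟨⟩ | ⟨i, z⟩⟩
    · exact hinl
    · by_cases hz : z = UnitSphere.point n
      · subst hz
        obtain ⟨t, ht⟩ := hinl
        exact ⟨t, ht.trans (Quot.sound (.glue i)).symm⟩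
      · obtain ⟨t, h1, h2, h3, h4⟩ := exists_chartVec_eq (f i) (z := z.1)
          (mem_sphere_zero_iff_norm.1 z.2) (fun he => hz (Subtype.ext he))
        let t' : K := ⟨t, h1, h2, Or.inr (h3 ▸ hfT i)⟩
        refine ⟨t', SphereWedge.coord_injective ?_⟩
        ext1 j
        change SphereWedge.coord (q₀ _) j = _
        rw [hcoord]
        simp only [SphereWedge.coord, Sum.elim_inr]
        split_ifs with hij
        · subst hij
          exact Subtype.ext h4
        · exact hφbase j t' fun he => hij (hfinj _ _ (h3.symm.trans he))
  -- Any positive constant below `1 / (n + 1)` would do.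
  set c : ℝ := 1 / (2 * (n + 1)) with hc
  have hcpos : 0 < c := by positivity
  have hcn : c * (n + 1) < 1 := by
    rw [hc]; field_simp; norm_num
  let H : C(unitInterval × K, K) :=
    ⟨fun p => ⟨flow T x c p.1 p.2, (h.flow_mem hcpos hcn p.1.2 p.2.2).2⟩, by
      refine Continuous.subtype_mk (continuous_pi fun a => ?_) _
      have hcont : ∀ a, Continuous fun p : unitInterval × K => flowNum T x c p.1 p.2 a := fun a =>
        (continuous_flowNum T x c a).comp ((continuous_subtype_val.comp continuous_fst).prodMk
          (continuous_subtype_val.comp continuous_snd))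
      exact (hcont a).div (continuous_finsetSum _ fun b _ => hcont b)
        fun p => (h.flow_mem hcpos hcn p.1.2 p.2.2).1.ne'⟩
  refine nonempty_homotopyEquiv_of_surjective q hqsurj H ?_ ?_ ?_
  · exact fun t => Subtype.ext (flow_zero x c t.2.1 t.2.2.1)
  · intro t t' heq
    rcases hqeq t t' heq with rfl | ⟨hC, hC'⟩
    · rfl
    · refine Subtype.ext (funext fun a => ?_)
      exact (h.flow_one hcpos ⟨t.2.1, t.2.2.1, hC⟩ a).trans
        (h.flow_one hcpos ⟨t'.2.1, t'.2.2.1, hC'⟩ a).symm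
  · intro s t t' heq
    rcases hqeq t t' heq with rfl | ⟨hC, hC'⟩
    · rfl
    · exact hqC _ _ (h.flow_mem_cone hcpos s.2 ⟨t.2.1, t.2.2.1, hC⟩).2.2.2
        (h.flow_mem_cone hcpos s.2 ⟨t'.2.1, t'.2.2.1, hC'⟩).2.2.2

end IsConeWithFaces

/-- Without the faces in `T` the complex is collapsible, so attaching a cone with a new apex `x`
over it does not change the homotopy type. The enlarged complex is this cone with the faces in `T`
attached along their boundaries. -/
theorem IsSpherical.exists_homotopyEquiv [Fintype ι] {n : ℕ} {X : Set (Finset ι)} (hX : IsSpherical (n + 1) X)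
    (hne : ∀ s ∈ X, s.Nonempty) (hdown : ∀ s ∈ X, ∀ ρ ⊆ s, ρ.Nonempty → ρ ∈ X) {x : ι}
    (hx : ∀ s ∈ X, x ∉ s) : ∃ k, Nonempty (realization X ≃ₕ SphereWedge n k) := by
  obtain ⟨T, hTX, hTn, hTc⟩ := hX.2 n.succ_pos
  classical
  have hsub : X \ T ⊆ X := Set.sdiff_subset
  obtain ⟨e⟩ := (hTc.union_openCone_collapsesTo hx hsub).nonempty_homotopyEquiv
  have hmax : ∀ s ∈ X, ∀ σ ∈ T, σ ⊆ s → σ = s := fun s hs σ hσ hss =>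
    Finset.eq_of_subset_of_card_le hss (by rw [hTn σ hσ]; exact hX.1 s hs)
  have hAdown : ∀ s ∈ X \ T, ∀ ρ ⊆ s, ρ.Nonempty → ρ ∈ X \ T := fun s hs ρ hρ hn =>
    ⟨hdown s hs.1 ρ hρ hn, fun hT => hs.2 (hmax s hs.1 ρ hT hρ ▸ hT)⟩
  have hcone : IsConeWithFaces ((X \ T) ∪ openCone x (X \ T)) T.toFinite.toFinset x n := by
    refine ⟨?_, ?_, Or.inr (Or.inl rfl), ?_, ?_, ?_, ?_⟩
    · rintro s (hs | rfl | ⟨s, hs, rfl⟩) ρ hρ hn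
      · exact Or.inl (hAdown s hs ρ hρ hn)
      · rw [hn.subset_singleton_iff.1 hρ]
        exact Or.inr (Or.inl rfl)
      · rcases (ρ.erase x).eq_empty_or_nonempty with he | he
        · have : ρ ⊆ {x} := by
            rw [Finset.erase_eq_empty_iff] at he
            rcases he with rfl | rfl <;> simp
          rw [hn.subset_singleton_iff.1 this]
          exact Or.inr (Or.inl rfl)
        · have hm := hAdown s hs (ρ.erase x) (Finset.subset_insert_iff.1 hρ) he
          by_cases hxρ : x ∈ ρ
          · exact Or.inr (Or.inr ⟨_, hm, Finset.insert_erase hxρ⟩)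
          · rw [Finset.erase_eq_of_notMem hxρ] at hm
            exact Or.inl hm
    · rintro s (hs | rfl | ⟨s, hs, rfl⟩)
      · exact Or.inr (Or.inr ⟨s, hs, rfl⟩)
      · exact Or.inr (Or.inl (by simp))
      · exact Or.inr (Or.inr ⟨s, hs, by simp⟩)
    · intro σ hσ ρ hρ hn
      rw [Set.Finite.mem_toFinset] at hσ
      refine Or.inl ⟨hdown σ (hTX hσ) ρ hρ.1 hn, fun hT => ?_⟩
      exact hρ.ne (hmax σ (hTX hσ) ρ hT hρ.1)
    · exact fun σ hσ => hTn σ (by simpa using hσ)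
    · rintro s hs σ hσ hss
      rw [Set.Finite.mem_toFinset] at hσ
      have hxσ := hx σ (hTX hσ)
      have hσn := hne σ (hTX hσ)
      rcases hs with hs | rfl | ⟨s, hs, rfl⟩
      · exact hs.2 (hmax s hs.1 σ hσ hss ▸ hσ)
      · rw [hσn.subset_singleton_iff.1 hss] at hxσ
        simp at hxσ
      · rw [Finset.subset_insert_iff_of_notMem hxσ] at hss
        exact hs.2 (hmax s hs.1 σ hσ hss ▸ hσ)
    · exact fun σ hσ => hx σ (hTX (by simpa using hσ))
  obtain ⟨g⟩ := hcone.nonempty_homotopyEquiv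
  have hunion : ((X \ T) ∪ openCone x (X \ T)) ∪ (T.toFinite.toFinset : Set (Finset ι)) =
      X ∪ openCone x (X \ T) := by
    rw [Set.Finite.coe_toFinset, Set.union_right_comm, Set.sdiff_union_of_subset hTX]
  rw [hunion] at g
  exact ⟨_, ⟨e.symm.trans g⟩⟩

end Attach

/-! ### Realizations of subposets -/

section PosetRealization

variable {ι : Type*} [PartialOrder ι] [Fintype ι]

theorem sum_subtype_eq_sum {ι : Type*} [Fintype ι] (p : ι → Prop) [Fintype {a // p a}]
    {g : ι → ℝ} (h : ∀ a, ¬ p a → g a = 0) : ∑ a : {a // p a}, g a = ∑ a, g a := by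
  classical
  rw [← Finset.sum_subtype (Finset.univ.filter p) (by simp) g]
  exact Finset.sum_filter_of_ne fun a _ ha => by_contra fun hp => ha (h a hp)

open Classical in
/-- The realization of a subposet, in the coordinates of the ambient poset. -/
noncomputable def posetRealizationHomeomorph (p : ι → Prop) :
    PosetRealization {a // p a} ≃ₜ realization (orderComplex {a | p a}) where
  toFun t := ⟨fun a => if h : p a then t.1 ⟨a, h⟩ else 0, by
    have hsupp : ∀ a, a ∈ funSupport (fun a => if h : p a then t.1 ⟨a, h⟩ else 0) ↔
        ∃ h : p a, t.1 ⟨a, h⟩ ≠ 0 := fun a => by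
      rw [mem_funSupport]
      by_cases h : p a <;> simp [h]
    have hsum : ∑ a, (if h : p a then t.1 ⟨a, h⟩ else 0) = 1 := by
      have h1 := t.2.2.1
      rw [finsum_eq_sum_of_fintype] at h1
      refine (sum_subtype_eq_sum p fun a ha => by simp [ha]).symm.trans (Eq.trans ?_ h1)
      exact Finset.sum_congr rfl fun a _ => by simp [a.2]
    refine ⟨fun a => ?_, hsum, funSupport_nonempty hsum, ?_, ?_⟩
    · by_cases h : p a
      · simpa [h] using t.2.1 _
      · simp [h]
    · intro a ha
      exact ((hsupp a).1 ha).1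
    · intro a ha b hb hab
      obtain ⟨h1, h2⟩ := (hsupp a).1 ha
      obtain ⟨h1', h2'⟩ := (hsupp b).1 hb
      exact t.2.2.2 (x := ⟨a, h1⟩) (y := ⟨b, h1'⟩) h2 h2'
        (fun h => hab (congrArg Subtype.val h))⟩
  invFun t := ⟨fun a => t.1 a.1, fun a => t.2.1 a, by
    rw [finsum_eq_sum_of_fintype]
    refine (sum_subtype_eq_sum p fun a ha => ?_).trans t.2.2.1
    by_contra h
    exact ha (t.2.2.2.2.1 (mem_funSupport.2 h)), by
    intro a ha b hb hab
    exact t.2.2.2.2.2 (x := a.1) (y := b.1) (mem_funSupport.2 ha) (mem_funSupport.2 hb)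
      (fun h => hab (Subtype.ext h))⟩
  left_inv t := by
    ext a
    simp [a.2]
  right_inv t := by
    ext a
    by_cases h : p a
    · simp [h]
    · simp only [h, dite_false]
      by_contra h'
      exact h (t.2.2.2.2.1 (mem_funSupport.2 (Ne.symm h')))
  continuous_toFun := by
    refine Continuous.subtype_mk (continuous_pi fun a => ?_) _
    by_cases h : p a
    · simp only [h, dite_true]
      exact (continuous_apply _).comp continuous_subtype_val
    · simp only [h, dite_false]
      exact continuous_const
  continuous_invFun := by
    refine Continuous.subtype_mk (continuous_pi fun a => ?_) _
    exact (continuous_apply _).comp continuous_subtype_val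

end PosetRealization

/-! ### Forests and cycles in multigraphs -/

namespace Graph

variable {α β : Type*} {G H : Graph α β} {F F' : Set β} {x y z a b : α} {e : β}

theorem Joined.refl (G : Graph α β) (x : α) : G.Joined x x := SimpleGraph.Reachable.refl x

theorem Joined.symm (h : G.Joined x y) : G.Joined y x := SimpleGraph.Reachable.symm h

theorem Joined.trans (h : G.Joined x y) (h' : G.Joined y z) : G.Joined x z :=
  SimpleGraph.Reachable.trans h h'

theorem IsLink.joined (h : G.IsLink e x y) : G.Joined x y := by
  by_cases hxy : x = y
  · subst hxy; exact .refl G x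
  · exact SimpleGraph.Adj.reachable (G := G.underlying)
      ((SimpleGraph.fromRel_adj _ _ _).2 ⟨hxy, Or.inl ⟨e, h⟩⟩)

theorem IsLink.joined_restrict (h : G.IsLink e x y) (he : e ∈ F) : (G.restrict F).Joined x y :=
  IsLink.joined (e := e) (G := G.restrict F) ⟨he, h⟩

theorem exists_isLink_of_underlying_adj (h : G.underlying.Adj x y) : ∃ e, G.IsLink e x y := by
  rcases ((SimpleGraph.fromRel_adj _ _ _).1 h).2 with ⟨e, he⟩ | ⟨e, he⟩
  · exact ⟨e, he⟩
  · exact ⟨e, he.symm⟩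

theorem Joined.induction {P : α → Prop} (h : G.Joined x y) (hx : P x)
    (step : ∀ e z w, G.IsLink e z w → P z → P w) : P y := by
  rw [Joined, SimpleGraph.reachable_iff_reflTransGen] at h
  induction h with
  | refl => exact hx
  | tail _ hzw ih =>
    obtain ⟨e, he⟩ := exists_isLink_of_underlying_adj hzw
    exact step e _ _ he ih

theorem Joined.mono (hGH : G ≤ H) (h : G.Joined x y) : H.Joined x y :=
  h.induction (.refl H x) fun _ _ _ he hz => hz.trans (he.mono hGH).joined

theorem Joined.restrict_mono (h : (G.restrict F).Joined x y) (hF : F ⊆ F') :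
    (G.restrict F').Joined x y :=
  h.mono (G.restrict_mono_right hF)

theorem Joined.restrict_mono_left (hGH : G ≤ H) (h : (G.restrict F).Joined x y) :
    (H.restrict F).Joined x y :=
  h.mono (Graph.restrict_mono_left hGH F)

theorem Joined.mem_right (h : G.Joined x y) (hx : x ∈ V(G)) : y ∈ V(G) :=
  h.induction hx fun _ _ _ he _ => he.right_mem

theorem Joined.eq_of_forall_not_inc (h : (G.restrict F).Joined x y)
    (hx : ∀ e ∈ F, ¬ G.Inc e x) : y = x := by
  refine h.induction (P := fun w => w = x) rfl ?_
  rintro e z w he rfl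
  exact absurd he.2.inc_left (hx e he.1)

/-- Repeated crossings of `e` can be cut short, so one crossing at most is needed. -/
theorem joined_restrict_insert (he : G.IsLink e a b)
    (h : (G.restrict (insert e F)).Joined x y) :
    (G.restrict F).Joined x y ∨
      ((G.restrict F).Joined x a ∧ (G.restrict F).Joined b y) ∨
      ((G.restrict F).Joined x b ∧ (G.restrict F).Joined a y) := by
  refine h.induction (P := fun y => (G.restrict F).Joined x y ∨
    ((G.restrict F).Joined x a ∧ (G.restrict F).Joined b y) ∨
    ((G.restrict F).Joined x b ∧ (G.restrict F).Joined a y)) (Or.inl (.refl _ x)) ?_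
  rintro f z w ⟨rfl | hf, hlink⟩ hz
  · rcases he.eq_and_eq_or_eq_and_eq hlink with ⟨rfl, rfl⟩ | ⟨rfl, rfl⟩
    · rcases hz with h | ⟨h, -⟩ | ⟨h, -⟩
      · exact Or.inr (Or.inl ⟨h, .refl _ _⟩)
      · exact Or.inr (Or.inl ⟨h, .refl _ _⟩)
      · exact Or.inl h
    · rcases hz with h | ⟨h, -⟩ | ⟨h, -⟩
      · exact Or.inr (Or.inr ⟨h, .refl _ _⟩)
      · exact Or.inl h
      · exact Or.inr (Or.inr ⟨h, .refl _ _⟩)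
  · have hzw := hlink.joined_restrict hf
    exact hz.imp (·.trans hzw) (.imp (And.imp_right (·.trans hzw)) (And.imp_right (·.trans hzw)))

/-- A cyclic enumeration of the vertices and edges of a cycle graph by the natural numbers. -/
structure IsCyclicEnumeration (C : Graph α β) (n : ℕ) (v : ℕ → α) (e : ℕ → β) : Prop where
  isLink : ∀ i, C.IsLink (e i) (v i) (v (i + 1))
  vertex_eq_iff : ∀ i j, v i = v j ↔ i ≡ j [MOD n + 1]
  edge_eq_iff : ∀ i j, e i = e j ↔ i ≡ j [MOD n + 1]
  exists_vertex : ∀ x ∈ V(C), ∃ i ≤ n, v i = x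
  exists_edge : ∀ f ∈ E(C), ∃ i ≤ n, e i = f

namespace IsCyclicEnumeration

variable {C : Graph α β} {n : ℕ} {v : ℕ → α} {e : ℕ → β}

theorem vertex_period (h : IsCyclicEnumeration C n v e) : v (n + 1) = v 0 :=
  (h.vertex_eq_iff _ _).2 (by simp [Nat.ModEq])

theorem vertex_injOn (h : IsCyclicEnumeration C n v e) {i j : ℕ} (hi : i ≤ n) (hj : j ≤ n)
    (hij : v i = v j) : i = j :=
  ((h.vertex_eq_iff i j).1 hij).eq_of_lt_of_lt (by omega) (by omega)

theorem edge_injOn (h : IsCyclicEnumeration C n v e) {i j : ℕ} (hi : i ≤ n) (hj : j ≤ n)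
    (hij : e i = e j) : i = j :=
  ((h.edge_eq_iff i j).1 hij).eq_of_lt_of_lt (by omega) (by omega)

theorem rotate (h : IsCyclicEnumeration C n v e) (k : ℕ) :
    IsCyclicEnumeration C n (fun i => v (k + i)) (fun i => e (k + i)) where
  isLink i := h.isLink (k + i)
  vertex_eq_iff i j := (h.vertex_eq_iff _ _).trans
    ⟨Nat.ModEq.add_left_cancel rfl, Nat.ModEq.add_left k⟩
  edge_eq_iff i j := (h.edge_eq_iff _ _).trans
    ⟨Nat.ModEq.add_left_cancel rfl, Nat.ModEq.add_left k⟩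
  exists_vertex x hx := by
    obtain ⟨i, hi, rfl⟩ := h.exists_vertex x hx
    -- Modulo `n + 1`, adding `n * k` is subtracting `k`.
    refine ⟨(i + n * k) % (n + 1), Nat.le_of_lt_succ (Nat.mod_lt _ n.succ_pos), ?_⟩
    rw [h.vertex_eq_iff]
    calc k + (i + n * k) % (n + 1) ≡ k + (i + n * k) [MOD n + 1] :=
          Nat.ModEq.add_left k (Nat.mod_modEq _ _)
      _ = i + (n + 1) * k := by ring
      _ ≡ i [MOD n + 1] := by simp [Nat.ModEq]
  exists_edge x hx := by
    obtain ⟨i, hi, rfl⟩ := h.exists_edge x hx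
    refine ⟨(i + n * k) % (n + 1), Nat.le_of_lt_succ (Nat.mod_lt _ n.succ_pos), ?_⟩
    rw [h.edge_eq_iff]
    calc k + (i + n * k) % (n + 1) ≡ k + (i + n * k) [MOD n + 1] :=
          Nat.ModEq.add_left k (Nat.mod_modEq _ _)
      _ = i + (n + 1) * k := by ring
      _ ≡ i [MOD n + 1] := by simp [Nat.ModEq]

/-- Consecutive edges join the vertices of an arc. -/
theorem joined_arc (h : IsCyclicEnumeration C n v e) {i j : ℕ} (hij : i ≤ j)
    (hF : ∀ k, i ≤ k → k < j → e k ∈ F) : (C.restrict F).Joined (v i) (v j) := by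
  induction j, hij using Nat.le_induction with
  | base => exact .refl _ _
  | succ j hij ih =>
    exact (ih fun k hk hkj => hF k hk (by omega)).trans
      ((h.isLink j).joined_restrict (hF j hij (by omega)))

theorem ncard_vertexSet (h : IsCyclicEnumeration C n v e) : V(C).ncard = n + 1 := by
  have : V(C) = v '' (Finset.range (n + 1) : Set ℕ) := by
    ext x
    constructor
    · intro hx
      obtain ⟨i, hi, rfl⟩ := h.exists_vertex x hx
      exact ⟨i, by simp; omega, rfl⟩
    · rintro ⟨i, -, rfl⟩
      exact (h.isLink i).left_mem
  rw [this, Set.InjOn.ncard_image, Set.ncard_coe_finset, Finset.card_range]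
  intro i hi j hj hij
  simp at hi hj
  exact h.vertex_injOn (by omega) (by omega) hij

theorem ncard_edgeSet (h : IsCyclicEnumeration C n v e) : E(C).ncard = n + 1 := by
  have : E(C) = e '' (Finset.range (n + 1) : Set ℕ) := by
    ext x
    constructor
    · intro hx
      obtain ⟨i, hi, rfl⟩ := h.exists_edge x hx
      exact ⟨i, by simp; omega, rfl⟩
    · rintro ⟨i, -, rfl⟩
      exact (h.isLink i).edge_mem
  rw [this, Set.InjOn.ncard_image, Set.ncard_coe_finset, Finset.card_range]
  intro i hi j hj hij
  simp at hi hj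
  exact h.edge_injOn (by omega) (by omega) hij

end IsCyclicEnumeration

theorem IsCycleGraph.exists_enumeration {C : Graph α β} (h : C.IsCycleGraph) :
    ∃ n v e, IsCyclicEnumeration C n v e := by
  obtain ⟨n, v, e, hv, he, hV, hE, hlink⟩ := h
  have hof : ∀ i j, Fin.ofNat (n + 1) i = Fin.ofNat (n + 1) j ↔ i ≡ j [MOD n + 1] := fun i j => by
    rw [Fin.ext_iff]; rfl
  refine ⟨n, fun i => v (Fin.ofNat (n + 1) i), fun i => e (Fin.ofNat (n + 1) i), ?_, ?_, ?_, ?_, ?_⟩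
  · intro i
    have : Fin.ofNat (n + 1) (i + 1) = Fin.ofNat (n + 1) i + 1 := by
      ext
      simp [Fin.val_add]
    rw [this]
    exact hlink _
  · exact fun i j => hv.eq_iff.trans (hof i j)
  · exact fun i j => he.eq_iff.trans (hof i j)
  · intro x hx
    rw [hV] at hx
    obtain ⟨i, rfl⟩ := hx
    exact ⟨i, Nat.le_of_lt_succ i.2, by simp⟩
  · intro x hx
    rw [hE] at hx
    obtain ⟨i, rfl⟩ := hx
    exact ⟨i, Nat.le_of_lt_succ i.2, by simp⟩

theorem IsCycleGraph.exists_enumeration_of_vertex {C : Graph α β} (h : C.IsCycleGraph)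
    (hx : x ∈ V(C)) : ∃ n v e, IsCyclicEnumeration C n v e ∧ v 0 = x := by
  obtain ⟨n, v, e, h⟩ := h.exists_enumeration
  obtain ⟨i, -, rfl⟩ := h.exists_vertex x hx
  exact ⟨n, _, _, h.rotate i, rfl⟩

theorem IsCycleGraph.exists_enumeration_of_edge {C : Graph α β} (h : C.IsCycleGraph) {f : β}
    (hf : f ∈ E(C)) : ∃ n v e, IsCyclicEnumeration C n v e ∧ e 0 = f := by
  obtain ⟨n, v, e, h⟩ := h.exists_enumeration
  obtain ⟨i, -, rfl⟩ := h.exists_edge f hf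
  exact ⟨n, _, _, h.rotate i, rfl⟩

/-- If an edge of a cycle is missing from `F` but its ends are joined by edges of the cycle
in `F`, then all other edges of the cycle are in `F`. -/
theorem IsCycleGraph.mem_of_joined {C : Graph α β} (h : C.IsCycleGraph) {e f : β}
    (he : C.IsLink e a b) (heF : e ∉ F) (hj : (C.restrict F).Joined a b) (hf : f ∈ E(C))
    (hfe : f ≠ e) : f ∈ F := by
  by_contra hfF
  obtain ⟨n, v, g, hC, rfl⟩ := h.exists_enumeration_of_edge he.edge_mem
  obtain ⟨k, hk, rfl⟩ := hC.exists_edge f hf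
  have hk0 : k ≠ 0 := fun h => hfe (h ▸ rfl)
  have hj' : (C.restrict F).Joined (v 1) (v 0) := by
    rcases he.eq_and_eq_or_eq_and_eq (hC.isLink 0) with ⟨rfl, rfl⟩ | ⟨rfl, rfl⟩
    · exact hj.symm
    · exact hj
  -- Without the edges `g 0` and `g k`, a walk from `v 1` cannot leave the arc `v 1, …, v k`, which
  -- does not contain `v 0`.
  have : ∃ i, 1 ≤ i ∧ i ≤ k ∧ v i = v 0 := by
    refine hj'.induction (P := fun x => ∃ i, 1 ≤ i ∧ i ≤ k ∧ v i = x) ⟨1, le_rfl, by omega, rfl⟩ ?_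
    rintro f z w ⟨hfF', hl⟩ ⟨i, hi1, hik, rfl⟩
    obtain ⟨l, hl1, rfl⟩ := hC.exists_edge f hl.edge_mem
    have hl0 : l ≠ 0 := fun h => heF (h ▸ hfF')
    have hlk : l ≠ k := fun h => hfF (h ▸ hfF')
    rcases hl.eq_and_eq_or_eq_and_eq (hC.isLink l) with ⟨h1, rfl⟩ | ⟨h1, rfl⟩
    · have := hC.vertex_injOn (by omega) hl1 h1
      exact ⟨l + 1, by omega, by omega, rfl⟩
    · rcases hl1.lt_or_eq with h2 | rfl
      · have := hC.vertex_injOn (by omega) (by omega : l + 1 ≤ n) h1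
        exact ⟨l, by omega, by omega, rfl⟩
      · rw [hC.vertex_period] at h1
        have := hC.vertex_injOn (by omega) (by omega) h1
        omega
  obtain ⟨i, hi1, hik, hi⟩ := this
  have := hC.vertex_injOn (by omega) (by omega) hi
  omega

theorem IsForest.mono (h : G.IsForest F') (hF : F ⊆ F') : G.IsForest F :=
  ⟨hF.trans h.1, fun C hC => h.2 C (hC.trans (G.restrict_mono_right hF))⟩

theorem IsForest.insert (h : G.IsForest F) (he : G.IsLink e a b)
    (hab : ¬ (G.restrict F).Joined a b) : G.IsForest (insert e F) := by
  refine ⟨Set.insert_subset he.edge_mem h.1, fun C hC hcyc => ?_⟩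
  by_cases heC : e ∈ E(C)
  · obtain ⟨n, v, g, hCe, rfl⟩ := hcyc.exists_enumeration_of_edge heC
    have hj : (C.restrict F).Joined (v 1) (v (n + 1)) := by
      refine hCe.joined_arc (by omega) fun k hk hkn => ?_
      rcases ((hCe.isLink k).mono hC).1 with h1 | h1
      · have := hCe.edge_injOn (by omega) (by omega) h1
        omega
      · exact h1
    rw [hCe.vertex_period] at hj
    replace hj := hj.restrict_mono_left (hC.trans restrict_le)
    rcases he.eq_and_eq_or_eq_and_eq ((hCe.isLink 0).mono (hC.trans restrict_le)) with
      ⟨rfl, rfl⟩ | ⟨rfl, rfl⟩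
    · exact hab hj.symm
    · exact hab hj
  · refine h.2 C ⟨hC.vertexSet_mono, fun f x y hf => ?_⟩ hcyc
    obtain ⟨h1, h2⟩ := hf.mono hC
    refine ⟨h1.resolve_left ?_, h2⟩
    rintro rfl
    exact heC hf.edge_mem

/-- A path in `F \ {e}` between the ends of `e` is closed up by `e` to a cycle in `F`. For a loop
`e` the path has length zero, so in particular forests contain no loops. -/
theorem IsForest.not_joined (h : G.IsForest F) (heF : e ∈ F) (he : G.IsLink e a b) :
    ¬ (G.restrict (F \ {e})).Joined a b := by
  intro hj
  obtain ⟨p, hp⟩ := SimpleGraph.Reachable.exists_isPath hj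
  set l := p.length with hl
  have hinj : ∀ i j, i ≤ l → j ≤ l → p.getVert i = p.getVert j → i = j := fun i j hi hj h =>
    hp.getVert_injOn (by simpa using hi) (by simpa using hj) h
  have hadj : ∀ i, ∃ f, i < l → (G.restrict (F \ {e})).IsLink f (p.getVert i) (p.getVert (i + 1)) := by
    intro i
    by_cases hi : i < l
    · obtain ⟨f, hf⟩ := exists_isLink_of_underlying_adj (p.adj_getVert_succ hi)
      exact ⟨f, fun _ => hf⟩
    · exact ⟨e, fun h => absurd h hi⟩
  choose f hf using hadj
  let v : Fin (l + 1) → α := fun i => p.getVert i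
  let g : Fin (l + 1) → β := fun i => if (i : ℕ) < l then f i else e
  have hlink : ∀ i, (G.restrict F).IsLink (g i) (v i) (v (i + 1)) := by
    intro i
    by_cases hi : (i : ℕ) < l
    · have h1 : ((i + 1 : Fin (l + 1)) : ℕ) = i + 1 := Fin.val_add_one_of_lt (by
        rw [Fin.lt_def]; simpa using hi)
      have h2 := hf i hi
      simp only [g, v, if_pos hi, h1]
      exact ⟨h2.1.1, h2.2⟩
    · have h3 : i = Fin.last l := Fin.ext (by have := i.2; simp; omega)
      subst h3
      have h4 : p.getVert l = b := p.getVert_length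
      simp only [g, v, Fin.last_add_one, Fin.val_last, lt_irrefl, if_false, Fin.val_zero, h4,
        SimpleGraph.Walk.getVert_zero]
      exact ⟨heF, he.symm⟩
  have hginj : Function.Injective g := by
    have hne : ∀ i, i < l → f i ≠ e := fun i hi => (hf i hi).1.2
    intro i j hij
    by_cases hi : (i : ℕ) < l <;> by_cases hj : (j : ℕ) < l
    · simp only [g, if_pos hi, if_pos hj] at hij
      have h1 := (hf i hi).2
      rw [hij] at h1
      rcases h1.eq_and_eq_or_eq_and_eq (hf j hj).2 with ⟨h2, -⟩ | ⟨h2, h3⟩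
      · exact Fin.ext (hinj _ _ hi.le hj.le h2)
      · have h4 := hinj _ _ hi.le (by omega) h2
        have h5 := hinj _ _ (by omega) hj.le h3
        omega
    · simp only [g, if_pos hi, if_neg hj] at hij
      exact absurd hij (hne i hi)
    · simp only [g, if_neg hi, if_pos hj] at hij
      exact absurd hij.symm (hne j hj)
    · exact Fin.ext (by omega)
  have hvmem : Set.range v ⊆ V(G) := by
    rintro _ ⟨i, rfl⟩
    exact (hlink i).2.left_mem
  let C : Graph α β := (G.restrict (Set.range g)).induce (Set.range v)
  refine h.2 C ?_ ⟨l, v, g, fun i j hij => Fin.ext (hinj _ _ (by omega) (by omega) hij), hginj,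
    rfl, ?_, ?_⟩
  · refine ⟨hvmem, fun f' x y hxy => ?_⟩
    obtain ⟨⟨⟨i, rfl⟩, h2⟩, -⟩ := hxy
    exact ⟨(hlink i).1, h2⟩
  · ext f'
    constructor
    · rintro ⟨x, y, h1, -⟩
      exact h1.1
    · rintro ⟨i, rfl⟩
      exact ⟨v i, v (i + 1), ⟨⟨i, rfl⟩, (hlink i).2⟩, ⟨i, rfl⟩, ⟨i + 1, rfl⟩⟩
  · exact fun i => ⟨⟨⟨i, rfl⟩, (hlink i).2⟩, ⟨i, rfl⟩, ⟨i + 1, rfl⟩⟩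

end Graph

/-! ### Heights -/

namespace Graph

variable {α β : Type*} {G : Graph α β} {p x y : α} {e : β}

theorem distance_le_of_isLink (hx : G.Joined p x) (h : G.IsLink e x y) :
    G.distance p y ≤ G.distance p x + 1 := by
  by_cases hxy : x = y
  · subst hxy; omega
  obtain ⟨w, hw⟩ := SimpleGraph.Reachable.exists_walk_length_eq_dist hx
  have hadj : G.underlying.Adj x y := (SimpleGraph.fromRel_adj _ _ _).2 ⟨hxy, Or.inl ⟨e, h⟩⟩
  have := SimpleGraph.dist_le (w.concat hadj)
  rw [SimpleGraph.Walk.length_concat, hw] at this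
  exact this

theorem distance_self (G : Graph α β) (p : α) : G.distance p p = 0 := SimpleGraph.dist_self

theorem eq_of_distance_eq_zero (hx : G.Joined p x) (h : G.distance p x = 0) : p = x :=
  (SimpleGraph.Reachable.dist_eq_zero_iff hx).1 h

theorem exists_isLink_distance_add_one (hx : G.Joined p x) (h : G.distance p x ≠ 0) :
    ∃ e y, G.IsLink e x y ∧ G.distance p x = G.distance p y + 1 := by
  obtain ⟨w, hw⟩ := SimpleGraph.Reachable.exists_walk_length_eq_dist (Joined.symm hx)
  have hw' : w.length = G.distance p x := hw.trans SimpleGraph.dist_comm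
  cases w with
  | nil => simp at hw'; omega
  | @cons _ y _ hadj q =>
    obtain ⟨e, he⟩ := exists_isLink_of_underlying_adj hadj
    refine ⟨e, y, he, ?_⟩
    have h1 : G.distance p y ≤ q.length := by
      rw [distance, SimpleGraph.dist_comm]
      exact SimpleGraph.dist_le q
    have h2 := distance_le_of_isLink (hx.trans he.joined) he.symm
    rw [SimpleGraph.Walk.length_cons] at hw'
    omega

/-- A function that grows by at most one along each edge is bounded by the length of any walk from
`p`. This gives lower bounds for heights in blow-downs. -/
theorem le_distance {f : α → ℕ} (hp : f p = 0) (hf : ∀ e x y, G.IsLink e x y → f y ≤ f x + 1)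
    (hx : G.Joined p x) : f x ≤ G.distance p x := by
  obtain ⟨w, hw⟩ := SimpleGraph.Reachable.exists_walk_length_eq_dist hx
  rw [distance, ← hw]
  have : ∀ {a b : α} (w : G.underlying.Walk a b), f b ≤ f a + w.length := by
    intro a b w
    induction w with
    | nil => simp
    | cons hadj q ih =>
      obtain ⟨e, he⟩ := exists_isLink_of_underlying_adj hadj
      have := hf e _ _ he
      rw [SimpleGraph.Walk.length_cons]
      omega
  simpa [hp] using this w

end Graph

namespace DistinguishedGraph

variable {α β : Type*} {m : ℕ} {Γ : DistinguishedGraph α β m} {F F' : Set β} {e : β}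
  {a b x y u v : α} {d k : ℕ} {j : Fin m}

theorem IsWellFormed.joined_base (hΓ : Γ.IsWellFormed) (hx : x ∈ V(Γ.graph)) :
    Γ.graph.Joined Γ.base x :=
  hΓ.connected.2 _ hΓ.base_mem _ hx

theorem IsWellFormed.height_le (hΓ : Γ.IsWellFormed) (h : Γ.graph.IsLink e x y) :
    Γ.height y ≤ Γ.height x + 1 :=
  Graph.distance_le_of_isLink (hΓ.joined_base h.left_mem) h

theorem height_base (Γ : DistinguishedGraph α β m) : Γ.height Γ.base = 0 :=
  Graph.distance_self _ _

theorem IsWellFormed.eq_base (hΓ : Γ.IsWellFormed) (hx : x ∈ V(Γ.graph)) (h : Γ.height x = 0) :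
    x = Γ.base :=
  (Graph.eq_of_distance_eq_zero (hΓ.joined_base hx) h).symm

theorem IsWellFormed.exists_isLink_down (hΓ : Γ.IsWellFormed) (hx : x ∈ V(Γ.graph))
    (h : Γ.height x ≠ 0) : ∃ e y, Γ.graph.IsLink e x y ∧ Γ.height x = Γ.height y + 1 :=
  Graph.exists_isLink_distance_add_one (hΓ.joined_base hx) h

theorem IsWellFormed.mem_graph (hΓ : Γ.IsWellFormed) (hx : x ∈ V(Γ.cycle j)) : x ∈ V(Γ.graph) :=
  (hΓ.cycle_le j).vertexSet_mono hx

/-! ### Admissible forests -/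

/-- Suppose that the connection of `x` and `y` inside the cycle uses `e`. Together with the
connection that avoids `e`, it joins the ends of `e` within `F \ {e}`, which is impossible in a
forest. -/
theorem IsAdmissible.diff_singleton (hΓ : Γ.IsWellFormed) (hF : Γ.IsAdmissible F) (e : β) :
    Γ.IsAdmissible (F \ {e}) := by
  refine ⟨hF.isForest.mono Set.sdiff_subset, fun j k x hx y hy h =>
    hF.eq_of_joined j k x hx y hy (h.restrict_mono Set.sdiff_subset), fun j x hx y hy h => ?_⟩
  by_cases heF : e ∈ F
  swap
  · rw [Set.sdiff_singleton_eq_self heF] at h ⊢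
    exact hF.joined_in_cycle j x hx y hy h
  have h1 := hF.joined_in_cycle j x hx y hy (h.restrict_mono Set.sdiff_subset)
  by_cases heC : e ∈ E(Γ.cycle j)
  · obtain ⟨a, b, hab⟩ := Graph.exists_isLink_of_mem_edgeSet heC
    have hins : F = insert e (F \ {e}) := by simp [Set.insert_eq_of_mem heF]
    have hnot := hF.isForest.not_joined heF (hab.mono (hΓ.cycle_le j))
    rw [hins] at h1
    rcases Graph.joined_restrict_insert hab h1 with h2 | ⟨h2, h3⟩ | ⟨h2, h3⟩
    · exact h2
    · have h2' := h2.restrict_mono_left (hΓ.cycle_le j)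
      have h3' := h3.restrict_mono_left (hΓ.cycle_le j)
      exact absurd (h2'.symm.trans (h.trans h3'.symm)) hnot
    · have h2' := h2.restrict_mono_left (hΓ.cycle_le j)
      have h3' := h3.restrict_mono_left (hΓ.cycle_le j)
      exact absurd (h3'.trans (h.symm.trans h2')) hnot
  · refine h1.induction (.refl _ x) ?_
    rintro f z w ⟨hf, hl⟩ hz
    refine hz.trans (hl.joined_restrict ⟨hf, ?_⟩)
    rintro rfl
    exact heC hl.edge_mem

theorem IsAdmissible.mono [Finite β] (hΓ : Γ.IsWellFormed) (hF : Γ.IsAdmissible F')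
    (h : F ⊆ F') : Γ.IsAdmissible F := by
  have key : ∀ D : Set β, Γ.IsAdmissible (F' \ D) := by
    intro D
    induction D, D.toFinite using Set.Finite.induction_on with
    | empty => simpa using hF
    | @insert e D _ _ ih =>
      have : F' \ insert e D = (F' \ D) \ {e} := by ext; simp; tauto
      rw [this]
      exact ih.diff_singleton hΓ e
  have := key (F' \ F)
  rwa [Set.sdiff_sdiff_cancel_left h] at this

/-- The two trees that are merged meet only the cycle `j`, each in a connected piece, and `e`
connects the two pieces inside the cycle. -/
theorem IsAdmissible.insert_cycle_edge (hΓ : Γ.IsWellFormed) (hF : Γ.IsAdmissible F)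
    (he : (Γ.cycle j).IsLink e a b) (hab : ¬ (Γ.graph.restrict F).Joined a b) :
    Γ.IsAdmissible (insert e F) := by
  have heG := he.mono (hΓ.cycle_le j)
  refine ⟨hF.isForest.insert heG hab, fun k l x hx y hy h => ?_, fun k x hx y hy h => ?_⟩
  · rcases Graph.joined_restrict_insert heG h with h | ⟨h1, h2⟩ | ⟨h1, h2⟩
    · exact hF.eq_of_joined k l x hx y hy h
    · exact (hF.eq_of_joined k j x hx a he.left_mem h1).trans
        (hF.eq_of_joined j l b he.right_mem y hy h2)
    · exact (hF.eq_of_joined k j x hx b he.right_mem h1).trans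
        (hF.eq_of_joined j l a he.left_mem y hy h2)
  · have hsub := Set.subset_insert e F
    have hl := he.joined_restrict (Set.mem_insert e F)
    rcases Graph.joined_restrict_insert heG h with h | ⟨h1, h2⟩ | ⟨h1, h2⟩
    · exact (hF.joined_in_cycle k x hx y hy h).restrict_mono hsub
    · obtain rfl := hF.eq_of_joined k j x hx a he.left_mem h1
      exact ((hF.joined_in_cycle k x hx a he.left_mem h1).restrict_mono hsub).trans
        (hl.trans ((hF.joined_in_cycle k b he.right_mem y hy h2).restrict_mono hsub))
    · obtain rfl := hF.eq_of_joined k j x hx b he.right_mem h1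
      exact ((hF.joined_in_cycle k x hx b he.right_mem h1).restrict_mono hsub).trans
        (hl.symm.trans ((hF.joined_in_cycle k a he.left_mem y hy h2).restrict_mono hsub))

theorem isAdmissible_empty (Γ : DistinguishedGraph α β m) (hΓ : Γ.IsWellFormed) :
    Γ.IsAdmissible ∅ := by
  have heq : ∀ x y, (Γ.graph.restrict ∅).Joined x y → y = x := fun x y h =>
    h.eq_of_forall_not_inc (by simp)
  refine ⟨⟨by simp, fun C hC hcyc => ?_⟩, fun j k x hx y hy h => ?_, fun j x hx y hy h => ?_⟩
  · obtain ⟨n, v, e, hC'⟩ := hcyc.exists_enumeration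
    exact ((hC'.isLink 0).mono hC).1
  · obtain rfl := heq x y h
    by_contra hjk
    exact (hΓ.disjoint j k hjk).le_bot ⟨hx, hy⟩
  · obtain rfl := heq x y h
    exact .refl _ _

/-! ### Nice forests -/

/-- All vertices of the `j`-th distinguished cycle have height at least `k`. -/
def CycleAbove (Γ : DistinguishedGraph α β m) (k : ℕ) (j : Fin m) : Prop :=
  ∀ w ∈ V(Γ.cycle j), k ≤ Γ.height w

/-- The edges of `F` both of whose ends have height at least `k`. -/
def upper (Γ : DistinguishedGraph α β m) (F : Set β) (k : ℕ) : Set β :=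
  {e ∈ F | ∀ v, Γ.graph.Inc e v → k ≤ Γ.height v}

/-- Different vertices of level `k` in the same tree lie in a common distinguished cycle which has
no vertices below level `k`, and if a tree meets level `k` and such a cycle, then its vertices
of level `k` are in this cycle. -/
structure IsNice (Γ : DistinguishedGraph α β m) (k : ℕ) (F : Set β) : Prop where
  exists_cycle : ∀ x ∈ Γ.level k, ∀ y ∈ Γ.level k, x ≠ y → (Γ.graph.restrict F).Joined x y →
    ∃ j, x ∈ V(Γ.cycle j) ∧ y ∈ V(Γ.cycle j) ∧ Γ.CycleAbove k j
  mem_cycle : ∀ u ∈ Γ.level k, ∀ j, Γ.CycleAbove k j → ∀ x ∈ V(Γ.cycle j),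
    (Γ.graph.restrict F).Joined u x → u ∈ V(Γ.cycle j)

/-- Admissible forests whose part above each level is nice at this level. -/
def IsTotallyNice (Γ : DistinguishedGraph α β m) (F : Set β) : Prop :=
  Γ.IsAdmissible F ∧ ∀ k, Γ.IsNice k (Γ.upper F k)

theorem upper_subset : Γ.upper F k ⊆ F := fun _ h => h.1

theorem upper_insert_subset : Γ.upper (insert e F) k ⊆ insert e (Γ.upper F k) := by
  rintro f ⟨rfl | hf, h⟩
  · exact Or.inl rfl
  · exact Or.inr ⟨hf, h⟩

theorem upper_insert_of_lt (hv : Γ.graph.Inc e v) (h : Γ.height v < k) :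
    Γ.upper (insert e F) k = Γ.upper F k := by
  ext f
  constructor
  · rintro ⟨rfl | hf, h'⟩
    · exact absurd (h' v hv) (by omega)
    · exact ⟨hf, h'⟩
  · exact fun hf => ⟨Or.inr hf.1, hf.2⟩

theorem IsNice.mono (h : Γ.IsNice k F') (hF : F ⊆ F') : Γ.IsNice k F :=
  ⟨fun x hx y hy hxy hj => h.exists_cycle x hx y hy hxy (hj.restrict_mono hF),
    fun u hu j hj x hx hux => h.mem_cycle u hu j hj x hx (hux.restrict_mono hF)⟩

theorem isNice_of_forall_height_ne (h : ∀ e ∈ F, ∀ v, Γ.graph.Inc e v → Γ.height v ≠ k) :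
    Γ.IsNice k F := by
  have heq : ∀ x ∈ Γ.level k, ∀ y, (Γ.graph.restrict F).Joined x y → y = x := fun x hx y hj =>
    hj.eq_of_forall_not_inc fun e he hi => h e he x hi hx.2
  exact ⟨fun x hx y _ hxy hj => absurd (heq x hx y hj).symm hxy,
    fun u hu j _ x hx hj => heq u hu x hj ▸ hx⟩

/-- Both trees that are merged meet the cycle `j`, so by `mem_cycle` their vertices of level `k`
already lie on it. -/
theorem IsNice.insert_cycle_edge (hΓ : Γ.IsWellFormed) (hF : Γ.IsNice k F)
    (hadm : ∀ i l, ∀ x ∈ V(Γ.cycle i), ∀ y ∈ V(Γ.cycle l),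
      (Γ.graph.restrict F).Joined x y → i = l)
    (he : e ∈ E(Γ.cycle j)) (hj : Γ.CycleAbove k j) : Γ.IsNice k (insert e F) := by
  obtain ⟨a, b, hab⟩ := Graph.exists_isLink_of_mem_edgeSet he
  have habG := hab.mono (hΓ.cycle_le j)
  have ha := hab.left_mem
  have hb := hab.right_mem
  constructor
  · intro x hx y hy hxy h
    rcases Graph.joined_restrict_insert habG h with h | ⟨h1, h2⟩ | ⟨h1, h2⟩
    · exact hF.exists_cycle x hx y hy hxy h
    · exact ⟨j, hF.mem_cycle x hx j hj a ha h1, hF.mem_cycle y hy j hj b hb h2.symm, hj⟩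
    · exact ⟨j, hF.mem_cycle x hx j hj b hb h1, hF.mem_cycle y hy j hj a ha h2.symm, hj⟩
  · intro u hu l hl x hx h
    rcases Graph.joined_restrict_insert habG h with h | ⟨h1, h2⟩ | ⟨h1, h2⟩
    · exact hF.mem_cycle u hu l hl x hx h
    · obtain rfl := hadm j l b hb x hx h2
      exact hF.mem_cycle u hu j hj a ha h1
    · obtain rfl := hadm j l a ha x hx h2
      exact hF.mem_cycle u hu j hj b hb h1

/-- Levels above the height of `v` do not see `e`, and no vertex of the cycle is below any of the
other levels. -/
theorem IsTotallyNice.insert_of_isAdmissible (hΓ : Γ.IsWellFormed) (hF : Γ.IsTotallyNice F)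
    (he : e ∈ E(Γ.cycle j)) (hv : Γ.graph.Inc e v) (hj : Γ.CycleAbove (Γ.height v) j)
    (hadm : Γ.IsAdmissible (insert e F)) : Γ.IsTotallyNice (insert e F) := by
  refine ⟨hadm, fun k => ?_⟩
  rcases lt_or_ge (Γ.height v) k with hk | hk
  · rw [upper_insert_of_lt hv hk]
    exact hF.2 k
  · refine IsNice.mono (IsNice.insert_cycle_edge hΓ (hF.2 k) ?_ he fun w hw => hk.trans (hj w hw))
      upper_insert_subset
    exact fun i l x hx y hy h =>
      hF.1.eq_of_joined i l x hx y hy (h.restrict_mono upper_subset)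

theorem isTotallyNice_empty (hΓ : Γ.IsWellFormed) : Γ.IsTotallyNice ∅ :=
  ⟨isAdmissible_empty Γ hΓ, fun _ => isNice_of_forall_height_ne fun _ he => absurd he.1 (by simp)⟩

/-! ### The blow-down -/

theorem component_eq_iff :
    Γ.graph.component F x = Γ.graph.component F y ↔ (Γ.graph.restrict F).Joined x y := by
  constructor
  · intro h
    have : y ∈ Γ.graph.component F x := by rw [h]; exact .refl _ y
    exact this
  · intro h
    ext z
    exact ⟨fun hz => h.symm.trans hz, fun hz => h.trans hz⟩

theorem joined_blowDown (h : Γ.graph.Joined x y) :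
    (Γ.blowDown F).graph.Joined (Γ.graph.component F x) (Γ.graph.component F y) := by
  refine h.induction (P := fun y => (Γ.blowDown F).graph.Joined (Γ.graph.component F x)
    (Γ.graph.component F y)) (.refl _ _) fun e z w hl hz => hz.trans ?_
  by_cases he : e ∈ F
  · rw [component_eq_iff.2 (hl.joined_restrict he)]
    exact .refl _ _
  · exact Graph.IsLink.joined (e := e) ⟨z, w, ⟨hl, he⟩, rfl, rfl⟩

theorem height_blowDown_le (hΓ : Γ.IsWellFormed) (hx : x ∈ V(Γ.graph)) :
    (Γ.blowDown F).height (Γ.graph.component F x) ≤ Γ.height x := by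
  induction hn : Γ.height x generalizing x with
  | zero =>
    rw [hΓ.eq_base hx hn]
    exact (height_base (Γ.blowDown F)).le
  | succ n ih =>
    obtain ⟨e, y, hl, hy⟩ := hΓ.exists_isLink_down hx (by omega)
    have h1 := ih hl.right_mem (by omega)
    by_cases he : e ∈ F
    · rw [component_eq_iff.2 (hl.joined_restrict he)]
      omega
    · have h2 := Graph.distance_le_of_isLink (e := e) (G := (Γ.blowDown F).graph)
        (p := Γ.graph.component F Γ.base) (x := Γ.graph.component F y)
        (y := Γ.graph.component F x) (joined_blowDown (hΓ.joined_base hl.right_mem))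
        ⟨y, x, ⟨hl.symm, he⟩, rfl, rfl⟩
      exact h2.trans (Nat.succ_le_succ h1)

/-- The left side grows by at most one along an edge of the blow-down: a component with a vertex
below `d` is a single vertex, and on all others the value is `d` or `d + 1`. The cap is needed
because the blow-down may lower heights above `d`. -/
theorem min_sInf_le_height_blowDown (hΓ : Γ.IsWellFormed)
    (hd : ∀ e ∈ F, ∀ v, Γ.graph.Inc e v → d ≤ Γ.height v) (hx : x ∈ V(Γ.graph)) :
    min (sInf (Γ.height '' Γ.graph.component F x)) (d + 1) ≤
      (Γ.blowDown F).height (Γ.graph.component F x) := by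
  refine Graph.le_distance (f := fun c => min (sInf (Γ.height '' c)) (d + 1)) ?_ ?_
    (joined_blowDown (hΓ.joined_base hx))
  · have h0 : (0 : ℕ) ∈ Γ.height '' Γ.graph.component F Γ.base :=
      ⟨Γ.base, .refl _ _, height_base Γ⟩
    have := Nat.sInf_le h0
    change min (sInf (Γ.height '' Γ.graph.component F Γ.base)) (d + 1) = 0
    omega
  · rintro e _ _ ⟨z, w, ⟨hl, -⟩, rfl, rfl⟩
    obtain ⟨z', hz', hs⟩ := Nat.sInf_mem (s := Γ.height '' Γ.graph.component F z)
      ⟨_, z, .refl _ z, rfl⟩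
    rcases lt_or_ge (Γ.height z') d with hlt | hge
    · have hzz : z = z' := Graph.Joined.eq_of_forall_not_inc (G := Γ.graph) (F := F)
        (Graph.Joined.symm hz') fun e he hi => by
          have := hd e he z' hi
          omega
      subst hzz
      have h1 : sInf (Γ.height '' Γ.graph.component F w) ≤ Γ.height w :=
        Nat.sInf_le ⟨w, .refl _ w, rfl⟩
      have h2 := hΓ.height_le hl
      omega
    · omega

theorem le_height_of_joined
    (hd : ∀ e ∈ F, ∀ v, Γ.graph.Inc e v → d ≤ Γ.height v)
    (h : (Γ.graph.restrict F).Joined x y) (hx : d ≤ Γ.height x) :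
    d ≤ Γ.height y :=
  h.induction (P := fun y => d ≤ Γ.height y) hx fun e _ w hl _ => hd e hl.1 w hl.2.inc_right

theorem le_height_blowDown (hΓ : Γ.IsWellFormed)
    (hd : ∀ e ∈ F, ∀ v, Γ.graph.Inc e v → d ≤ Γ.height v) (hx : x ∈ V(Γ.graph)) (h : d ≤ Γ.height x) :
    d ≤ (Γ.blowDown F).height (Γ.graph.component F x) := by
  have h1 := min_sInf_le_height_blowDown hΓ hd hx
  have h2 : d ≤ sInf (Γ.height '' Γ.graph.component F x) := by
    refine le_csInf ⟨_, x, .refl _ x, rfl⟩ ?_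
    rintro _ ⟨z, hz, rfl⟩
    exact le_height_of_joined hd hz h
  omega

theorem exists_mem_level (hΓ : Γ.IsWellFormed)
    (hd : ∀ e ∈ F, ∀ v, Γ.graph.Inc e v → d ≤ Γ.height v) (hx : x ∈ V(Γ.graph))
    (h : (Γ.blowDown F).height (Γ.graph.component F x) = d) :
    ∃ u ∈ Γ.level d, Γ.graph.component F u = Γ.graph.component F x := by
  have h1 := min_sInf_le_height_blowDown hΓ hd hx
  have h2 := height_blowDown_le (F := F) hΓ hx
  obtain ⟨u, hu, hs⟩ := Nat.sInf_mem (s := Γ.height '' Γ.graph.component F x)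
    ⟨_, x, .refl _ x, rfl⟩
  have h3 : d ≤ Γ.height u := le_height_of_joined hd hu (by omega)
  exact ⟨u, ⟨Graph.Joined.mem_right (G := Γ.graph.restrict F) hu hx, by omega⟩, (component_eq_iff.2 hu).symm⟩

theorem height_blowDown_of_mem_level (hΓ : Γ.IsWellFormed)
    (hd : ∀ e ∈ F, ∀ v, Γ.graph.Inc e v → d ≤ Γ.height v) (hu : u ∈ Γ.level d) :
    (Γ.blowDown F).height (Γ.graph.component F u) = d :=
  le_antisymm ((height_blowDown_le hΓ hu.1).trans hu.2.le) (le_height_blowDown hΓ hd hu.1 hu.2.ge)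

/-- The blow-down does not change whether a cycle has vertices below level `d`. For a tree through
level `d`, being a base vertex therefore only requires that it meets a cycle without such vertices.
-/
theorem isBaseVertex_blowDown_iff (hΓ : Γ.IsWellFormed)
    (hd : ∀ e ∈ F, ∀ v, Γ.graph.Inc e v → d ≤ Γ.height v) (hu : u ∈ Γ.level d) :
    (Γ.blowDown F).IsBaseVertex (Γ.graph.component F u) ↔
      ∃ j, Γ.CycleAbove d j ∧ ∃ x ∈ V(Γ.cycle j), (Γ.graph.restrict F).Joined u x := by
  have hh := height_blowDown_of_mem_level hΓ hd hu
  constructor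
  · rintro ⟨j, ⟨x, hx, hxu⟩, hmin⟩
    refine ⟨j, fun w hw => ?_, x, hx, component_eq_iff.1 hxu.symm⟩
    have := hmin _ ⟨w, hw, rfl⟩
    rw [hh] at this
    exact this.trans (height_blowDown_le hΓ (hΓ.mem_graph hw))
  · rintro ⟨j, hj, x, hx, hux⟩
    refine ⟨j, ⟨x, hx, (component_eq_iff.2 hux).symm⟩, ?_⟩
    rintro _ ⟨w, hw, rfl⟩
    rw [hh]
    exact le_height_blowDown hΓ hd (hΓ.mem_graph hw) (hj w hw)

theorem setOf_isBaseVertex_blowDown (hΓ : Γ.IsWellFormed)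
    (hd : ∀ e ∈ F, ∀ v, Γ.graph.Inc e v → d ≤ Γ.height v) :
    {c | c ∈ (Γ.blowDown F).level d ∧ (Γ.blowDown F).IsBaseVertex c} =
      Γ.graph.component F '' {u | u ∈ Γ.level d ∧ ∃ j, Γ.CycleAbove d j ∧
        ∃ x ∈ V(Γ.cycle j), (Γ.graph.restrict F).Joined u x} := by
  ext c
  constructor
  · rintro ⟨⟨⟨x, hx, rfl⟩, hxd⟩, hbase⟩
    obtain ⟨u, hu, hux⟩ := exists_mem_level hΓ hd hx hxd
    rw [← hux] at hbase
    exact ⟨u, ⟨hu, (isBaseVertex_blowDown_iff hΓ hd hu).1 hbase⟩, hux⟩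
  · rintro ⟨u, ⟨hu, h⟩, rfl⟩
    exact ⟨⟨⟨u, hu.1, rfl⟩, height_blowDown_of_mem_level hΓ hd hu⟩,
      (isBaseVertex_blowDown_iff hΓ hd hu).2 h⟩

theorem setOf_isBaseVertex (Γ : DistinguishedGraph α β m) (d : ℕ) :
    {u | u ∈ Γ.level d ∧ Γ.IsBaseVertex u} =
      {u | u ∈ Γ.level d ∧ ∃ j, Γ.CycleAbove d j ∧ u ∈ V(Γ.cycle j)} := by
  ext u
  constructor
  · rintro ⟨hu, j, huj, hmin⟩
    exact ⟨hu, j, fun w hw => hu.2.ge.trans (hmin w hw), huj⟩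
  · rintro ⟨hu, j, hj, huj⟩
    exact ⟨hu, j, huj, fun w hw => hu.2.le.trans (hj w hw)⟩

theorem forestLevel_le (he : e ∈ F) (hv : Γ.graph.Inc e v) : Γ.forestLevel F ≤ Γ.height v :=
  Nat.sInf_le ⟨e, he, v, hv, rfl⟩

theorem exists_forestLevel_eq (hne : F.Nonempty) (hF : F ⊆ E(Γ.graph)) :
    ∃ e ∈ F, ∃ v, Γ.graph.Inc e v ∧ Γ.height v = Γ.forestLevel F := by
  obtain ⟨e, he⟩ := hne
  obtain ⟨a, b, hab⟩ := Graph.exists_isLink_of_mem_edgeSet (hF he)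
  exact Nat.sInf_mem (s := {i | ∃ e ∈ F, ∃ v, Γ.graph.Inc e v ∧ Γ.height v = i})
    ⟨_, e, he, a, hab.inc_left, rfl⟩

/-! ### Good forests and nice forests -/

variable [Finite α]

/-- By `mem_cycle` the base vertices of level `d` in the blow-down are the images of those in `Γ`,
so their number cannot grow. If it stays the same, the images are distinct, whereas by
`exists_cycle` an arc would identify two base vertices. -/
theorem IsTotallyNice.isGood (hΓ : Γ.IsWellFormed) (hF : Γ.IsTotallyNice F) : Γ.IsGood F := by
  set d := Γ.forestLevel F with hdef
  have hd : ∀ e ∈ F, ∀ v, Γ.graph.Inc e v → d ≤ Γ.height v := fun e he v hv => forestLevel_le he hv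
  have hup : Γ.upper F d = F := Set.Subset.antisymm upper_subset fun e he => ⟨he, hd e he⟩
  have hnice := hF.2 d
  rw [hup] at hnice
  set B := {u | u ∈ Γ.level d ∧ ∃ j, Γ.CycleAbove d j ∧ u ∈ V(Γ.cycle j)} with hB
  have hsub : {u | u ∈ Γ.level d ∧ ∃ j, Γ.CycleAbove d j ∧
      ∃ x ∈ V(Γ.cycle j), (Γ.graph.restrict F).Joined u x} = B := by
    ext u
    constructor
    · rintro ⟨hu, j, hj, x, hx, hux⟩
      exact ⟨hu, j, hj, hnice.mem_cycle u hu j hj x hx hux⟩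
    · rintro ⟨hu, j, hj, huj⟩
      exact ⟨hu, j, hj, u, huj, .refl _ u⟩
  have hcard : Γ.baseChange d F = ((Γ.graph.component F '' B).ncard : ℤ) - B.ncard := by
    rw [baseChange, numBaseVertices, numBaseVertices, setOf_isBaseVertex_blowDown hΓ hd, hsub,
      setOf_isBaseVertex]
  have hle : (Γ.graph.component F '' B).ncard ≤ B.ncard := Set.ncard_image_le B.toFinite
  rw [IsGood, ← hdef, hcard]
  rcases hle.lt_or_eq with hlt | heq
  · left; omega
  · right
    refine ⟨by omega, ?_⟩
    rintro ⟨x, hx, y, hy, hxy, hj⟩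
    rw [← hdef] at hx hy
    obtain ⟨j, hxj, hyj, hab⟩ := hnice.exists_cycle x hx y hy hxy hj
    exact hxy ((Set.ncard_image_iff B.toFinite).1 heq ⟨hx, j, hab, hxj⟩ ⟨hy, j, hab, hyj⟩
      (component_eq_iff.2 hj))

/-- Without such edges, admissibility puts the base vertices of level `d` into different trees.
Their number cannot drop, so goodness means no change and no arcs. Hence each base vertex of level
`d` in the blow-down is a tree containing an old one, which is its only vertex of level `d`. -/
theorem IsGood.isNice (hΓ : Γ.IsWellFormed) (hadm : Γ.IsAdmissible F) (hF : Γ.IsGood F)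
    (hno : ∀ j, Γ.CycleAbove (Γ.forestLevel F) j → ∀ e ∈ F, ∀ u, (Γ.cycle j).Inc e u →
      Γ.height u ≠ Γ.forestLevel F) : Γ.IsNice (Γ.forestLevel F) F := by
  set d := Γ.forestLevel F with hdef
  have hd : ∀ e ∈ F, ∀ v, Γ.graph.Inc e v → d ≤ Γ.height v := fun e he v hv => forestLevel_le he hv
  set B := {u | u ∈ Γ.level d ∧ ∃ j, Γ.CycleAbove d j ∧ u ∈ V(Γ.cycle j)} with hB
  set B' := {u | u ∈ Γ.level d ∧ ∃ j, Γ.CycleAbove d j ∧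
      ∃ x ∈ V(Γ.cycle j), (Γ.graph.restrict F).Joined u x} with hB'
  have hsub : B ⊆ B' := by
    rintro u ⟨hu, j, hj, huj⟩
    exact ⟨hu, j, hj, u, huj, .refl _ u⟩
  have hcard : Γ.baseChange d F = ((Γ.graph.component F '' B').ncard : ℤ) - B.ncard := by
    rw [baseChange, numBaseVertices, numBaseVertices, setOf_isBaseVertex_blowDown hΓ hd,
      setOf_isBaseVertex]
  have hinj : Set.InjOn (Γ.graph.component F) B := by
    rintro x ⟨hx, j, hj, hxj⟩ y ⟨hy, l, hl, hyl⟩ hxy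
    have hxy' := component_eq_iff.1 hxy
    obtain rfl := hadm.eq_of_joined j l x hxj y hyl hxy'
    exact ((hadm.joined_in_cycle j x hxj y hyl hxy').eq_of_forall_not_inc
      fun e he hi => hno j hj e he x hi hx.2).symm
  have hle : B.ncard ≤ (Γ.graph.component F '' B').ncard := by
    rw [← Set.InjOn.ncard_image hinj]
    exact Set.ncard_le_ncard (Set.image_mono hsub)
  have hgood : Γ.baseChange d F = 0 ∧ ¬ Γ.IsArced F := by
    rcases hF with h | h
    · rw [← hdef, hcard] at h
      omega
    · exact h
  have himage : Γ.graph.component F '' B = Γ.graph.component F '' B' := by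
    refine Set.eq_of_subset_of_ncard_le (Set.image_mono hsub) ?_
    rw [Set.InjOn.ncard_image hinj]
    have := hgood.1
    omega
  constructor
  · exact fun x hx y hy hxy hj => absurd ⟨x, hx, y, hy, hxy, hj⟩ hgood.2
  · intro u hu j hj x hx hux
    have hu' : Γ.graph.component F u ∈ Γ.graph.component F '' B := by
      rw [himage]
      exact ⟨u, ⟨hu, j, hj, x, hx, hux⟩, rfl⟩
    obtain ⟨b, ⟨hb, l, hl, hbl⟩, hbu⟩ := hu'
    have hbu' := component_eq_iff.1 hbu
    by_cases h : b = u
    · subst h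
      obtain rfl := hadm.eq_of_joined l j b hbl x hx hux
      exact hbl
    · exact absurd ⟨b, hb, u, hu, h, hbu'⟩ hgood.2

/-- If `F` is nice at its lowest level `d`, any edge reaching level `d` will do, as no higher level
sees it. Otherwise `IsGood.isNice` yields a cycle edge in `F` at a base vertex of level `d`. -/
theorem IsGood.exists_insert [Finite β] (hΓ : Γ.IsWellFormed) (hne : F.Nonempty)
    (hadm : Γ.IsAdmissible F) (hF : Γ.IsGood F) :
    ∃ e ∈ F, ∀ G, Γ.IsTotallyNice G → G ⊆ F → Γ.IsTotallyNice (insert e G) := by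
  set d := Γ.forestLevel F with hdef
  have hd : ∀ e ∈ F, ∀ v, Γ.graph.Inc e v → d ≤ Γ.height v := fun e he v hv => forestLevel_le he hv
  by_cases hnice : Γ.IsNice d F
  · obtain ⟨e, he, v, hv, hvd⟩ := exists_forestLevel_eq hne hadm.isForest.1
    refine ⟨e, he, fun G hG hGF => ?_⟩
    have hsub : insert e G ⊆ F := Set.insert_subset he hGF
    refine ⟨hadm.mono hΓ hsub, fun k => ?_⟩
    rcases lt_trichotomy k d with hk | rfl | hk
    · refine (isNice_of_forall_height_ne fun e he v hv => ?_).mono (upper_subset.trans hsub)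
      have := hd e he v hv
      omega
    · exact hnice.mono (upper_subset.trans hsub)
    · rw [upper_insert_of_lt hv (by omega)]
      exact hG.2 k
  · have : ¬ ∀ j, Γ.CycleAbove d j → ∀ e ∈ F, ∀ u, (Γ.cycle j).Inc e u → Γ.height u ≠ d :=
      fun h => hnice (hF.isNice hΓ hadm h)
    push Not at this
    obtain ⟨j, hj, e, he, u, hu, hud⟩ := this
    refine ⟨e, he, fun G hG hGF => ?_⟩
    exact hG.insert_of_isAdmissible hΓ hu.edge_mem (hu.mono (hΓ.cycle_le j)) (hud.symm ▸ hj)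
      (hadm.mono hΓ (Set.insert_subset he hGF))

end DistinguishedGraph

/-! ### A cycle with an edge away from its base vertices -/

namespace DistinguishedGraph

variable {α β : Type*} {m : ℕ} {Γ : DistinguishedGraph α β m} {F F' : Set β} {e f : β}
  {a b x y u v w : α} {d i k : ℕ} {j l : Fin m}

theorem IsWellFormed.eq_of_mem (hΓ : Γ.IsWellFormed) (hj : x ∈ V(Γ.cycle j))
    (hl : x ∈ V(Γ.cycle l)) : j = l := by
  by_contra hjl
  exact (hΓ.disjoint j l hjl).le_bot ⟨hj, hl⟩

theorem IsTotallyNice.insert_cycle_edge (hΓ : Γ.IsWellFormed) (hF : Γ.IsTotallyNice F)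
    (he : (Γ.cycle j).IsLink e a b) (hab : ¬ (Γ.graph.restrict F).Joined a b)
    (hw : (Γ.cycle j).Inc e w) (hj : Γ.CycleAbove (Γ.height w) j) :
    Γ.IsTotallyNice (insert e F) :=
  hF.insert_of_isAdmissible hΓ he.edge_mem (hw.mono (hΓ.cycle_le j)) hj
    (hF.1.insert_cycle_edge hΓ he hab)

theorem IsAdmissible.mem_of_joined (hΓ : Γ.IsWellFormed) (hF : Γ.IsAdmissible F)
    (he : (Γ.cycle j).IsLink e a b) (heF : e ∉ F) (hab : (Γ.graph.restrict F).Joined a b)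
    (hf : f ∈ E(Γ.cycle j)) (hfe : f ≠ e) : f ∈ F :=
  (hΓ.isCycleGraph j).mem_of_joined he heF
    (hF.joined_in_cycle j a he.left_mem b he.right_mem hab) hf hfe

/-- If `e` could not be added, `F` would contain all other edges of the cycle. Consider the arc
around `f` between the two nearest vertices of minimal height. Its interior joins two different
vertices one level higher, so by niceness there they lie on a cycle without lower vertices. But the
only distinguished cycle through them contains `w`. -/
theorem IsTotallyNice.insert_of_height_ne (hΓ : Γ.IsWellFormed) (hF : Γ.IsTotallyNice F)
    (hw : (Γ.cycle j).Inc e w) (hj : Γ.CycleAbove (Γ.height w) j) (hf : f ∈ E(Γ.cycle j))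
    (hfw : ∀ v, (Γ.cycle j).Inc f v → Γ.height v ≠ Γ.height w) :
    Γ.IsTotallyNice (insert e F) := by
  by_cases heF : e ∈ F
  · rwa [Set.insert_eq_of_mem heF]
  obtain ⟨a, b, hab⟩ := Graph.exists_isLink_of_mem_edgeSet hw.edge_mem
  refine hF.insert_cycle_edge hΓ hab (fun hjoin => ?_) hw hj
  have hmem : ∀ g ∈ E(Γ.cycle j), g ≠ e → g ∈ F := fun g =>
    hF.1.mem_of_joined hΓ hab heF hjoin
  obtain ⟨n, v, g, hC, rfl⟩ := (hΓ.isCycleGraph j).exists_enumeration_of_vertex hw.vertex_mem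
  obtain ⟨k, hk, rfl⟩ := hC.exists_edge f hf
  have hk0 := hfw _ (hC.isLink k).inc_left
  have hk1 := hfw _ (hC.isLink k).inc_right
  have hge : ∀ t, Γ.height (v 0) ≤ Γ.height (v t) := fun t => hj _ (hC.isLink t).left_mem
  -- `v s` and `v r` are the vertices of minimal height nearest to `f = g k` on either side, where
  -- `r = n + 1` stands for `v 0` again. Since the ends of `f` are higher, `s + 1 ≤ k` and `k + 1 ≤
  -- r - 1`.
  obtain ⟨s, hsk, hs, hs'⟩ : ∃ s ≤ k, Γ.height (v s) = Γ.height (v 0) ∧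
      ∀ t, s < t → t ≤ k → Γ.height (v t) ≠ Γ.height (v 0) := by
    classical
    exact ⟨Nat.findGreatest (fun t => Γ.height (v t) = Γ.height (v 0)) k,
      Nat.findGreatest_le k,
      Nat.findGreatest_spec (P := fun t => Γ.height (v t) = Γ.height (v 0)) (Nat.zero_le k) rfl,
      fun t ht htk => Nat.findGreatest_is_greatest
        (P := fun t => Γ.height (v t) = Γ.height (v 0)) ht htk⟩
  have hex : ∃ t, k + 1 ≤ t ∧ Γ.height (v t) = Γ.height (v 0) :=
    ⟨n + 1, by omega, by rw [hC.vertex_period]⟩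
  obtain ⟨r, hrn, ⟨hkr, hr⟩, hr'⟩ : ∃ r ≤ n + 1, (k + 1 ≤ r ∧ Γ.height (v r) = Γ.height (v 0)) ∧
      ∀ t, k + 1 ≤ t → t < r → Γ.height (v t) ≠ Γ.height (v 0) := by
    classical
    exact ⟨Nat.find hex, Nat.find_min' hex ⟨by omega, by rw [hC.vertex_period]⟩,
      Nat.find_spec hex, fun t ht htr h => Nat.find_min hex htr ⟨ht, h⟩⟩
  have hsk' : s ≠ k := by rintro rfl; exact hk0 hs
  have hkr' : r ≠ k + 1 := by rintro rfl; exact hk1 hr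
  obtain ⟨q, rfl⟩ : ∃ q, r = q + 1 := ⟨r - 1, by omega⟩
  have hgt : ∀ t, s < t → t ≤ q → Γ.height (v 0) + 1 ≤ Γ.height (v t) := by
    intro t hst htq
    have h1 := hge t
    have h2 : Γ.height (v t) ≠ Γ.height (v 0) := by
      rcases le_or_gt t k with h | h
      · exact hs' t hst h
      · exact hr' t h (by omega)
    omega
  have hx : Γ.height (v (s + 1)) = Γ.height (v 0) + 1 := by
    have h1 := hΓ.height_le ((hC.isLink s).mono (hΓ.cycle_le j))
    have h2 := hgt (s + 1) (by omega) (by omega)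
    omega
  have hy : Γ.height (v q) = Γ.height (v 0) + 1 := by
    have h1 := hΓ.height_le ((hC.isLink q).mono (hΓ.cycle_le j)).symm
    have h2 := hgt q (by omega) (by omega)
    omega
  have hne : v (s + 1) ≠ v q := fun h => by
    have := hC.vertex_injOn (by omega) (by omega) h
    omega
  have harc : ((Γ.cycle j).restrict (Γ.upper F (Γ.height (v 0) + 1))).Joined (v (s + 1)) (v q) := by
    refine hC.joined_arc (by omega) fun t hst htq => ?_
    have hinc : ∀ z, Γ.graph.Inc (g t) z → Γ.height (v 0) + 1 ≤ Γ.height z := by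
      intro z hz
      rcases hz.eq_or_eq_of_isLink ((hC.isLink t).mono (hΓ.cycle_le j)) with rfl | rfl
      · exact hgt t (by omega) (by omega)
      · exact hgt (t + 1) (by omega) (by omega)
    refine ⟨hmem _ (hC.isLink t).edge_mem ?_, hinc⟩
    rintro rfl
    have := hinc _ (hw.mono (hΓ.cycle_le j))
    omega
  obtain ⟨l, hl, -, habove⟩ := (hF.2 _).exists_cycle (v (s + 1))
    ⟨hΓ.mem_graph (hC.isLink _).left_mem, hx⟩ (v q) ⟨hΓ.mem_graph (hC.isLink _).left_mem, hy⟩ hne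
    (harc.restrict_mono_left (hΓ.cycle_le j))
  obtain rfl := hΓ.eq_of_mem hl (hC.isLink _).left_mem
  have := habove _ hw.vertex_mem
  omega

end DistinguishedGraph

/-! ### Bounded sets of edges -/

namespace DistinguishedGraph

variable {α β : Type*} {m : ℕ} {Γ : DistinguishedGraph α β m} {F F' : Set β} {e f : β}
  {a b x y z u v w : α} {d i k : ℕ} {j l : Fin m}

/-- `v` lies in no distinguished cycle. -/
def IsOffCycles (Γ : DistinguishedGraph α β m) (v : α) : Prop :=
  v ∈ V(Γ.graph) ∧ ∀ j, v ∉ V(Γ.cycle j)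

/-- `e` leads from `v` to the next lower level. -/
def IsDownEdge (Γ : DistinguishedGraph α β m) (e : β) (v : α) : Prop :=
  ∃ u, Γ.graph.IsLink e v u ∧ Γ.height v = Γ.height u + 1

/-- Every edge of a distinguished cycle has an end which is a base vertex of the cycle. -/
def IsShallow (Γ : DistinguishedGraph α β m) : Prop :=
  ∀ j, ∀ f ∈ E(Γ.cycle j), ∃ v, (Γ.cycle j).Inc f v ∧ Γ.CycleAbove (Γ.height v) j

/-- `F` consists of edges of distinguished cycles and of downward edges from vertices off these
cycles, it contains none of these cycles, and at most one downward edge from each vertex off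
these cycles. -/
structure IsBounded (Γ : DistinguishedGraph α β m) (F : Set β) : Prop where
  mem : ∀ e ∈ F, (∃ j, e ∈ E(Γ.cycle j)) ∨ ∃ v, Γ.IsOffCycles v ∧ Γ.IsDownEdge e v
  not_subset : ∀ j, ¬ E(Γ.cycle j) ⊆ F
  eq_of_isDownEdge : ∀ v, Γ.IsOffCycles v → ∀ e ∈ F, ∀ f ∈ F, Γ.IsDownEdge e v →
    Γ.IsDownEdge f v → e = f

theorem IsOffCycles.notMem_edgeSet (hΓ : Γ.IsWellFormed) (hv : Γ.IsOffCycles v)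
    (h : Γ.graph.Inc e v) (j : Fin m) : e ∉ E(Γ.cycle j) := by
  intro he
  obtain ⟨a, b, hab⟩ := Graph.exists_isLink_of_mem_edgeSet he
  rcases h.eq_or_eq_of_isLink (hab.mono (hΓ.cycle_le j)) with rfl | rfl
  · exact hv.2 j hab.left_mem
  · exact hv.2 j hab.right_mem

theorem IsDownEdge.inc (h : Γ.IsDownEdge e v) : Γ.graph.Inc e v := by
  obtain ⟨u, hu, -⟩ := h
  exact hu.inc_left

theorem IsDownEdge.eq (h : Γ.IsDownEdge e v) (h' : Γ.IsDownEdge e w) : v = w := by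
  obtain ⟨u, hu, hh⟩ := h
  obtain ⟨u', hu', hh'⟩ := h'
  rcases hu.eq_and_eq_or_eq_and_eq hu' with ⟨h, -⟩ | ⟨rfl, rfl⟩
  · exact h
  · omega

theorem IsWellFormed.eq_of_mem_edgeSet (hΓ : Γ.IsWellFormed) (hj : e ∈ E(Γ.cycle j))
    (hl : e ∈ E(Γ.cycle l)) : j = l := by
  obtain ⟨a, b, hab⟩ := Graph.exists_isLink_of_mem_edgeSet hj
  obtain ⟨c, d, hcd⟩ := Graph.exists_isLink_of_mem_edgeSet hl
  rcases (hab.mono (hΓ.cycle_le j)).eq_and_eq_or_eq_and_eq (hcd.mono (hΓ.cycle_le l)) with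
    ⟨rfl, rfl⟩ | ⟨rfl, rfl⟩
  · exact hΓ.eq_of_mem hab.left_mem hcd.left_mem
  · exact hΓ.eq_of_mem hab.left_mem hcd.right_mem

/-- An edge of the cycle at `x` has an end of minimal height, which is at most one level below `x`.
-/
theorem IsShallow.cycleAbove (hΓ : Γ.IsWellFormed) (hs : Γ.IsShallow) (hx : x ∈ V(Γ.cycle l))
    (h : Γ.height x = i + 1) : Γ.CycleAbove i l := by
  obtain ⟨n, v, e, hC, rfl⟩ := (hΓ.isCycleGraph l).exists_enumeration_of_vertex hx
  obtain ⟨w, hw, hl⟩ := hs l (e 0) (hC.isLink 0).edge_mem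
  have hlink := (hC.isLink 0).mono (hΓ.cycle_le l)
  have hle : i ≤ Γ.height w := by
    rcases hw.eq_or_eq_of_isLink (hC.isLink 0) with rfl | rfl
    · omega
    · have := hΓ.height_le hlink.symm
      omega
  exact fun z hz => hle.trans (hl z hz)

theorem IsAdmissible.joined_diff_singleton (hΓ : Γ.IsWellFormed) (hF : Γ.IsAdmissible F)
    (hx : x ∈ V(Γ.cycle l)) (hy : y ∈ V(Γ.cycle l)) (h : (Γ.graph.restrict F).Joined x y)
    (he : e ∉ E(Γ.cycle l)) : (Γ.graph.restrict (F \ {e})).Joined x y := by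
  refine (hF.joined_in_cycle l x hx y hy h).induction (.refl _ x) ?_
  rintro f z w ⟨hf, hl⟩ hz
  refine hz.trans ((hl.mono (hΓ.cycle_le l)).joined_restrict ⟨hf, ?_⟩)
  rintro rfl
  exact he hl.edge_mem

/-- Otherwise the ends of `e` would also be joined along the cycle within `F`, closing a circuit. -/
theorem IsAdmissible.mem_edgeSet (hΓ : Γ.IsWellFormed) (hF : Γ.IsAdmissible F) (heF : e ∈ F)
    (he : Γ.graph.IsLink e x y) (hx : x ∈ V(Γ.cycle l)) (hy : y ∈ V(Γ.cycle l)) :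
    e ∈ E(Γ.cycle l) := by
  by_contra hel
  exact hF.isForest.not_joined heF he
    (hF.joined_diff_singleton hΓ hx hy (he.joined_restrict heF) hel)

theorem mem_upper (he : Γ.graph.IsLink e x y) (heF : e ∈ F) (hx : k ≤ Γ.height x)
    (hy : k ≤ Γ.height y) : e ∈ Γ.upper F k := by
  refine ⟨heF, fun v hv => ?_⟩
  rcases hv.eq_or_eq_of_isLink he with rfl | rfl
  · exact hx
  · exact hy

/-- Niceness at the lower end of an edge puts both ends on a common cycle if the edge is horizontal
or if its upper end is on a cycle; the edge then belongs to this cycle. Two downward edges from `v`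
off the cycles would end at the same vertex or on a common cycle, and either way produce a circuit.
-/
theorem IsTotallyNice.isBounded (hΓ : Γ.IsWellFormed) (hs : Γ.IsShallow)
    (hF : Γ.IsTotallyNice F) : Γ.IsBounded F := by
  refine ⟨fun e he => ?_, fun j hj => ?_, ?_⟩
  · by_contra! hcon
    obtain ⟨hcyc, hdown⟩ := hcon
    obtain ⟨x, y, hxy, hle⟩ : ∃ x y, Γ.graph.IsLink e x y ∧ Γ.height x ≤ Γ.height y := by
      obtain ⟨a, b, hab⟩ := Graph.exists_isLink_of_mem_edgeSet (hF.1.isForest.1 he)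
      rcases le_total (Γ.height a) (Γ.height b) with h | h
      · exact ⟨a, b, hab, h⟩
      · exact ⟨b, a, hab.symm, h⟩
    have hj := hxy.joined_restrict (mem_upper hxy he le_rfl hle)
    rcases hle.eq_or_lt with heq | hlt
    · by_cases hne : x = y
      · subst hne
        exact hF.1.isForest.not_joined he hxy (.refl _ x)
      · obtain ⟨l, hx, hy, -⟩ := (hF.2 _).exists_cycle x ⟨hxy.left_mem, rfl⟩ y
          ⟨hxy.right_mem, heq.symm⟩ hne hj
        exact hcyc l (hF.1.mem_edgeSet hΓ he hxy hx hy)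
    · have hh : Γ.height y = Γ.height x + 1 := by
        have := hΓ.height_le hxy
        omega
      refine hdown y ⟨hxy.right_mem, fun l hl => ?_⟩ ⟨x, hxy.symm, hh⟩
      have hx := (hF.2 _).mem_cycle x ⟨hxy.left_mem, rfl⟩ l (hs.cycleAbove hΓ hl hh) y hl hj
      exact hcyc l (hF.1.mem_edgeSet hΓ he hxy hx hl)
  · exact hF.1.isForest.2 (Γ.cycle j) ⟨(hΓ.cycle_le j).vertexSet_mono, fun _ _ _ h =>
      ⟨hj h.edge_mem, h.mono (hΓ.cycle_le j)⟩⟩ (hΓ.isCycleGraph j)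
  · rintro v hv e he f hf hev ⟨u', hu', hh'⟩
    by_contra hef
    have hoff := hv.notMem_edgeSet hΓ hev.inc
    obtain ⟨u, hu, hh⟩ := hev
    have hf' := hu'.joined_restrict (F := F \ {e}) ⟨hf, fun h => hef h.symm⟩
    refine hF.1.isForest.not_joined he hu ?_
    by_cases huu : u = u'
    · rwa [huu]
    · have hj : (Γ.graph.restrict (Γ.upper F (Γ.height u))).Joined u u' :=
        (hu.joined_restrict (mem_upper hu he (by omega) le_rfl)).symm.trans
          (hu'.joined_restrict (mem_upper hu' hf (by omega) (by omega)))
      obtain ⟨l, hl, hl', -⟩ := (hF.2 _).exists_cycle u ⟨hu.right_mem, rfl⟩ u'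
        ⟨hu'.right_mem, by omega⟩ huu hj
      exact hf'.trans (hF.1.joined_diff_singleton hΓ hl hl' (hj.restrict_mono upper_subset)
        (hoff l)).symm

theorem IsBounded.mono (hF : Γ.IsBounded F') (h : F ⊆ F') : Γ.IsBounded F :=
  ⟨fun e he => hF.mem e (h he), fun j hj => hF.not_subset j (hj.trans h),
    fun v hv e he f hf => hF.eq_of_isDownEdge v hv e (h he) f (h hf)⟩

/-- From `v` one can only climb: each further vertex has at most one downward edge in `F`, the one
by which it was reached. -/
theorem IsBounded.of_joined (hΓ : Γ.IsWellFormed) (hF : Γ.IsBounded F) (hv : Γ.IsOffCycles v)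
    (hno : ∀ g ∈ F, ¬ Γ.IsDownEdge g v) (h : (Γ.graph.restrict F).Joined v z) :
    Γ.IsOffCycles z ∧ (z = v ∨ Γ.height v < Γ.height z) := by
  let r : α → α → Prop := fun s t => Γ.IsOffCycles t ∧
    ∃ g ∈ F, Γ.graph.IsLink g t s ∧ Γ.height t = Γ.height s + 1
  have hr : ∀ z, Relation.ReflTransGen r v z →
      Γ.IsOffCycles z ∧ (z = v ∨ Γ.height v < Γ.height z) := by
    intro z hz
    induction hz with
    | refl => exact ⟨hv, Or.inl rfl⟩
    | tail _ hst ih =>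
      obtain ⟨ht, g, -, -, hh⟩ := hst
      refine ⟨ht, Or.inr ?_⟩
      rcases ih.2 with rfl | h <;> omega
  refine hr z (h.induction (P := Relation.ReflTransGen r v) .refl ?_)
  rintro g z w ⟨hg, hl⟩ hz
  have hoff := (hr z hz).1
  rcases hF.mem g hg with ⟨j, hj⟩ | ⟨t, ht, s, hst, hh⟩
  · exact absurd hj (hoff.notMem_edgeSet hΓ hl.inc_left j)
  · rcases hl.eq_and_eq_or_eq_and_eq hst with ⟨rfl, rfl⟩ | ⟨rfl, rfl⟩
    · rcases hz.cases_tail with rfl | ⟨s', hs', -, g', hg', hl', hh'⟩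
      · exact absurd ⟨_, hst, hh⟩ (hno g hg)
      · obtain rfl := hF.eq_of_isDownEdge _ hoff g hg g' hg' ⟨_, hst, hh⟩ ⟨_, hl', hh'⟩
        rwa [hst.right_unique hl']
    · exact hz.tail ⟨ht, g, hg, hst, hh⟩

/-- By `IsBounded.of_joined` the tree of `v` meets no distinguished cycle and no level below `v`.
Hanging it on `u` creates no new connections between cycle vertices or between vertices of a level
up to that of `u`. -/
theorem IsTotallyNice.insert_isDownEdge (hΓ : Γ.IsWellFormed) (hF : Γ.IsTotallyNice F)
    (hB : Γ.IsBounded F) (hv : Γ.IsOffCycles v) (hno : ∀ g ∈ F, ¬ Γ.IsDownEdge g v)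
    (he : Γ.IsDownEdge e v) : Γ.IsTotallyNice (insert e F) := by
  obtain ⟨u, hu, hh⟩ := he
  have hK : ∀ z, (Γ.graph.restrict F).Joined v z → Γ.IsOffCycles z ∧ Γ.height v ≤ Γ.height z := by
    intro z hz
    obtain ⟨h1, rfl | h2⟩ := hB.of_joined hΓ hv hno hz
    · exact ⟨h1, le_rfl⟩
    · exact ⟨h1, h2.le⟩
  have hcyc : ∀ l, ∀ x ∈ V(Γ.cycle l), ¬ (Γ.graph.restrict F).Joined v x := fun l x hx h =>
    (hK x h).1.2 l hx
  have hjoin : ∀ j l, ∀ x ∈ V(Γ.cycle j), ∀ y ∈ V(Γ.cycle l),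
      (Γ.graph.restrict (insert e F)).Joined x y → (Γ.graph.restrict F).Joined x y := by
    intro j l x hx y hy h
    rcases Graph.joined_restrict_insert hu h with h | ⟨h1, h2⟩ | ⟨h1, h2⟩
    · exact h
    · exact absurd h1.symm (hcyc j x hx)
    · exact absurd h2 (hcyc l y hy)
  refine ⟨⟨hF.1.isForest.insert hu fun h => ?_, ?_, ?_⟩, fun k => ?_⟩
  · have := (hK u h).2
    omega
  · exact fun j l x hx y hy h => hF.1.eq_of_joined j l x hx y hy (hjoin j l x hx y hy h)
  · exact fun j x hx y hy h => (hF.1.joined_in_cycle j x hx y hy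
      (hjoin j j x hx y hy h)).restrict_mono (Set.subset_insert e F)
  · rcases lt_or_ge (Γ.height u) k with hk | hk
    · rw [upper_insert_of_lt hu.inc_right hk]
      exact hF.2 k
    · have hlevel : ∀ x ∈ Γ.level k, ¬ (Γ.graph.restrict (Γ.upper F k)).Joined v x := by
        intro x hx h
        have h1 := (hK x (h.restrict_mono upper_subset)).2
        have h2 := hx.2
        omega
      refine IsNice.mono ⟨fun x hx y hy hxy h => ?_, fun u' hu' j hj x hx h => ?_⟩
        upper_insert_subset
      · rcases Graph.joined_restrict_insert hu h with h | ⟨h1, h2⟩ | ⟨h1, h2⟩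
        · exact (hF.2 k).exists_cycle x hx y hy hxy h
        · exact absurd h1.symm (hlevel x hx)
        · exact absurd h2 (hlevel y hy)
      · rcases Graph.joined_restrict_insert hu h with h | ⟨h1, h2⟩ | ⟨h1, h2⟩
        · exact (hF.2 k).mem_cycle u' hu' j hj x hx h
        · exact absurd h1.symm (hlevel u' hu')
        · exact absurd (h2.restrict_mono upper_subset) (hcyc j x hx)

theorem IsBounded.isTotallyNice [Finite β] (hΓ : Γ.IsWellFormed) (hs : Γ.IsShallow)
    (hF : Γ.IsBounded F) : Γ.IsTotallyNice F := by
  induction F, F.toFinite using Set.Finite.induction_on with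
  | empty => exact isTotallyNice_empty hΓ
  | @insert e F heF _ ih =>
    have hB := hF.mono (Set.subset_insert e F)
    have hN := ih hB
    rcases hF.mem e (Set.mem_insert e F) with ⟨j, hj⟩ | ⟨v, hv, he⟩
    · obtain ⟨w, hw, habove⟩ := hs j e hj
      obtain ⟨a, b, hab⟩ := Graph.exists_isLink_of_mem_edgeSet hj
      refine hN.insert_cycle_edge hΓ hab (fun h => hF.not_subset j fun f hf => ?_) hw habove
      by_cases hfe : f = e
      · exact Or.inl hfe
      · exact Or.inr (hN.1.mem_of_joined hΓ hab heF h hf hfe)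
    · refine hN.insert_isDownEdge hΓ hB hv (fun g hg hgv => heF ?_) he
      rwa [hF.eq_of_isDownEdge v hv e (Set.mem_insert e F) g (Or.inr hg) he hgv]

theorem isTotallyNice_iff_isBounded [Finite β] (hΓ : Γ.IsWellFormed) (hs : Γ.IsShallow) :
    Γ.IsTotallyNice F ↔ Γ.IsBounded F :=
  ⟨fun h => h.isBounded hΓ hs, fun h => h.isTotallyNice hΓ hs⟩

end DistinguishedGraph

/-! ### Bounded sets of edges and partitions -/

namespace DistinguishedGraph

variable {α β : Type*} {m : ℕ} {Γ : DistinguishedGraph α β m} {F : Set β} {e : β}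
  {v : α} {j : Fin m}

/-- The block of an edge: the distinguished cycle it belongs to, or else its upper end. -/
noncomputable def block (Γ : DistinguishedGraph α β m) (e : β) : α ⊕ Fin m :=
  open scoped Classical in
  if h : ∃ j, e ∈ E(Γ.cycle j) then Sum.inr h.choose
  else if h : ∃ v, Γ.IsDownEdge e v then Sum.inl h.choose else Sum.inl Γ.base

/-- The maximal number of edges of a block which a bounded set may contain. -/
noncomputable def capacity (Γ : DistinguishedGraph α β m) : α ⊕ Fin m → ℕ
  | Sum.inl v => open scoped Classical in if Γ.IsOffCycles v ∧ v ≠ Γ.base then 1 else 0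
  | Sum.inr j => E(Γ.cycle j).ncard - 1

/-- The set of the edges which may occur in bounded sets. -/
def blockEdges (Γ : DistinguishedGraph α β m) : Set β :=
  {e | (∃ j, e ∈ E(Γ.cycle j)) ∨ ∃ v, Γ.IsOffCycles v ∧ Γ.IsDownEdge e v}

theorem block_eq_inr (hΓ : Γ.IsWellFormed) (he : e ∈ E(Γ.cycle j)) : Γ.block e = Sum.inr j := by
  have h : ∃ j, e ∈ E(Γ.cycle j) := ⟨j, he⟩
  rw [block, dif_pos h, hΓ.eq_of_mem_edgeSet h.choose_spec he]

theorem block_eq_inl (hΓ : Γ.IsWellFormed) (hv : Γ.IsOffCycles v) (he : Γ.IsDownEdge e v) :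
    Γ.block e = Sum.inl v := by
  have h : ¬ ∃ j, e ∈ E(Γ.cycle j) := fun ⟨j, hj⟩ => hv.notMem_edgeSet hΓ he.inc j hj
  have h' : ∃ v, Γ.IsDownEdge e v := ⟨v, he⟩
  rw [block, dif_neg h, dif_pos h', h'.choose_spec.eq he]

theorem mem_cycle_of_block_eq (hΓ : Γ.IsWellFormed) (he : e ∈ Γ.blockEdges)
    (h : Γ.block e = Sum.inr j) : e ∈ E(Γ.cycle j) := by
  rcases he with ⟨l, hl⟩ | ⟨v, hv, hev⟩
  · rw [block_eq_inr hΓ hl, Sum.inr.injEq] at h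
    exact h ▸ hl
  · rw [block_eq_inl hΓ hv hev] at h
    exact absurd h (by simp)

theorem isDownEdge_of_block_eq (hΓ : Γ.IsWellFormed) (he : e ∈ Γ.blockEdges)
    (h : Γ.block e = Sum.inl v) : Γ.IsOffCycles v ∧ Γ.IsDownEdge e v := by
  rcases he with ⟨l, hl⟩ | ⟨w, hw, hev⟩
  · rw [block_eq_inr hΓ hl] at h
    exact absurd h (by simp)
  · rw [block_eq_inl hΓ hw hev, Sum.inl.injEq] at h
    exact h ▸ ⟨hw, hev⟩

theorem IsDownEdge.ne_base (h : Γ.IsDownEdge e v) : v ≠ Γ.base := by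
  rintro rfl
  obtain ⟨u, -, hh⟩ := h
  rw [height_base] at hh
  omega

theorem IsWellFormed.ncard_edgeSet (hΓ : Γ.IsWellFormed) (j : Fin m) :
    E(Γ.cycle j).ncard = V(Γ.cycle j).ncard := by
  obtain ⟨n, v, e, h⟩ := (hΓ.isCycleGraph j).exists_enumeration
  rw [h.ncard_edgeSet, h.ncard_vertexSet]

theorem IsWellFormed.ncard_vertexSet_pos (hΓ : Γ.IsWellFormed) (j : Fin m) :
    0 < V(Γ.cycle j).ncard := by
  obtain ⟨n, v, e, h⟩ := (hΓ.isCycleGraph j).exists_enumeration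
  rw [h.ncard_vertexSet]
  omega

theorem isBounded_iff [Finite β] (hΓ : Γ.IsWellFormed) :
    Γ.IsBounded F ↔
      F ⊆ Γ.blockEdges ∧ ∀ b, (F ∩ Γ.block ⁻¹' {b}).ncard ≤ Γ.capacity b := by
  constructor
  · refine fun hF => ⟨hF.mem, ?_⟩
    rintro (v | j)
    · have hmem : ∀ e ∈ F ∩ Γ.block ⁻¹' {Sum.inl v}, Γ.IsOffCycles v ∧ Γ.IsDownEdge e v :=
        fun e he => isDownEdge_of_block_eq hΓ (hF.mem e he.1) he.2
      by_cases hv : Γ.IsOffCycles v ∧ v ≠ Γ.base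
      · rw [capacity, if_pos hv, Set.ncard_le_one]
        exact fun e he f hf => hF.eq_of_isDownEdge v hv.1 e he.1 f hf.1 (hmem e he).2 (hmem f hf).2
      · rw [capacity, if_neg hv, Nat.le_zero, Set.ncard_eq_zero]
        exact Set.eq_empty_of_forall_notMem fun e he =>
          hv ⟨(hmem e he).1, (hmem e he).2.ne_base⟩
    · have hlt : (F ∩ Γ.block ⁻¹' {Sum.inr j}).ncard < E(Γ.cycle j).ncard := by
        refine Set.ncard_lt_ncard ⟨fun e he => mem_cycle_of_block_eq hΓ (hF.mem e he.1) he.2,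
          fun h => hF.not_subset j fun e he => (h he).1⟩
      rw [capacity]
      omega
  · rintro ⟨hsub, hcap⟩
    refine ⟨hsub, fun j hj => ?_, fun v hv e he f hf hev hfv => ?_⟩
    · have h1 : E(Γ.cycle j).ncard ≤ (F ∩ Γ.block ⁻¹' {Sum.inr j}).ncard :=
        Set.ncard_le_ncard fun e he => ⟨hj he, block_eq_inr hΓ he⟩
      have h2 := hcap (Sum.inr j)
      have h3 := hΓ.ncard_vertexSet_pos j
      rw [capacity] at h2
      rw [← hΓ.ncard_edgeSet] at h3
      omega
    · have h := hcap (Sum.inl v)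
      rw [capacity, if_pos ⟨hv, hev.ne_base⟩, Set.ncard_le_one] at h
      exact h e ⟨he, block_eq_inl hΓ hv hev⟩ f ⟨hf, block_eq_inl hΓ hv hfv⟩

/-- Every vertex other than the basepoint has a downward edge, so the capacities can be attained and
their sum is the rank. -/
theorem capacity_le [Finite β] (hΓ : Γ.IsWellFormed) (b : α ⊕ Fin m) :
    Γ.capacity b ≤ (Γ.blockEdges ∩ Γ.block ⁻¹' {b}).ncard := by
  rcases b with v | j
  · by_cases hv : Γ.IsOffCycles v ∧ v ≠ Γ.base
    · rw [capacity, if_pos hv, Nat.succ_le_iff, Set.ncard_pos]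
      obtain ⟨e, y, hl, hh⟩ := hΓ.exists_isLink_down hv.1.1
        fun h => hv.2 (hΓ.eq_base hv.1.1 h)
      exact ⟨e, Or.inr ⟨v, hv.1, y, hl, hh⟩, block_eq_inl hΓ hv.1 ⟨y, hl, hh⟩⟩
    · rw [capacity, if_neg hv]
      exact Nat.zero_le _
  · exact (Nat.sub_le _ _).trans (Set.ncard_le_ncard fun e he =>
      ⟨Or.inl ⟨j, he⟩, block_eq_inr hΓ he⟩)

theorem numVertices_eq [Finite α] (hΓ : Γ.IsWellFormed) :
    Γ.numVertices = {v | Γ.IsOffCycles v}.ncard + ∑ j, V(Γ.cycle j).ncard := by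
  have hU : (⋃ j, V(Γ.cycle j)).ncard = ∑ j, V(Γ.cycle j).ncard := by
    rw [Set.ncard_iUnion_of_finite (fun j => Set.toFinite _)
      (fun j k hjk => hΓ.disjoint j k hjk), finsum_eq_sum_of_fintype]
  rw [numVertices, ← hU, ← Set.ncard_union_eq]
  · congr 1
    ext v
    simp only [Set.mem_union, Set.mem_ofPred_eq, Set.mem_iUnion, IsOffCycles]
    constructor
    · intro hv
      by_cases h : ∃ j, v ∈ V(Γ.cycle j)
      · exact Or.inr h
      · exact Or.inl ⟨hv, fun j hj => h ⟨j, hj⟩⟩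
    · rintro (h | ⟨j, hj⟩)
      · exact h.1
      · exact hΓ.mem_graph hj
  · rw [Set.disjoint_left]
    intro v hv hv'
    obtain ⟨j, hj⟩ := Set.mem_iUnion.1 hv'
    exact hv.2 j hj

theorem sum_capacity [Fintype α] (hΓ : Γ.IsWellFormed) :
    ((∑ b, Γ.capacity b : ℕ) : ℤ) =
      (Γ.numVertices : ℤ) - (Γ.numCyclesOffBase : ℤ) - 1 := by
  have h1 : ∑ v, Γ.capacity (Sum.inl v) = ({v | Γ.IsOffCycles v} \ {Γ.base}).ncard := by
    classical
    simp only [capacity]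
    rw [Finset.sum_boole, ← Set.ncard_coe_finset]
    simp [Set.sdiff_eq, Set.ofPred_and, Set.compl_def]
  have h2 : ∑ j, Γ.capacity (Sum.inr j) + m = ∑ j, V(Γ.cycle j).ncard := by
    have : ∀ j, V(Γ.cycle j).ncard = Γ.capacity (Sum.inr j) + 1 := fun j => by
      have := hΓ.ncard_vertexSet_pos j
      rw [capacity, hΓ.ncard_edgeSet]
      omega
    simp [this, Finset.sum_add_distrib]
  -- The `1` comes from the basepoint, whose block has capacity zero, or from the cycle through the
  -- basepoint, which `numCyclesOffBase` omits.
  have h3 : ({v | Γ.IsOffCycles v} \ {Γ.base}).ncard + Γ.numCyclesOffBase + 1 =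
      {v | Γ.IsOffCycles v}.ncard + m := by
    by_cases h : Γ.IsOffCycles Γ.base
    · have h4 := Set.ncard_sdiff_singleton_add_one (s := {v | Γ.IsOffCycles v}) h
      have h5 : {j | Γ.base ∉ V(Γ.cycle j)} = Set.univ := Set.eq_univ_of_forall h.2
      rw [numCyclesOffBase, h5, Set.ncard_univ, Nat.card_fin]
      omega
    · rw [Set.sdiff_singleton_eq_self (s := {v | Γ.IsOffCycles v}) h]
      obtain ⟨l, hl⟩ : ∃ l, Γ.base ∈ V(Γ.cycle l) := by
        by_contra! hcon
        exact h ⟨hΓ.base_mem, hcon⟩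
      have h5 : {j | Γ.base ∉ V(Γ.cycle j)} = Set.univ \ {l} := by
        ext j
        refine ⟨fun hj => ⟨trivial, ?_⟩, fun hj hj' => hj.2 (hΓ.eq_of_mem hj' hl)⟩
        rintro rfl
        exact hj hl
      have h6 := Set.ncard_sdiff_singleton_add_one (Set.mem_univ l)
      rw [Set.ncard_univ, Nat.card_fin] at h6
      rw [numCyclesOffBase, h5]
      omega
  have h4 := numVertices_eq hΓ
  rw [Fintype.sum_sum_type]
  omega

end DistinguishedGraph

/-! ### The poset of good forests -/

namespace DistinguishedGraph

variable {α β : Type*} {m : ℕ} {Γ : DistinguishedGraph α β m} {e f : β} {w : α} {j : Fin m}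

/-- The set of good forests. -/
def goodForests (Γ : DistinguishedGraph α β m) : Set (Set β) :=
  {F | F.Nonempty ∧ Γ.IsAdmissible F ∧ Γ.IsGood F}

/-- The set of non-empty totally nice forests. -/
def niceForests (Γ : DistinguishedGraph α β m) : Set (Set β) :=
  {F | F.Nonempty ∧ Γ.IsTotallyNice F}

open Classical in
-- For a good `F` that is not totally nice, joining with the edge `e` of `IsGood.exists_insert` maps
-- the totally nice forests below `F` to themselves: the result stays below `F` because it cannot
-- equal `F`. Forests above `F` already contain `e`.
theorem goodForests_collapsesTo [Finite α] [Finite β] (hΓ : Γ.IsWellFormed) :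
    CollapsesTo (orderComplex Γ.goodForests) (orderComplex Γ.niceForests) := by
  refine collapsesTo_orderComplex (fun F hF => ⟨hF.1, hF.2.1, hF.2.isGood hΓ⟩) ?_
  rintro F ⟨⟨hne, hadm, hgood⟩, hF⟩
  obtain ⟨e, he, hins⟩ := hgood.exists_insert hΓ hne hadm
  have hmem : ∀ G, Γ.IsTotallyNice G → G ⊆ F →
      insert e G ∈ {G | G ∈ Γ.niceForests ∧ G < F} := fun G hG hGF => by
    have hG' := hins G hG hGF
    have hsub : insert e G ⊆ F := Set.insert_subset he hGF
    refine ⟨⟨Set.insert_nonempty e G, hG'⟩, lt_of_le_of_ne hsub ?_⟩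
    intro h
    exact hF ⟨hne, h ▸ hG'⟩
  have hsingle := hmem ∅ (isTotallyNice_empty hΓ) (Set.empty_subset F)
  rw [insert_empty_eq] at hsingle
  refine isCollapsible_of_sup_mem (a := {e}) (Or.inl hsingle) ?_
  rintro G (⟨hG, hGF⟩ | ⟨hG, hFG⟩)
  · rw [show G ⊔ {e} = insert e G from Set.union_singleton]
    exact Or.inl (hmem G hG.2 hGF.le)
  · rw [sup_eq_left.2 (Set.singleton_subset_iff.2 (hFG.le he))]
    exact Or.inr ⟨hG, hFG⟩

open Classical in
theorem isCollapsible_niceForests [Finite β] (hΓ : Γ.IsWellFormed)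
    (hw : (Γ.cycle j).Inc e w) (hj : Γ.CycleAbove (Γ.height w) j) (hf : f ∈ E(Γ.cycle j))
    (hfw : ∀ v, (Γ.cycle j).Inc f v → Γ.height v ≠ Γ.height w) :
    IsCollapsible (orderComplex Γ.niceForests) := by
  have hins : ∀ F, Γ.IsTotallyNice F → insert e F ∈ Γ.niceForests := fun F hF =>
    ⟨Set.insert_nonempty e F, hF.insert_of_height_ne hΓ hw hj hf hfw⟩
  have hsingle := hins ∅ (isTotallyNice_empty hΓ)
  rw [insert_empty_eq] at hsingle
  refine isCollapsible_of_sup_mem hsingle fun F hF => ?_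
  rw [show F ⊔ {e} = insert e F from Set.union_singleton]
  exact hins F hF.2

open Classical in
theorem isSpherical_niceForests [Fintype α] [Finite β] (hΓ : Γ.IsWellFormed) (hs : Γ.IsShallow) :
    IsSpherical (∑ b, Γ.capacity b) (orderComplex Γ.niceForests) := by
  have heq : Γ.niceForests = boundedSets Γ.block Γ.capacity ∅ Γ.blockEdges := by
    ext F
    rw [niceForests, boundedSets, Set.mem_ofPred_eq, Set.mem_ofPred_eq,
      isTotallyNice_iff_isBounded hΓ hs, isBounded_iff hΓ, Set.empty_ssubset]
  rw [heq]
  exact isSpherical_boundedSets _ _ ∅ _ _ (Set.empty_subset _) (by simp) (capacity_le hΓ) (by simp)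

open Classical in
-- In the shallow case `Y` consists of all non-empty totally nice forests; otherwise these collapse
-- to a single point. The condition `∅ ∉ Y` leaves `∅` free as the apex of a cone.
theorem exists_isSpherical [Fintype α] [Finite β] (hΓ : Γ.IsWellFormed) :
    ∃ Y : Set (Set β), ∅ ∉ Y ∧ CollapsesTo (orderComplex Γ.niceForests) (orderComplex Y) ∧
      IsSpherical (∑ b, Γ.capacity b) (orderComplex Y) := by
  by_cases hs : Γ.IsShallow
  · exact ⟨Γ.niceForests, fun h => by simpa using h.1, .refl, isSpherical_niceForests hΓ hs⟩
  rw [IsShallow] at hs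
  push Not at hs
  obtain ⟨j, f, hf, hfj⟩ := hs
  obtain ⟨w, hw, hj⟩ : ∃ w ∈ V(Γ.cycle j), Γ.CycleAbove (Γ.height w) j := by
    obtain ⟨a, b, hab⟩ := Graph.exists_isLink_of_mem_edgeSet hf
    obtain ⟨w, hw, hmin⟩ := exists_minimalFor_of_wellFoundedLT (· ∈ V(Γ.cycle j)) Γ.height
      ⟨a, hab.left_mem⟩
    exact ⟨w, hw, fun z hz => (le_total _ _).elim id (hmin hz)⟩
  obtain ⟨n, v, g, hC, rfl⟩ := (hΓ.isCycleGraph j).exists_enumeration_of_vertex hw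
  have hinc := (hC.isLink 0).inc_left
  have hfw : ∀ z, (Γ.cycle j).Inc f z → Γ.height z ≠ Γ.height (v 0) := fun z hz h =>
    hfj z hz (h ▸ hj)
  obtain ⟨F, hF⟩ := isCollapsible_niceForests hΓ hinc hj hf hfw
  have hn : 1 ≤ n := by
    obtain ⟨i, hi, rfl⟩ := hC.exists_edge f hf
    by_contra hn
    obtain rfl : i = 0 := by omega
    exact hfw _ hinc rfl
  -- The dimension must leave room for a point: besides `g 0` the cycle has the edge `f`, so its
  -- capacity is positive.
  have hcap : 1 ≤ ∑ b, Γ.capacity b := by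
    refine le_trans ?_ (Finset.single_le_sum (f := Γ.capacity) (fun _ _ => Nat.zero_le _)
      (Finset.mem_univ (Sum.inr j)))
    rw [capacity, hC.ncard_edgeSet]
    omega
  rw [← orderComplex_singleton] at hF
  refine ⟨{F}, ?_, hF, IsCollapsible.isSpherical ⟨F, ?_⟩ ?_⟩
  · rintro h
    obtain rfl := Set.mem_singleton_iff.1 h
    have := (CollapsesTo.subset hF (by rw [orderComplex_singleton]; rfl : {∅} ∈ orderComplex {∅})).2.1
      (Finset.mem_coe.2 (Finset.mem_singleton_self _))
    simpa using this.1
  · rw [orderComplex_singleton]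
    exact .refl
  · rw [orderComplex_singleton]
    rintro s rfl
    simpa using hcap

end DistinguishedGraph

theorem mainTheorem5 {α β : Type*} [Finite α] [Finite β] {m : ℕ}
    (Γ : DistinguishedGraph α β m) (hΓ : Γ.IsWellFormed) :
    IsHomotopyWedgeOfSpheres (PosetRealization Γ.GoodForest)
      ((Γ.numVertices : ℤ) - (Γ.numCyclesOffBase : ℤ) - 2) := by
  classical
  have := Fintype.ofFinite α
  have := Fintype.ofFinite (Set β)
  obtain ⟨Y, hY, hcol, hsph⟩ := DistinguishedGraph.exists_isSpherical hΓ
  obtain ⟨E⟩ := CollapsesTo.nonempty_homotopyEquiv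
    ((DistinguishedGraph.goodForests_collapsesTo hΓ).trans hcol)
  have hhom := posetRealizationHomeomorph
    fun F : Set β => F.Nonempty ∧ Γ.IsAdmissible F ∧ Γ.IsGood F
  have hdim := DistinguishedGraph.sum_capacity hΓ
  rcases hr : ∑ b, Γ.capacity b with _ | n
  · rw [hr] at hsph hdim
    refine Or.inl ⟨by push_cast at hdim; omega, ⟨fun t => ?_⟩⟩
    -- In rank zero the support of a point would be a non-empty face with no vertices.
    have ht := (E (hhom t)).2.2.2
    have h1 := hsph.1 _ ht
    have h2 := Finset.card_pos.2 ht.1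
    omega
  · rw [hr] at hsph hdim
    obtain ⟨k, ⟨E'⟩⟩ := hsph.exists_homotopyEquiv (fun s hs => hs.1)
      (fun s hs ρ hρ hne => ⟨hne, fun a ha => hs.2.1 (hρ ha), hs.2.2.mono (Finset.coe_subset.2 hρ)⟩)
      (x := ∅) (notMem_of_mem_orderComplex hY)
    exact Or.inr ⟨n, k, by push_cast at hdim; omega,
      ⟨(hhom.toHomotopyEquiv.trans E).trans E'⟩⟩
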